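/- **Definitions.** Let $G$ be a finite simple graph with $n\ge 1$ nodes and connected components $G_1,\dots,G_m$, and let a *color palette* for $G$ be a multiset of $n-1$ colors. *Tubings.* A *tube* is a nonempty set of nodes inducing a connected subgraph. Two tubes are *compatible* if one properly contains the other, or if they are disjoint and not joined by an edge. A *tubing* is a set $T$ of pairwise compatible tubes that does not contain all of the components $G_1,\dots,G_m$, which are called the *universal tubes*. For $t\in T\cup\{G_1,\dots,G_m\}$, the *core* of $t$ in $T$ is the graph whose nodes are the nodes of $t$ in no tube $t'\in T$ with $t'\subsetneq t$, two of them being adjacent if they are adjacent in $G$ or are joined by a path through some such $t'$. Let $c_t$ be the number of nodes of the core and $k_t$ its connectivity (the least number of nodes whose removal disconnects it or leaves at most one node), except that $k_t:=1$ if $c_t=1$. *Templates.* A *color template* is a pair $(T,\mathcal O)$, where $T$ is a tubing and $\mathcal O$ distributes the palette into the following blocks. Each $t\in T\cup\{G_1,\dots,G_m\}$ has a color of $t$ if $t\in T$ (and none if $t\notin T$), then a sequence of $k_t-1$ outer blocks with one color each, then an unordered inner block with $c_t-k_t$ colors. In addition, there is an unordered universal block with $m-1-|T\cap\{G_1,\dots,G_m\}|$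 colors. A *listing* of the blocks of $t$ is a sequence consisting of the color of $t$ (if it has one), the outer colors in order, and the inner colors in any order. *Order.* Let $T=T'\cup\{t\}$ with $t\notin T'$. If $t$ is not a universal tube, let $s$ be the smallest element of $T'\cup\{G_1,\dots,G_m\}$ properly containing $t$; put $(T,\mathcal O)\prec(T',\mathcal O')$ if all blocks other than those of $s$ and $t$ agree, and there are listings $\ell_1$ of the blocks of $s$ in $\mathcal O$ and $\ell_2$ of the blocks of $t$ in $\mathcal O$ whose concatenation $\ell_1\ell_2$ is a listing of the blocks of $s$ in $\mathcal O'$. If $t$ is a universal tube, put $(T,\mathcal O)\prec(T',\mathcal O')$ if $\mathcal O$ arises from $\mathcal O'$ by moving one color of the universal block to the color of $t$. The *colorful graph associahedron* $\mathcal K_G$ is the set of color templates with the reflexive transitive closure of $\prec$. Regard it as a collection of posets, one for each connected component of this partially ordered set, each with a least face appended. *Polytopes.* An *abstract polytope* of rank $r$ is a poset with a least and a greatest face such that all flags (maximal chains) have $r+2$ faces, the poset is strongly flag-connected (any two flags $\Phi,\Psi$ are joined by a sequence of flags containing $\Phi\cap\Psi$, consecutive ones differing in exactly one face), and there are exactly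 two faces strictly between any two incident faces whose ranks differ by $2$. It is *simple* if the faces containing any given vertex form a Boolean lattice of rank $r$ (the vertex-figures are simplices). The product of polytopes is the Cartesian product: the product of their posets of faces other than the least one, with a least face appended. The product of collections consists of all products of members. **Theorem.** Let $G$ be a finite simple graph with $n\ge1$ nodes and connected components $G_1,\dots,G_m$, along with a color palette. Then $\mathcal K_G$ is a collection of simple abstract polytopes (of rank $n-1$). Moreover, each ordered partition of the palette into multisets $A_1,\dots,A_m,B$ of sizes $|G_1|-1,\dots,|G_m|-1,\,m-1$ corresponds to a nonempty subcollection of $\mathcal K_G$, namely that of the polytopes all of whose faces, for every $i$, use exactly the colors $A_i$ for the blocks of tubes contained in $G_i$ (without the color of $G_i$ itself), and the colors $B$ for the colors of universal tubes together with the universal block. Every polytope of $\mathcal K_G$ belongs to exactly one of these subcollections. The subcollection of $(A_1,\dots,A_m,B)$ is isomorphic to $$\mathcal K_{G_1}\times\cdots\times\mathcal K_{G_m}\times\mathcal K_{G[m]},$$ where $\mathcal K_{G_i}$ is formed with the palette $A_i$, and $G[m]$ is the null graph on $m$ nodes (no edges), with the palette $B$: there is a bijection between the polytopes of the subcollection and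 those of the product such that corresponding polytopes have isomorphic face posets. -/

import Mathlib

universe u v

namespace ColorfulGA

noncomputable section

open scoped Classical

/-! ### Abstract polytopes -/

/-- Two flags (maximal chains) are adjacent if they differ in exactly one face. -/
def AdjacentFlags {P : Type*} [PartialOrder P] (A B : Flag P) : Prop :=
  ((A : Set P) \ (B : Set P)).ncard = 1 ∧ ((B : Set P) \ (A : Set P)).ncard = 1

/-- `P` is the face poset of an abstract polytope of rank `n`. The least face has rank `-1`,
so the rank of a face is its height in `P` minus one. -/
structure IsAbstractPolytope (P : Type*) [PartialOrder P] (n : ℕ) : Prop where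
  exists_least : ∃ a : P, IsLeast Set.univ a
  exists_greatest : ∃ a : P, IsGreatest Set.univ a
  flag_card : ∀ A : Flag P, (A : Set P).ncard = n + 2
  strongly_flag_connected : ∀ A B : Flag P,
    Relation.ReflTransGen
      (fun C D : Flag P => AdjacentFlags C D ∧ (A : Set P) ∩ (B : Set P) ⊆ (D : Set P)) A B
  diamond : ∀ f h : P, f < h → Order.height h = Order.height f + 2 →
    {g : P | f < g ∧ g < h}.ncard = 2

/-- A polytope of rank `n` is simple if each of its vertex-figures is a simplex with `n` vertices,
that is, if the faces containing a given vertex (a face of rank `0`) form a Boolean lattice of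
rank `n`. -/
def IsSimplePolytope (P : Type*) [PartialOrder P] (n : ℕ) : Prop :=
  ∀ w : P, Order.height w = 1 → Nonempty (Set.Ici w ≃o Finset (Fin n))

/-! ### Collections of polytopes

A collection of polytopes is given by the poset `P` of all the faces of all of its members, with
the least faces (the faces of rank `-1`) left out. Its members correspond to the connected
components of `P`. -/

/-- The connected components of a poset (under the equivalence relation generated by `≤`). -/
def Component (P : Type*) [PartialOrder P] : Type _ := Quot (fun a b : P => a ≤ b)

/-- The elements of a connected component, i.e. the nonempty faces of a member of the
collection. -/
abbrev Faces {P : Type*} [PartialOrder P] (C : Component P) : Type _ :=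
  {x : P // Quot.mk (fun a b : P => a ≤ b) x = C}

/-- The face poset of a member of the collection: a least face, of rank `-1`, is appended to the
component. -/
abbrev FacePoset {P : Type*} [PartialOrder P] (C : Component P) : Type _ := WithBot (Faces C)

/-! ### Tubes, tubings and cores -/

section Tubes

variable {V : Type u}

/-- A nonempty set of nodes that induces a connected subgraph. (Properness is a condition on
tubings, see `IsTubing`.) -/
def IsTube (G : SimpleGraph V) (s : Finset V) : Prop := (G.induce (s : Set V)).Connected

/-- One tube properly contains the other, or they are disjoint and not joined by an edge. -/
def TubesCompatible (G : SimpleGraph V) (s t : Finset V) : Prop :=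
  s ⊂ t ∨ t ⊂ s ∨ (Disjoint s t ∧ ∀ a ∈ s, ∀ b ∈ t, ¬ G.Adj a b)

/-- The universal tubes are the connected components of the graph. -/
def IsUniversalTube (G : SimpleGraph V) (s : Finset V) : Prop :=
  ∃ C : G.ConnectedComponent, (s : Set V) = C.supp

/-- A tubing is a set of pairwise compatible tubes that does not contain all the connected
components. For a connected graph, the last condition says that its tubes are proper. -/
structure IsTubing (G : SimpleGraph V) (T : Finset (Finset V)) : Prop where
  tube : ∀ t ∈ T, IsTube G t
  compatible : ∀ s ∈ T, ∀ t ∈ T, s ≠ t → TubesCompatible G s t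
  proper : ∃ s, IsUniversalTube G s ∧ s ∉ T

/-- The nodes of `t` that lie in no tube of `T` properly contained in `t`. -/
def coreSet (T : Finset (Finset V)) (t : Finset V) : Set V :=
  {v | v ∈ t ∧ ∀ t' ∈ T, t' ⊂ t → v ∉ t'}

/-- The core graph of `t` in `T`: two nodes of the core are adjacent if they are adjacent in `G`
or connected via a path through some tube `t' ⊂ t` of `T`. Since `t'` induces a connected
subgraph, the latter means that both nodes have a neighbor in `t'`. -/
def coreGraph (G : SimpleGraph V) (T : Finset (Finset V)) (t : Finset V) :
    SimpleGraph (coreSet T t) where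
  Adj a b := a ≠ b ∧ (G.Adj a b ∨
    ∃ t' ∈ T, t' ⊂ t ∧ (∃ c ∈ t', G.Adj a c) ∧ (∃ d ∈ t', G.Adj b d))
  symm := ⟨by
    rintro a b ⟨hab, h⟩
    refine ⟨hab.symm, ?_⟩
    rcases h with h | ⟨t', ht', hs, hc, hd⟩
    · exact Or.inl h.symm
    · exact Or.inr ⟨t', ht', hs, hd, hc⟩⟩
  loopless := ⟨fun _ h => h.1 rfl⟩

/-- Vertex connectivity: the least number of nodes whose removal disconnects the graph or leaves
at most one node. It is `n - 1` for the complete graph on `n ≥ 1` nodes. -/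
def connectivity {W : Type u} (H : SimpleGraph W) : ℕ :=
  sInf {k | ∃ S : Set W, S.ncard = k ∧ (¬ (H.induce Sᶜ).Preconnected ∨ Sᶜ.ncard ≤ 1)}

/-- The finset of all universal tubes. -/
def universalTubes [Finite V] (G : SimpleGraph V) : Finset (Finset V) :=
  (Set.toFinite {s : Finset V | IsUniversalTube G s}).toFinset

end Tubes

/-! ### Color templates -/

/-- The color blocks attached to one tube: the color of the tube (`none` if the tube is
uncolored), the sequence of the outer blocks, with one color each, and the inner block, which is
unordered. -/
@[ext]
structure Blocks (κ : Type v) where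
  color : Option κ
  outer : List κ
  inner : Multiset κ

namespace Blocks

variable {κ : Type v}

/-- The color of the tube, as a multiset with at most one element. -/
def visible (b : Blocks κ) : Multiset κ := (b.color.toList : Multiset κ)

/-- The colors of the outer and inner blocks. -/
def hidden (b : Blocks κ) : Multiset κ := (b.outer : Multiset κ) + b.inner

/-- All the colors in the blocks. -/
def colors (b : Blocks κ) : Multiset κ := b.visible + b.hidden

/-- `l` lists all the colors of the blocks in an order that is consistent with the order of the
blocks; the colors of the inner block may be listed in any order. -/
def IsListing (b : Blocks κ) (l : List κ) : Prop :=
  ∃ i : List κ, (i : Multiset κ) = b.inner ∧ l = b.color.toList ++ b.outer ++ i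

end Blocks

section Templates

variable {V : Type u} [Finite V] {κ : Type v}

/-- A color template of the graph `G` with color palette `pal`: a tubing, together with a
distribution of the colors of the palette among the color blocks of the tubes of the tubing, the
color blocks of the universal tubes, and the universal block. -/
@[ext]
structure Template (G : SimpleGraph V) (pal : Multiset κ) where
  tubes : Finset (Finset V)
  blocks : Finset V → Blocks κ
  universalBlock : Multiset κ
  isTubing : IsTubing G tubes
  /-- The colored tubes are those of the tubing. -/
  color_isSome : ∀ t, (blocks t).color.isSome ↔ t ∈ tubes
  /-- There are `k - 1` outer blocks, where `k` is the connectivity of the core. -/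
  outer_length : ∀ t ∈ tubes ∪ universalTubes G,
    (blocks t).outer.length = connectivity (coreGraph G tubes t) - 1
  /-- The tube color, the outer blocks and the inner block have as many places as the core has
  nodes. -/
  inner_card : ∀ t ∈ tubes ∪ universalTubes G,
    1 + (blocks t).outer.length + (blocks t).inner.card = (coreSet tubes t).ncard
  /-- Nothing is attached to other sets of nodes. -/
  blocks_eq : ∀ t ∉ tubes ∪ universalTubes G, blocks t = ⟨none, [], 0⟩
  /-- A graph with `m` components has `m - 1` places for the colors of universal tubes. -/
  universalBlock_card :
    universalBlock.card + (tubes ∩ universalTubes G).card + 1 = Nat.card G.ConnectedComponent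
  total : ∑ t ∈ tubes ∪ universalTubes G, (blocks t).colors + universalBlock = pal

namespace Template

variable {G : SimpleGraph V} {pal : Multiset κ}

/-- `x` arises from `y` by adding the tube `t`, which is not a universal tube. Here `s` is the
smallest tube, possibly a universal one, that properly contains `t`. The colors of `s` in `y`,
listed in order, with the colors of the inner block in an arbitrary order, are cut in two: the
first ones fill the blocks of `s` in `x` in order, the last ones fill the blocks of `t`. -/
def AddTube (x y : Template G pal) (t : Finset V) : Prop :=
  t ∉ y.tubes ∧ ¬ IsUniversalTube G t ∧ x.tubes = insert t y.tubes ∧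
  ∃ s ∈ y.tubes ∪ universalTubes G, t ⊂ s ∧
    (∀ w ∈ y.tubes ∪ universalTubes G, t ⊂ w → s ⊆ w) ∧
    (∀ w, w ≠ t → w ≠ s → x.blocks w = y.blocks w) ∧
    x.universalBlock = y.universalBlock ∧
    ∃ l₁ l₂ : List κ, (x.blocks s).IsListing l₁ ∧ (x.blocks t).IsListing l₂ ∧
      (y.blocks s).IsListing (l₁ ++ l₂)

/-- `x` arises from `y` by adding the universal tube `s`, whose color is taken from the universal
block of `y`. -/
def AddUniversalTube (x y : Template G pal) (s : Finset V) : Prop :=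
  s ∉ y.tubes ∧ IsUniversalTube G s ∧ x.tubes = insert s y.tubes ∧
  (∀ w, w ≠ s → x.blocks w = y.blocks w) ∧
  ∃ c : κ, y.universalBlock = c ::ₘ x.universalBlock ∧
    (x.blocks s).color = some c ∧
    (x.blocks s).outer = (y.blocks s).outer ∧ (x.blocks s).inner = (y.blocks s).inner

/-- `x ≺ y` for templates whose tubings differ by one tube. -/
def Step (x y : Template G pal) : Prop :=
  ∃ t, AddTube x y t ∨ AddUniversalTube x y t

theorem Step.card_tubes {x y : Template G pal} (h : Step x y) :
    x.tubes.card = y.tubes.card + 1 := by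
  rcases h with ⟨t, ⟨ht, -, hx, -⟩ | ⟨ht, -, hx, -⟩⟩ <;>
    rw [hx, Finset.card_insert_of_notMem ht]

theorem eq_or_card_lt {x y : Template G pal} (h : Relation.ReflTransGen Step x y) :
    x = y ∨ y.tubes.card < x.tubes.card := by
  induction h with
  | refl => exact Or.inl rfl
  | tail _ hs ih =>
    have := hs.card_tubes
    rcases ih with rfl | ih
    · right; omega
    · right; omega

/-- The colorful graph associahedron of `G` with palette `pal` is the poset of color templates.
The order is obtained by adding tubes one at a time, smaller templates having more tubes. Its
connected components, with least faces appended, are its polytopes. -/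
instance instPartialOrder : PartialOrder (Template G pal) where
  le := Relation.ReflTransGen Step
  le_refl _ := Relation.ReflTransGen.refl
  le_trans _ _ _ := Relation.ReflTransGen.trans
  le_antisymm x y h h' := by
    rcases eq_or_card_lt h with h | h
    · exact h
    · rcases eq_or_card_lt h' with h' | h'
      · exact h'.symm
      · omega

/-- The colors that a template uses in the connected component `C`, except for the color of the
universal tube `C` itself. -/
def componentColors (x : Template G pal) (C : G.ConnectedComponent) : Multiset κ :=
  ∑ t ∈ (x.tubes ∪ universalTubes G).filter (fun t : Finset V => (t : Set V) ⊆ C.supp),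
    if IsUniversalTube G t then (x.blocks t).hidden else (x.blocks t).colors

/-- The colors that a template uses for the universal tubes or stores in the universal block. -/
def universalColors (x : Template G pal) : Multiset κ :=
  ∑ t ∈ universalTubes G, (x.blocks t).visible + x.universalBlock

end Template

/-- The ordered partitions of the palette into sets (with repeated colors) of sizes
`|G₁| - 1, …, |Gₘ| - 1, m - 1`, where `G₁, …, Gₘ` are the connected components of `G`. -/
@[ext]
structure PalettePartition {G : SimpleGraph V} {m : ℕ} (comp : Fin m ≃ G.ConnectedComponent)
    (pal : Multiset κ) where
  part : Fin m → Multiset κ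
  last : Multiset κ
  card_part : ∀ i, (part i).card = (comp i).supp.ncard - 1
  card_last : last.card = m - 1
  total : ∑ i, part i + last = pal

/-- The polytopes of the colorful graph associahedron that correspond to the ordered partition
`p`: all of their faces use the colors of the `i`-th class of `p` within the component `Gᵢ` and
the colors of the last class for the universal tubes. -/
def subcollection {G : SimpleGraph V} {m : ℕ} {comp : Fin m ≃ G.ConnectedComponent}
    {pal : Multiset κ} (p : PalettePartition comp pal) : Set (Component (Template G pal)) :=
  {C | ∀ x : Faces C,
    (∀ i, x.1.componentColors (comp i) = p.part i) ∧ x.1.universalColors = p.last}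

end Templates

end

end ColorfulGA

namespace ColorfulGA

open scoped Classical

/-! The local fact behind the theorem is that deleting a tube from a template is always possible,
has only one result, and commutes with the deletion of another tube. Deleting `t` appends a listing
of `t` to a listing of its parent `s`. That the result depends neither on the listings nor on the
order of two deletions is a matter of connectivity. Adding `t` does not lower the connectivity of
the core of `s` unless the new core is complete (`conn_parent_le`, `conn_le_add`), and if two tubes
have the same parent, the core nodes outside both form a cutset (`conn_le_of_siblings`). Hence the
faces above a template correspond to the subsets of its tubing (`isBooleanAbove_of_deletion`,
`Template.isBooleanAbove`). This gives simplicity, the diamond property and the connectedness of all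
intervals that do not start at the least face; it also shows that each component of the poset has
exactly one template without tubes, its greatest face.

The faces below a template `y` remain. The number of tubes plus the number of colors that can still
be moved is the size of the palette (`card_tubes_add`). A vertex has no movable colors. An edge has
one, with two places to go: two core nodes of the same tube, or two missing universal tubes
(`ncard_Iio_of_card`). From rank 2 on, the proper nonempty faces of `y` have to be connected
(`joined_Iio`). Each is joined to a facet that adds either a universal tube or the smallest tube
around a core node `a` of some `s`, colored by the last color of a listing `l` of `s`. Facets that
belong to different tubes `s`, or to `s` and a universal tube, are joined because both tubes can be
added together. For the same `s`, three moves are used: * if `a` and `b` are adjacent in the core,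
the facets of `(a, l)` and `(b, l)` are joined, so the node is arbitrary, the core being connected;
* if they are not adjacent, the facet of `(a, l)` is joined to one of `b` with the last two colors
of `l` exchanged; * two earlier inner colors can be exchanged at a suitable node, after whose
removal they still lie in an inner block. The last two moves need a cutset of suitable size, which
exists exactly because inner colors come after as many places as the connectivity prescribes.
General poset theory (`IsRankFunction.strongly_flag_connected`) turns connected intervals into
strong flag-connectedness.

For the second half, a step of the order changes neither the colors used inside a component of `G`
nor those of the universal tubes, so every polytope has one ordered partition. A template with a
given partition restricts to a template of each component and to one of the null graph, whose nodes
stand for the components. Restriction is injective, monotone and, by gluing, surjective; it reflects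
the order because a face above a given one is determined by its tubes. The resulting order
isomorphism matches connected components with products of connected components, since these are
detected by common upper bounds (`exists_equiv_of_orderIso`). -/

/-! ### Ranked bounded posets -/

/-- `r` is a rank function with values in `0, …, N + 1` on a bounded poset. -/
structure IsRankFunction {P : Type*} [PartialOrder P] (r : P → ℕ) (N : ℕ) : Prop where
  strictMono : StrictMono r
  exists_bot : ∃ b : P, r b = 0 ∧ ∀ x, b ≤ x
  exists_top : ∃ t : P, r t = N + 1 ∧ ∀ x, x ≤ t
  exists_between : ∀ f h : P, f < h → r f + 1 < r h → ∃ g, f < g ∧ g < h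

/-- Every predicate that is invariant under comparability in `s` takes the same value at
`x` and `y`. -/
def Joined {P : Type*} [PartialOrder P] (s : Set P) (x y : P) : Prop :=
  ∀ S : P → Prop, (∀ a ∈ s, ∀ b ∈ s, a ≤ b → (S a ↔ S b)) → (S x ↔ S y)

namespace Joined

variable {P : Type*} [PartialOrder P] {s : Set P} {x y z : P}

theorem refl (s : Set P) (x : P) : Joined s x x := fun _ _ => Iff.rfl

theorem symm (h : Joined s x y) : Joined s y x := fun S hS => (h S hS).symm

theorem trans (h : Joined s x y) (h' : Joined s y z) : Joined s x z :=
  fun S hS => (h S hS).trans (h' S hS)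

theorem of_le (hx : x ∈ s) (hy : y ∈ s) (h : x ≤ y) : Joined s x y :=
  fun _ hS => hS x hx y hy h

theorem of_common_lower (hz : z ∈ s) (hx : x ∈ s) (hy : y ∈ s) (h : z ≤ x) (h' : z ≤ y) :
    Joined s x y :=
  (of_le hz hx h).symm.trans (of_le hz hy h')

end Joined

namespace IsRankFunction

variable {P : Type*} [PartialOrder P] {r : P → ℕ} {N : ℕ}

theorem rank_le (h : IsRankFunction r N) (x : P) : r x ≤ N + 1 := by
  obtain ⟨t, ht, htx⟩ := h.exists_top
  rw [← ht]
  exact h.strictMono.monotone (htx x)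

theorem exists_rank_succ (h : IsRankFunction r N) (x : P) (hx : 0 < r x) :
    ∃ y < x, r y + 1 = r x := by
  obtain ⟨b, hb, hbx⟩ := h.exists_bot
  have hlt : b < x := lt_of_le_of_ne (hbx x) (by rintro rfl; omega)
  by_contra! hne
  -- If no element below `x` had rank `r x - 1`, `exists_between` would produce elements below `x`
  -- of ever larger rank.
  have key : ∀ k, k ≤ r x → ∃ y < x, k ≤ r y := by
    intro k
    induction k with
    | zero => exact fun _ => ⟨b, hlt, Nat.zero_le _⟩
    | succ k ih =>
      intro hk
      obtain ⟨y, hy, hky⟩ := ih (by omega)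
      have h1 := hne y hy
      have h2 := h.strictMono hy
      obtain ⟨g, hg, hg'⟩ := h.exists_between y x hy (by omega)
      exact ⟨g, hg', by have := h.strictMono hg; omega⟩
  obtain ⟨y, hy, hle⟩ := key (r x) le_rfl
  have := h.strictMono hy
  omega

/-- Chains are counted with `r`, whereas the diamond condition and simplicity are stated with
`Order.height`. -/
theorem height_eq (h : IsRankFunction r N) (x : P) : Order.height x = r x := by
  induction hn : r x using Nat.strong_induction_on generalizing x with
  | _ n ih =>
    subst hn
    apply le_antisymm
    · rw [Order.height_le_coe_iff]
      intro y hy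
      rw [ih (r y) (h.strictMono hy) y rfl]
      exact_mod_cast h.strictMono hy
    · rcases Nat.eq_zero_or_pos (r x) with h0 | h0
      · simp [h0]
      · obtain ⟨y, hy, hr⟩ := h.exists_rank_succ x h0
        have := Order.height_add_one_le hy
        rw [ih (r y) (by omega) y rfl] at this
        rw [← hr]
        exact_mod_cast this

theorem injOn_flag (h : IsRankFunction r N) (A : Flag P) : Set.InjOn r (A : Set P) := by
  intro x hx y hy hxy
  rcases A.le_or_le hx hy with hle | hle
  · rcases hle.eq_or_lt with e | e
    · exact e
    · have := h.strictMono e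
      omega
  · rcases hle.eq_or_lt with e | e
    · exact e.symm
    · have := h.strictMono e
      omega

theorem finite_flag (h : IsRankFunction r N) (A : Flag P) : (A : Set P).Finite :=
  Set.Finite.of_finite_image ((Set.finite_Iic (N + 1)).subset
    (by rintro _ ⟨x, -, rfl⟩; exact h.rank_le x)) (h.injOn_flag A)

/-- If a rank were skipped, there would be room for a further element between the neighboring
members of the flag, against its maximality. -/
theorem exists_mem_flag (h : IsRankFunction r N) (A : Flag P) {j : ℕ} (hj : j ≤ N + 1) :
    ∃ a ∈ A, r a = j := by
  by_contra! hne
  obtain ⟨b, hb, hbx⟩ := h.exists_bot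
  obtain ⟨t, ht, htx⟩ := h.exists_top
  have hbA : b ∈ A := Flag.mem_iff_forall_le_or_ge.2 fun _ _ => Or.inl (hbx _)
  have htA : t ∈ A := Flag.mem_iff_forall_le_or_ge.2 fun _ _ => Or.inr (htx _)
  have hfin := h.finite_flag A
  obtain ⟨f, ⟨hfA, hfj⟩, hf⟩ := Set.exists_max_image {a | a ∈ A ∧ r a < j} r
    (hfin.subset fun a ha => ha.1)
    ⟨b, hbA, by have := hne b hbA; omega⟩
  obtain ⟨g, ⟨hgA, hgj⟩, hg⟩ := Set.exists_min_image {a | a ∈ A ∧ j < r a} r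
    (hfin.subset fun a ha => ha.1)
    ⟨t, htA, by have := hne t htA; omega⟩
  have hfg : f < g := by
    rcases A.le_or_le hfA hgA with hle | hle
    · exact lt_of_le_of_ne hle (by rintro rfl; omega)
    · have := h.strictMono.monotone hle
      omega
  obtain ⟨e, hfe, heg⟩ := h.exists_between f g hfg (by omega)
  -- Every member of `A` is below `f` or above `g`, as none has rank `j`; so `e` is comparable to
  -- all of them.
  have heA : e ∈ A := by
    refine Flag.mem_iff_forall_le_or_ge.2 fun c hc => ?_
    rcases lt_or_gt_of_ne (hne c hc) with hcj | hcj
    · right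
      rcases A.le_or_le hc hfA with hle | hle
      · exact hle.trans hfe.le
      · have := h.injOn_flag A hc hfA (le_antisymm (hf c ⟨hc, hcj⟩) (h.strictMono.monotone hle))
        exact this ▸ hfe.le
    · left
      rcases A.le_or_le hgA hc with hle | hle
      · exact heg.le.trans hle
      · have := h.injOn_flag A hgA hc (le_antisymm (hg c ⟨hc, hcj⟩) (h.strictMono.monotone hle))
        exact this ▸ heg.le
  have h1 := h.strictMono hfe
  have h2 := h.strictMono heg
  rcases lt_or_gt_of_ne (hne e heA) with hcj | hcj
  · have := hf e ⟨heA, hcj⟩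
    omega
  · have := hg e ⟨heA, hcj⟩
    omega

theorem ncard_flag (h : IsRankFunction r N) (A : Flag P) : (A : Set P).ncard = N + 2 := by
  have himg : r '' (A : Set P) = Set.Iic (N + 1) := by
    ext j
    constructor
    · rintro ⟨x, -, rfl⟩
      exact h.rank_le x
    · intro hj
      obtain ⟨a, ha, har⟩ := h.exists_mem_flag A hj
      exact ⟨a, ha, har⟩
  rw [← (h.injOn_flag A).ncard_image, himg, Set.ncard_eq_toFinset_card']
  simp

/-- The elements of a chain that enclose a given element that is comparable to all of its
members. -/
theorem exists_gap (h : IsRankFunction r N) (A : Flag P) (J : Set P) (hJ : J ⊆ A)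
    (hb : ∀ b : P, (∀ x, b ≤ x) → b ∈ J) (ht : ∀ b : P, (∀ x, x ≤ b) → b ∈ J)
    (x : P) (hx : x ∈ A) (hxJ : x ∉ J) :
    ∃ f ∈ J, ∃ g ∈ J, f < x ∧ x < g ∧ ∀ j ∈ J, j ≤ f ∨ g ≤ j := by
  obtain ⟨b, hb0, hbx⟩ := h.exists_bot
  obtain ⟨t, ht0, htx⟩ := h.exists_top
  have hfin := (h.finite_flag A).subset hJ
  have hlt : ∀ j ∈ J, j < x ∨ x < j := by
    intro j hj
    have hne : j ≠ x := by rintro rfl; exact hxJ hj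
    rcases A.le_or_le (hJ hj) hx with hle | hle
    · exact Or.inl (lt_of_le_of_ne hle hne)
    · exact Or.inr (lt_of_le_of_ne hle hne.symm)
  obtain ⟨f, ⟨hfA, hfj⟩, hf⟩ := Set.exists_max_image {a | a ∈ J ∧ a < x} r
    (hfin.subset fun a ha => ha.1)
    ⟨b, hb b hbx, lt_of_le_of_ne (hbx x) (by rintro rfl; exact hxJ (hb _ hbx))⟩
  obtain ⟨g, ⟨hgA, hgj⟩, hg⟩ := Set.exists_min_image {a | a ∈ J ∧ x < a} r
    (hfin.subset fun a ha => ha.1)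
    ⟨t, ht t htx, lt_of_le_of_ne (htx x) (by rintro rfl; exact hxJ (ht _ htx))⟩
  refine ⟨f, hfA, g, hgA, hfj, hgj, fun j hj => ?_⟩
  rcases hlt j hj with hj' | hj'
  · left
    rcases A.le_or_le (hJ hj) (hJ hfA) with hle | hle
    · exact hle
    · exact (h.injOn_flag A (hJ hj) (hJ hfA)
        (le_antisymm (hf j ⟨hj, hj'⟩) (h.strictMono.monotone hle))).le
  · right
    rcases A.le_or_le (hJ hgA) (hJ hj) with hle | hle
    · exact hle
    · exact (h.injOn_flag A (hJ hgA) (hJ hj)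
        (le_antisymm (hg j ⟨hj, hj'⟩) (h.strictMono.monotone hle))).le

/-- The set in the conclusion consists of the faces that can be added to the chain `A ∩ B`. Faces in
different gaps of this chain are comparable, and a gap with at least two ranks is connected by
`hconn`. -/
theorem joined_link (h : IsRankFunction r N)
    (hconn : ∀ f g : P, f < g → r f + 3 ≤ r g → ∀ x ∈ Set.Ioo f g, ∀ y ∈ Set.Ioo f g,
      Joined (Set.Ioo f g) x y)
    (A B : Flag P) (hAB : 2 ≤ ((A : Set P) \ B).ncard) (x y : P)
    (hx : x ∈ (A : Set P) \ B) (hy : y ∈ (B : Set P) \ A) :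
    Joined {c | ∀ j ∈ (A : Set P) ∩ B, c < j ∨ j < c} x y := by
  have hbJ : ∀ b : P, (∀ x, b ≤ x) → b ∈ (A : Set P) ∩ B := fun b hb =>
    ⟨Flag.mem_iff_forall_le_or_ge.2 fun _ _ => Or.inl (hb _),
      Flag.mem_iff_forall_le_or_ge.2 fun _ _ => Or.inl (hb _)⟩
  have htJ : ∀ b : P, (∀ x, x ≤ b) → b ∈ (A : Set P) ∩ B := fun b hb =>
    ⟨Flag.mem_iff_forall_le_or_ge.2 fun _ _ => Or.inr (hb _),
      Flag.mem_iff_forall_le_or_ge.2 fun _ _ => Or.inr (hb _)⟩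
  obtain ⟨f, hf, g, hg, hfx, hxg, hJ⟩ := h.exists_gap A _ Set.inter_subset_left hbJ htJ x hx.1
    (fun hh => hx.2 hh.2)
  have memA : ∀ c ∈ (A : Set P) \ B, c ∈ {c | ∀ j ∈ (A : Set P) ∩ B, c < j ∨ j < c} := by
    intro c hc j hj
    have hne : c ≠ j := by rintro rfl; exact hc.2 hj.2
    rcases A.le_or_le hc.1 hj.1 with hle | hle
    · exact Or.inl (lt_of_le_of_ne hle hne)
    · exact Or.inr (lt_of_le_of_ne hle hne.symm)
  have memB : ∀ c ∈ (B : Set P) \ A, c ∈ {c | ∀ j ∈ (A : Set P) ∩ B, c < j ∨ j < c} := by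
    intro c hc j hj
    have hne : c ≠ j := by rintro rfl; exact hc.2 hj.1
    rcases B.le_or_le hc.1 hj.2 with hle | hle
    · exact Or.inl (lt_of_le_of_ne hle hne)
    · exact Or.inr (lt_of_le_of_ne hle hne.symm)
  rcases memB y hy f hf with hyf | hfy
  · exact (Joined.of_le (memB y hy) (memA x hx) (hyf.trans hfx).le).symm
  rcases memB y hy g hg with hyg | hgy
  swap
  · exact Joined.of_le (memA x hx) (memB y hy) (hxg.trans hgy).le
  by_cases h3 : r f + 3 ≤ r g
  · intro S hS
    refine hconn f g (hfx.trans hxg) h3 x ⟨hfx, hxg⟩ y ⟨hfy, hyg⟩ S ?_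
    have hsub : ∀ c ∈ Set.Ioo f g, ∀ j ∈ (A : Set P) ∩ B, c < j ∨ j < c := by
      intro c hc j hj
      rcases hJ j hj with hle | hle
      · exact Or.inr (hle.trans_lt hc.1)
      · exact Or.inl (hc.2.trans_le hle)
    intro a ha b hb hab
    exact hS a (hsub a ha) b (hsub b hb) hab
  -- The gap around `x` and `y` has a single rank, so another face `z` of `A \ B` lies outside it
  -- and is comparable to both.
  · obtain ⟨z, hz, hzx⟩ := Set.exists_ne_of_one_lt_ncard (s := (A : Set P) \ B) (by omega) x
    have h1 := h.strictMono hfx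
    have h2 := h.strictMono hxg
    have hzr : r z ≠ r x := fun e => hzx (h.injOn_flag A hz.1 hx.1 e)
    rcases memA z hz f hf with hzf | hfz
    · exact (Joined.of_le (memA z hz) (memA x hx) (hzf.trans hfx).le).symm.trans
        (Joined.of_le (memA z hz) (memB y hy) (hzf.trans hfy).le)
    rcases memA z hz g hg with hzg | hgz
    · have h3 := h.strictMono hfz
      have h4 := h.strictMono hzg
      omega
    · exact (Joined.of_le (memA x hx) (memA z hz) (hxg.trans hgz).le).trans
        (Joined.of_le (memB y hy) (memA z hz) (hyg.trans hgz).le).symm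

/-- Induction on the number of faces in `A \ B`. Comparable faces `a ≤ b` of the link of `A ∩ B` lie
in a common flag through `A ∩ B`, and flags that share one more face than `A ∩ B` are covered by the
induction hypothesis. So reachability spreads along the link, from a face of `A` to a face of `B`.
-/
theorem strongly_flag_connected (h : IsRankFunction r N)
    (hconn : ∀ f g : P, f < g → r f + 3 ≤ r g → ∀ x ∈ Set.Ioo f g, ∀ y ∈ Set.Ioo f g,
      Joined (Set.Ioo f g) x y) (A B : Flag P) :
    Relation.ReflTransGen
      (fun C D : Flag P => AdjacentFlags C D ∧ (A : Set P) ∩ (B : Set P) ⊆ (D : Set P)) A B := by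
  induction hm : ((A : Set P) \ B).ncard using Nat.strong_induction_on generalizing A B with
  | _ m ih =>
    subst hm
    have hcard : ∀ C D : Flag P, ((C : Set P) ∩ D).ncard + ((C : Set P) \ D).ncard = N + 2 := by
      intro C D
      rw [← h.ncard_flag C]
      exact Set.ncard_inter_add_ncard_sdiff_eq_ncard _ _ (h.finite_flag C)
    have h1 := hcard A B
    have h2 := hcard B A
    rw [Set.inter_comm] at h2
    rcases Nat.lt_trichotomy ((A : Set P) \ B).ncard 1 with h0 | h0 | h0
    · have he : (A : Set P) \ B = ∅ :=
        (Set.ncard_eq_zero ((h.finite_flag A).subset Set.sdiff_subset)).1 (by omega)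
      have : A = B := by
        apply Flag.ext
        exact Set.eq_of_subset_of_ncard_le (Set.sdiff_eq_empty.1 he)
          (by rw [h.ncard_flag, h.ncard_flag]) (h.finite_flag B)
      subst this
      exact Relation.ReflTransGen.refl
    · exact Relation.ReflTransGen.single ⟨⟨h0, by omega⟩, Set.inter_subset_right⟩
    · obtain ⟨x, hx⟩ : ((A : Set P) \ B).Nonempty := by
        rw [Set.nonempty_iff_ne_empty]
        intro he
        rw [he, Set.ncard_empty] at h0
        omega
      obtain ⟨y, hy⟩ : ((B : Set P) \ A).Nonempty := by
        rw [Set.nonempty_iff_ne_empty]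
        intro he
        rw [he, Set.ncard_empty] at h2
        omega
      set J := (A : Set P) ∩ B with hJ
      have hJfin : J.Finite := (h.finite_flag A).subset Set.inter_subset_left
      have step : ∀ (c : P) (C D : Flag P), c ∉ J → insert c J ⊆ C → insert c J ⊆ D →
          Relation.ReflTransGen (fun C D : Flag P => AdjacentFlags C D ∧ J ⊆ (D : Set P)) C D := by
        intro c C D hc hC hD
        have h3 := hcard C D
        have h4 : J.ncard + 1 ≤ ((C : Set P) ∩ D).ncard := by
          rw [← Set.ncard_insert_of_notMem hc hJfin]
          exact Set.ncard_le_ncard (Set.subset_inter hC hD)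
            ((h.finite_flag C).subset Set.inter_subset_left)
        refine Relation.ReflTransGen.mono (fun E F hEF => ?_) _ _ (ih _ (by omega) C D rfl)
        exact ⟨hEF.1, fun j hj => hEF.2 ⟨hC (Or.inr hj), hD (Or.inr hj)⟩⟩
      -- The property carried from `x` to `y` is that every flag through `J` and the given face can
      -- be reached from `A`.
      have hlink := h.joined_link hconn A B (by omega) x y hx hy
        (fun c => ∀ D : Flag P, insert c J ⊆ D →
          Relation.ReflTransGen (fun C D : Flag P => AdjacentFlags C D ∧ J ⊆ (D : Set P)) A D) ?_
      · refine hlink.1 ?_ B (Set.insert_subset hy.1 Set.inter_subset_right)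
        intro D hD
        exact step x A D (fun hh => hx.2 hh.2)
          (Set.insert_subset hx.1 Set.inter_subset_left) hD
      · intro a ha b hb hab
        have hchain : IsChain (· ≤ ·) (insert a (insert b J)) := by
          refine IsChain.insert (IsChain.insert (A.chain_le.mono Set.inter_subset_left) ?_) ?_
          · intro j hj _
            rcases hb j hj with e | e
            · exact Or.inl e.le
            · exact Or.inr e.le
          · rintro j (rfl | hj) _
            · exact Or.inl hab
            · rcases ha j hj with e | e
              · exact Or.inl e.le
              · exact Or.inr e.le
        obtain ⟨E, hE⟩ := hchain.exists_subset_flag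
        have haJ : a ∉ J := fun hh => by rcases ha a hh with e | e <;> exact lt_irrefl _ e
        have hbJ : b ∉ J := fun hh => by rcases hb b hh with e | e <;> exact lt_irrefl _ e
        have hEa : insert a J ⊆ (E : Set P) := fun z hz => hE (by
          rcases hz with rfl | hz
          · exact Or.inl rfl
          · exact Or.inr (Or.inr hz))
        have hEb : insert b J ⊆ (E : Set P) := fun z hz => hE (Or.inr hz)
        constructor
        · intro hS D hD
          exact (hS E hEa).trans (step b E D hbJ hEb hD)
        · intro hS D hD
          exact (hS E hEb).trans (step a E D haJ hEa hD)

end IsRankFunction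
end ColorfulGA

namespace ColorfulGA

open scoped Classical

/-! ### Posets that are Boolean above every element -/

/-- Each `x` is labeled by a finite set `T x`, and the elements above `x` correspond to the subsets
of `T x`, in reverse order. -/
structure IsBooleanAbove {P : Type*} [PartialOrder P] {ι : Type*} (T : P → Finset ι) : Prop where
  subset : ∀ {x y : P}, x ≤ y → T y ⊆ T x
  exists_above : ∀ (x : P) {S : Finset ι}, S ⊆ T x → ∃ y, x ≤ y ∧ T y = S
  le_of_subset : ∀ {x y z : P}, x ≤ y → x ≤ z → T z ⊆ T y → y ≤ z

/-- If the order of a poset is generated by deletions of labels that exist, are unique and commute,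
then the poset is Boolean above every element. -/
theorem isBooleanAbove_of_deletion {P : Type*} [PartialOrder P] {ι : Type*} [DecidableEq ι]
    (T : P → Finset ι)
    (R : P → ι → P → Prop)
    (hle : ∀ x y : P, x ≤ y ↔ Relation.ReflTransGen (fun a b => ∃ t, R a t b) x y)
    (hT : ∀ {x t y}, R x t y → t ∉ T y ∧ T x = insert t (T y))
    (hex : ∀ {x t}, t ∈ T x → ∃ y, R x t y)
    (huniq : ∀ {x t y y'}, R x t y → R x t y' → y = y')
    (hcomm : ∀ {x t t' y y' z z'}, t ≠ t' → R x t y → R y t' z → R x t' y' → R y' t z' → z = z') :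
    IsBooleanAbove T := by
  have hR : ∀ {x t y}, R x t y → x ≤ y := fun h => (hle _ _).2 (.single ⟨_, h⟩)
  have hsub : ∀ {x y : P}, x ≤ y → T y ⊆ T x := by
    intro x y h
    rw [hle] at h
    induction h with
    | refl => exact subset_rfl
    | tail _ h ih =>
      obtain ⟨t, ht⟩ := h
      refine subset_trans ?_ ih
      rw [(hT ht).2]
      exact Finset.subset_insert _ _
  -- Deleting a label that `z` does not have stays below `z`: by commutation, this deletion is
  -- pushed along the deletions that lead from `x` to `z` until it meets the one of the same label.
  have hdel : ∀ {x z : P}, x ≤ z → ∀ {t x₁}, R x t x₁ → t ∉ T z → x₁ ≤ z := by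
    intro x z h
    rw [hle] at h
    induction h using Relation.ReflTransGen.head_induction_on with
    | refl =>
      intro t x₁ ht htz
      exact absurd ((hT ht).2 ▸ Finset.mem_insert_self _ _) htz
    | head h _ ih =>
      intro t x₁ ht htz
      obtain ⟨t', ht'⟩ := h
      rename_i hcz
      by_cases htt : t' = t
      · subst htt
        rw [huniq ht ht']
        exact (hle _ _).2 hcz
      · have htx : t ∈ insert t' (T _) := (hT ht').2 ▸ (hT ht).2 ▸ Finset.mem_insert_self _ _
        obtain ⟨w, hw⟩ := hex ((Finset.mem_insert.1 htx).resolve_left (Ne.symm htt))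
        have htx' : t' ∈ insert t (T _) := (hT ht).2 ▸ (hT ht').2 ▸ Finset.mem_insert_self _ _
        obtain ⟨w', hw'⟩ := hex ((Finset.mem_insert.1 htx').resolve_left htt)
        rw [← hcomm htt ht' hw ht hw'] at hw'
        exact (hR hw').trans (ih hw htz)
  refine ⟨hsub, ?_, ?_⟩
  · intro x S hS
    induction hn : (T x \ S).card generalizing x with
    | zero =>
      refine ⟨x, le_rfl, subset_antisymm ?_ hS⟩
      rwa [Finset.card_eq_zero, Finset.sdiff_eq_empty_iff_subset] at hn
    | succ n ih =>
      obtain ⟨t, ht⟩ : (T x \ S).Nonempty := Finset.card_pos.1 (by omega)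
      rw [Finset.mem_sdiff] at ht
      obtain ⟨y, hy⟩ := hex ht.1
      obtain ⟨hty, hxy⟩ := hT hy
      have hSy : S ⊆ T y := by
        intro a ha
        have := hS ha
        rw [hxy, Finset.mem_insert] at this
        rcases this with rfl | h
        · exact absurd ha ht.2
        · exact h
      obtain ⟨z, hz, hzS⟩ := ih y hSy (by
        rw [hxy, Finset.insert_sdiff_of_notMem _ ht.2, Finset.card_insert_of_notMem (by
          simp [hty])] at hn
        omega)
      exact ⟨z, (hR hy).trans hz, hzS⟩
  · intro x y z hxy hxz hzy
    rw [hle] at hxy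
    induction hxy using Relation.ReflTransGen.head_induction_on with
    | refl => exact hxz
    | head h hcy ih =>
      obtain ⟨t, ht⟩ := h
      exact ih (hdel hxz ht fun htz => (hT ht).1 (hsub ((hle _ _).2 hcy) (hzy htz)))

namespace IsBooleanAbove

/-- The rank function on the face poset. -/
def rank {P ι : Type*} (T : P → Finset ι) (N : ℕ) : WithBot P → ℕ
  | ⊥ => 0
  | (x : P) => N + 1 - (T x).card

@[simp] theorem rank_bot {P ι : Type*} (T : P → Finset ι) (N : ℕ) : rank T N ⊥ = 0 := rfl

@[simp] theorem rank_coe {P ι : Type*} (T : P → Finset ι) (N : ℕ) (x : P) : rank T N (x : WithBot P) = N + 1 - (T x).card := rfl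

variable {P : Type*} [PartialOrder P] {ι : Type*} {T : P → Finset ι} {N : ℕ}

theorem eq_of_eq (h : IsBooleanAbove T) {x y z : P} (hy : x ≤ y) (hz : x ≤ z) (e : T y = T z) :
    y = z :=
  le_antisymm (h.le_of_subset hy hz e.ge) (h.le_of_subset hz hy e.le)

theorem card_lt (h : IsBooleanAbove T) {x y : P} (hxy : x < y) : (T y).card < (T x).card := by
  refine Finset.card_lt_card (Finset.ssubset_iff_subset_ne.2 ⟨h.subset hxy.le, fun e => ?_⟩)
  exact hxy.ne (h.eq_of_eq le_rfl hxy.le e.symm)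

/-- Between two nonempty faces, one label is deleted; between the appended least face and a face
with fewer than `N` labels, `hlow` supplies an element. -/
theorem isRankFunction (h : IsBooleanAbove T) (hN : ∀ x, (T x).card ≤ N)
    (htop : ∃ t : P, ∀ x, x ≤ t) (hlow : ∀ y, (T y).card < N → ∃ x, x < y) :
    IsRankFunction (rank T N) N where
  strictMono := by
    intro a b hab
    induction b with
    | bot => exact absurd hab not_lt_bot
    | coe y =>
      have hy := hN y
      induction a with
      | bot => simp; omega
      | coe x =>
        have := h.card_lt (WithBot.coe_lt_coe.1 hab)
        have hx := hN x
        simp only [rank_coe]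
        omega
  exists_bot := ⟨⊥, rfl, fun _ => bot_le⟩
  exists_top := by
    obtain ⟨t, ht⟩ := htop
    obtain ⟨y, hy, hy0⟩ := h.exists_above t (Finset.empty_subset _)
    obtain rfl := le_antisymm hy (ht y)
    refine ⟨t, by simp [hy0], fun x => ?_⟩
    induction x with
    | bot => exact bot_le
    | coe x => exact WithBot.coe_le_coe.2 (ht x)
  exists_between := by
    intro a b hab hr
    induction b with
    | bot => exact absurd hab not_lt_bot
    | coe y =>
      induction a with
      | bot =>
        simp only [rank_bot, rank_coe] at hr
        obtain ⟨x, hx⟩ := hlow y (by omega)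
        exact ⟨x, WithBot.bot_lt_coe x, WithBot.coe_lt_coe.2 hx⟩
      | coe x =>
        rw [WithBot.coe_lt_coe] at hab
        simp only [rank_coe] at hr
        obtain ⟨t, htx, hty⟩ := Finset.exists_of_ssubset
          (Finset.ssubset_iff_subset_ne.2 ⟨h.subset hab.le, fun e => by rw [e] at hr; omega⟩)
        obtain ⟨g, hxg, hg⟩ := h.exists_above x (Finset.erase_subset t (T x))
        have hgc := Finset.card_erase_of_mem htx
        have hgy : g ≤ y := h.le_of_subset hxg hab.le (by
          rw [hg]
          exact Finset.subset_erase.2 ⟨h.subset hab.le, hty⟩)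
        have hpos := Finset.card_pos.2 ⟨t, htx⟩
        refine ⟨g, WithBot.coe_lt_coe.2 (lt_of_le_of_ne hxg ?_),
          WithBot.coe_lt_coe.2 (lt_of_le_of_ne hgy ?_)⟩
        · rintro rfl
          rw [← hg] at hgc
          omega
        · rintro rfl
          rw [← hg] at hgc
          omega

/-- Every element of the interval lies below a maximal one, with one label more than `y`. Two of
these lie above the element that has both additional labels; since the interval has rank at least 3,
that element differs from `x`. -/
theorem joined_Ioo (h : IsBooleanAbove T) {x y : P} (hxy : x ≤ y)
    (hcard : (T y).card + 3 ≤ (T x).card) {a b : P} (ha : a ∈ Set.Ioo x y) (hb : b ∈ Set.Ioo x y) :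
    Joined (Set.Ioo x y) a b := by
  have hyx := h.subset hxy
  have key : ∀ S, T y ⊂ S → S ⊂ T x → ∃ g ∈ Set.Ioo x y, T g = S := by
    intro S hS hS'
    obtain ⟨g, hxg, hg⟩ := h.exists_above x hS'.subset
    have hgy : g ≤ y := h.le_of_subset hxg hxy (hg ▸ hS.subset)
    refine ⟨g, ⟨lt_of_le_of_ne hxg ?_, lt_of_le_of_ne hgy ?_⟩, hg⟩
    · rintro rfl
      exact hS'.ne hg.symm
    · rintro rfl
      exact hS.ne hg
  have pick : ∀ c ∈ Set.Ioo x y, ∃ s ∈ T x, s ∉ T y ∧ s ∈ T c := by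
    intro c hc
    obtain ⟨s, hs, hs'⟩ := Finset.exists_of_ssubset (Finset.ssubset_iff_subset_ne.2
      ⟨h.subset hc.2.le, fun e => by have := h.card_lt hc.2; rw [e] at this; omega⟩)
    exact ⟨s, h.subset hc.1.le hs, hs', hs⟩
  have sing : ∀ c ∈ Set.Ioo x y, ∀ s ∉ T y, s ∈ T c → ∀ g ∈ Set.Ioo x y, T g = insert s (T y) →
      c ≤ g := by
    intro c hc s _ hs g hg e
    refine h.le_of_subset hc.1.le hg.1.le ?_
    rw [e]
    exact Finset.insert_subset hs (h.subset hc.2.le)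
  obtain ⟨s, hsx, hsy, hsa⟩ := pick a ha
  obtain ⟨s', hsx', hsy', hsb⟩ := pick b hb
  have hc1 : ∀ s ∉ T y, (insert s (T y)).card = (T y).card + 1 :=
    fun s hs => Finset.card_insert_of_notMem hs
  have hc2 : (insert s (insert s' (T y))).card ≤ (T y).card + 2 := by
    have := Finset.card_insert_le s (insert s' (T y))
    rw [hc1 s' hsy'] at this
    omega
  have hss : ∀ S, S ⊆ T x → S.card < (T x).card → S ⊂ T x := fun S hS hlt =>
    Finset.ssubset_iff_subset_ne.2 ⟨hS, by rintro rfl; omega⟩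
  obtain ⟨g, hg, hgT⟩ := key (insert s (T y)) (Finset.ssubset_insert hsy)
    (hss _ (Finset.insert_subset hsx hyx) (by rw [hc1 s hsy]; omega))
  obtain ⟨g', hg', hgT'⟩ := key (insert s' (T y)) (Finset.ssubset_insert hsy')
    (hss _ (Finset.insert_subset hsx' hyx) (by rw [hc1 s' hsy']; omega))
  obtain ⟨k, hk, hkT⟩ := key (insert s (insert s' (T y)))
    (lt_of_lt_of_le (Finset.ssubset_insert hsy') (Finset.subset_insert _ _))
    (hss _ (Finset.insert_subset hsx (Finset.insert_subset hsx' hyx)) (by omega))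
  have h1 := sing a ha s hsy hsa g hg hgT
  have h2 := sing b hb s' hsy' hsb g' hg' hgT'
  have h3 := sing k hk s hsy (by simp [hkT]) g hg hgT
  have h4 := sing k hk s' hsy' (by simp [hkT]) g' hg' hgT'
  exact (Joined.of_le ha hg h1).trans
    ((Joined.of_common_lower hk hg hg' h3 h4).trans (Joined.of_le hb hg' h2).symm)

theorem joined_bot_Ioo {y : P} {a b : P} (h : Joined (Set.Iio y) a b) :
    Joined (Set.Ioo (⊥ : WithBot P) y) a b := fun S hS =>
  h (fun c => S c) fun c hc d hd hcd =>
    hS c ⟨WithBot.bot_lt_coe c, WithBot.coe_lt_coe.2 hc⟩ d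
      ⟨WithBot.bot_lt_coe d, WithBot.coe_lt_coe.2 hd⟩ (WithBot.coe_le_coe.2 hcd)

theorem joined_coe_Ioo {x y : P} {a b : P} (h : Joined (Set.Ioo x y) a b) :
    Joined (Set.Ioo (x : WithBot P) y) a b := fun S hS =>
  h (fun c => S c) fun c hc d hd hcd =>
    hS c ⟨WithBot.coe_lt_coe.2 hc.1, WithBot.coe_lt_coe.2 hc.2⟩ d
      ⟨WithBot.coe_lt_coe.2 hd.1, WithBot.coe_lt_coe.2 hd.2⟩ (WithBot.coe_le_coe.2 hcd)

theorem ncard_Ioo (h : IsBooleanAbove T) {x y : P} (hxy : x ≤ y)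
    (hcard : (T x).card = (T y).card + 2) : (Set.Ioo x y).ncard = 2 := by
  have hsub := h.subset hxy
  have h2 : (T x \ T y).card = 2 := by
    rw [Finset.card_sdiff_of_subset hsub]
    omega
  obtain ⟨s, s', hne, hs⟩ := Finset.card_eq_two.1 h2
  have hmem : ∀ a, a ∈ T x ∧ a ∉ T y ↔ a = s ∨ a = s' := by
    intro a
    rw [← Finset.mem_sdiff, hs]
    simp
  obtain ⟨hsx, hsy⟩ := (hmem s).2 (Or.inl rfl)
  obtain ⟨hsx', hsy'⟩ := (hmem s').2 (Or.inr rfl)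
  obtain ⟨g, hxg, hg⟩ := h.exists_above x (Finset.insert_subset hsx hsub)
  obtain ⟨g', hxg', hg'⟩ := h.exists_above x (Finset.insert_subset hsx' hsub)
  have hgg : g ≠ g' := by
    rintro rfl
    have : s ∈ insert s' (T y) := by rw [← hg', hg]; exact Finset.mem_insert_self _ _
    rw [Finset.mem_insert] at this
    exact this.elim hne hsy
  rw [Set.ncard_eq_two]
  refine ⟨g, g', hgg, Set.ext fun k => ⟨fun hk => ?_, ?_⟩⟩
  · have hkx := h.subset hk.1.le
    have hyk := h.subset hk.2.le
    have hk1 := h.card_lt hk.1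
    have hk2 := h.card_lt hk.2
    obtain ⟨a, hak, hay⟩ := Finset.exists_of_ssubset (Finset.ssubset_iff_subset_ne.2
      ⟨hyk, fun e => by rw [e] at hk2; omega⟩)
    have hins : insert a (T y) = T k := by
      apply Finset.eq_of_subset_of_card_le (Finset.insert_subset hak hyk)
      rw [Finset.card_insert_of_notMem hay]
      omega
    rcases (hmem a).1 ⟨hkx hak, hay⟩ with rfl | rfl
    · exact Or.inl (h.eq_of_eq hk.1.le hxg (hins.symm.trans hg.symm))
    · exact Or.inr (h.eq_of_eq hk.1.le hxg' (hins.symm.trans hg'.symm))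
  · have : ∀ g, x ≤ g → ∀ s ∉ T y, T g = insert s (T y) → g ∈ Set.Ioo x y := by
      intro g hxg s hsy hg
      have hc := Finset.card_insert_of_notMem hsy
      rw [← hg] at hc
      refine ⟨lt_of_le_of_ne hxg (by rintro rfl; omega), lt_of_le_of_ne
        (h.le_of_subset hxg hxy (by rw [hg]; exact Finset.subset_insert _ _)) (by rintro rfl; omega)⟩
    rintro (rfl | rfl)
    · exact this _ hxg s hsy hg
    · exact this _ hxg' s' hsy' hg'

/-- Intervals that start at a nonempty face are Boolean. Only those from the appended least face
need `hedge` (rank 2) and `hconn` (rank at least 3). -/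
theorem isAbstractPolytope (h : IsBooleanAbove T) (hN : ∀ x, (T x).card ≤ N)
    (htop : ∃ t : P, ∀ x, x ≤ t) (hlow : ∀ y, (T y).card < N → ∃ x, x < y)
    (hedge : ∀ y, (T y).card + 1 = N → (Set.Iio y).ncard = 2)
    (hconn : ∀ y, (T y).card + 2 ≤ N → ∀ a < y, ∀ b < y, Joined (Set.Iio y) a b) :
    IsAbstractPolytope (WithBot P) N := by
  have hr := h.isRankFunction hN htop hlow
  refine ⟨⟨⊥, Set.mem_univ _, fun _ _ => bot_le⟩, ?_, hr.ncard_flag,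
    hr.strongly_flag_connected ?_, ?_⟩
  · obtain ⟨t, -, ht⟩ := hr.exists_top
    exact ⟨t, Set.mem_univ _, fun x _ => ht x⟩
  · intro f g hfg hrk x hx y hy
    induction g with
    | bot => exact absurd hfg not_lt_bot
    | coe g =>
      induction x with
      | bot => exact absurd hx.1 not_lt_bot
      | coe x =>
        induction y with
        | bot => exact absurd hy.1 not_lt_bot
        | coe y =>
          induction f with
          | bot =>
            simp only [rank_bot, rank_coe] at hrk
            exact joined_bot_Ioo (hconn g (by omega) x (WithBot.coe_lt_coe.1 hx.2) y
              (WithBot.coe_lt_coe.1 hy.2))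
          | coe f =>
            have := hN f
            simp only [rank_coe] at hrk
            exact joined_coe_Ioo (h.joined_Ioo (WithBot.coe_le_coe.1 hfg.le) (by omega)
              ⟨WithBot.coe_lt_coe.1 hx.1, WithBot.coe_lt_coe.1 hx.2⟩
              ⟨WithBot.coe_lt_coe.1 hy.1, WithBot.coe_lt_coe.1 hy.2⟩)
  · intro f g hfg hh
    rw [hr.height_eq, hr.height_eq] at hh
    replace hh : rank T N g = rank T N f + 2 := by exact_mod_cast hh
    induction g with
    | bot => exact absurd hfg not_lt_bot
    | coe g =>
      induction f with
      | bot =>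
        simp only [rank_bot, rank_coe] at hh
        rw [← hedge g (by omega),
          ← Set.ncard_image_of_injective _ (WithBot.coe_injective (α := P))]
        refine congrArg Set.ncard (Set.ext fun k => ?_)
        induction k with
        | bot => simp
        | coe k => simp
      | coe f =>
        have := hN f
        simp only [rank_coe] at hh
        rw [← h.ncard_Ioo (WithBot.coe_le_coe.1 hfg.le) (by omega),
          ← Set.ncard_image_of_injective _ (WithBot.coe_injective (α := P))]
        refine congrArg Set.ncard (Set.ext fun k => ?_)
        induction k with
        | bot => simp
        | coe k => simp

theorem isSimplePolytope (h : IsBooleanAbove T) (hN : ∀ x, (T x).card ≤ N)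
    (htop : ∃ t : P, ∀ x, x ≤ t) (hlow : ∀ y, (T y).card < N → ∃ x, x < y) :
    IsSimplePolytope (WithBot P) N := by
  have hr := h.isRankFunction hN htop hlow
  intro w hw
  rw [hr.height_eq] at hw
  replace hw : rank T N w = 1 := by exact_mod_cast hw
  induction w with
  | bot => simp at hw
  | coe x =>
    have hx := hN x
    simp only [rank_coe] at hw
    have hcard : (T x).card = N := by omega
    let e := ((T x).equivFinOfCardEq hcard).symm
    -- `S` records the deleted labels, not those that are kept, so that larger sets give larger
    -- faces.
    have hex : ∀ S : Finset (Fin N), ∃ y, x ≤ y ∧ T y = T x \ S.image (fun i => (e i : ι)) :=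
      fun S => h.exists_above x Finset.sdiff_subset
    choose f hf hfT using hex
    have hle : ∀ S S', f S ≤ f S' ↔ S ≤ S' := by
      intro S S'
      constructor
      · intro hle i hi
        by_contra hi'
        have : (e i : ι) ∈ T (f S) := h.subset hle (by
          rw [hfT, Finset.mem_sdiff]
          refine ⟨(e i).2, fun hh => ?_⟩
          obtain ⟨j, hj, hji⟩ := Finset.mem_image.1 hh
          rw [e.injective (Subtype.ext hji)] at hj
          exact hi' hj)
        rw [hfT, Finset.mem_sdiff] at this
        exact this.2 (Finset.mem_image_of_mem _ hi)
      · intro hS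
        refine h.le_of_subset (hf _) (hf _) ?_
        rw [hfT, hfT]
        exact Finset.sdiff_subset_sdiff subset_rfl (Finset.image_subset_image hS)
    let φ : Finset (Fin N) ↪o Set.Ici (x : WithBot P) :=
      OrderEmbedding.ofMapLEIff (fun S => ⟨(f S : WithBot P), Set.mem_Ici.2 (WithBot.coe_le_coe.2 (hf S))⟩)
        fun S S' => by rw [Subtype.mk_le_mk, WithBot.coe_le_coe, hle]
    refine ⟨(RelIso.ofSurjective φ ?_).symm⟩
    rintro ⟨y, hy⟩
    induction y with
    | bot => exact absurd (lt_of_lt_of_le (WithBot.bot_lt_coe x) hy) (lt_irrefl _)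
    | coe y =>
      have hxy : x ≤ y := WithBot.coe_le_coe.1 hy
      refine ⟨Finset.univ.filter fun i => (e i : ι) ∉ T y, Subtype.ext ?_⟩
      change ((f _ : P) : WithBot P) = y
      rw [WithBot.coe_inj]
      refine h.eq_of_eq (hf _) hxy ?_
      rw [hfT]
      ext t
      simp only [Finset.mem_sdiff, Finset.mem_image, Finset.mem_filter, Finset.mem_univ, true_and,
        not_exists, not_and]
      constructor
      · rintro ⟨htx, ht⟩
        by_contra hty
        refine ht (e.symm ⟨t, htx⟩) ?_ ?_ <;> simp [hty]
      · intro hty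
        refine ⟨h.subset hxy hty, ?_⟩
        rintro i hi rfl
        exact hi hty

end IsBooleanAbove
end ColorfulGA

namespace ColorfulGA

open scoped Classical

/-! ### Tubes -/

section Tubes

variable {V : Type u} {G : SimpleGraph V} {T : Finset (Finset V)} {s t w : Finset V}

/-- Connectivity is used below through sets closed under adjacency rather than through walks; these
are easy to transport between tubes, cores and subgraphs. -/
theorem preconnected_iff_forall_set {W : Type*} (H : SimpleGraph W) :
    H.Preconnected ↔ ∀ A : Set W, A.Nonempty → (∀ a ∈ A, ∀ b, H.Adj a b → b ∈ A) → ∀ b, b ∈ A := by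
  constructor
  · rintro h A ⟨a, ha⟩ hA b
    have := (SimpleGraph.reachable_iff_reflTransGen a b).1 (h a b)
    induction this with
    | refl => exact ha
    | tail _ hadj ih => exact hA _ ih _ hadj
  · intro h a b
    exact h {b | H.Reachable a b} ⟨a, SimpleGraph.Reachable.refl a⟩
      (fun c hc d hcd => SimpleGraph.Reachable.trans hc hcd.reachable) b

theorem IsTube.nonempty (h : IsTube G s) : s.Nonempty := by
  obtain ⟨⟨v, hv⟩⟩ := SimpleGraph.Connected.nonempty h
  exact ⟨v, hv⟩

/-- A set that is closed under adjacency within a tube and meets the tube contains it. -/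
theorem IsTube.forall_mem_of_closed (h : IsTube G s) (X : Set V) {v : V} (hv : v ∈ s) (hvX : v ∈ X)
    (hX : ∀ a ∈ s, a ∈ X → ∀ b ∈ s, G.Adj a b → b ∈ X) : ∀ b ∈ s, b ∈ X := by
  intro b hb
  exact (preconnected_iff_forall_set _).1 h.preconnected {a | (a : V) ∈ X} ⟨⟨v, hv⟩, hvX⟩
    (fun a ha c hac => hX a a.2 ha c c.2 hac) ⟨b, hb⟩

theorem isTube_of_forall {v : V} (hv : v ∈ s)
    (h : ∀ X : Set V, v ∈ X → (∀ a ∈ s, a ∈ X → ∀ b ∈ s, G.Adj a b → b ∈ X) → ∀ b ∈ s, b ∈ X) :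
    IsTube G s := by
  have : Nonempty (s : Set V) := ⟨⟨v, hv⟩⟩
  have key : ∀ b : (s : Set V), (G.induce (s : Set V)).Reachable ⟨v, hv⟩ b := by
    rintro ⟨b, hb⟩
    obtain ⟨hb', hr⟩ := h {b | ∃ hb : b ∈ (s : Set V),
      (G.induce (s : Set V)).Reachable ⟨v, hv⟩ ⟨b, hb⟩} ⟨hv, SimpleGraph.Reachable.refl _⟩
      (by
        rintro a - ⟨ha, har⟩ b hb hab
        exact ⟨hb, har.trans (SimpleGraph.Adj.reachable
          (show (G.induce (s : Set V)).Adj ⟨a, ha⟩ ⟨b, hb⟩ from hab))⟩) b hb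
    exact hr
  exact ⟨fun a b => (key a).symm.trans (key b)⟩

theorem IsUniversalTube.mem_of_adj (h : IsUniversalTube G s) {a b : V} (ha : a ∈ s)
    (hab : G.Adj a b) : b ∈ s := by
  obtain ⟨C, hC⟩ := h
  have := C.mem_supp_of_adj_mem_supp (hC ▸ Finset.mem_coe.2 ha) hab
  exact Finset.mem_coe.1 (hC ▸ this)

theorem IsUniversalTube.isTube (h : IsUniversalTube G s) : IsTube G s := by
  obtain ⟨C, hC⟩ := h
  have := C.maximal_connected_induce_supp.1
  rwa [← hC] at this

theorem IsUniversalTube.subset_of_mem (h : IsUniversalTube G s) (ht : IsTube G t) {a : V}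
    (has : a ∈ s) (hat : a ∈ t) : t ⊆ s :=
  ht.forall_mem_of_closed {x | x ∈ s} hat has fun _ _ hx _ _ hxy => h.mem_of_adj hx hxy

theorem IsUniversalTube.not_ssubset (h : IsUniversalTube G s) (ht : IsTube G t) : ¬ s ⊂ t := by
  intro hst
  obtain ⟨a, ha⟩ := h.isTube.nonempty
  exact hst.2 (h.subset_of_mem ht ha (hst.1 ha))

theorem IsTubing.mono {T' : Finset (Finset V)} (hT : IsTubing G T) (h : T' ⊆ T) : IsTubing G T' where
  tube t ht := hT.tube t (h ht)
  compatible s hs t ht := hT.compatible s (h hs) t (h ht)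
  proper := by
    obtain ⟨s, hs, hsT⟩ := hT.proper
    exact ⟨s, hs, fun hh => hsT (h hh)⟩

variable [Finite V]

@[simp] theorem mem_universalTubes : s ∈ universalTubes G ↔ IsUniversalTube G s := by
  simp [universalTubes]

theorem exists_universalTube_mem (G : SimpleGraph V) (v : V) : ∃ s, IsUniversalTube G s ∧ v ∈ s :=
  ⟨(Set.toFinite (G.connectedComponentMk v).supp).toFinset,
    ⟨G.connectedComponentMk v, by simp⟩, by simp⟩

theorem card_universalTubes (G : SimpleGraph V) :
    (universalTubes G).card = Nat.card G.ConnectedComponent := by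
  have h : Nat.card {s : Finset V | IsUniversalTube G s} = (universalTubes G).card := by
    rw [Nat.card_coe_set_eq, universalTubes, Set.ncard_eq_toFinset_card]
  rw [← h]
  symm
  refine Nat.card_congr (Equiv.ofBijective
    (fun C => ⟨(Set.toFinite C.supp).toFinset, ⟨C, by simp⟩⟩) ⟨?_, ?_⟩)
  · intro C D h
    have := congrArg (fun x : {s | IsUniversalTube G s} => ((x : Finset V) : Set V)) h
    exact SimpleGraph.ConnectedComponent.supp_injective (by simpa using this)
  · rintro ⟨s, C, hC⟩
    refine ⟨C, Subtype.ext ?_⟩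
    apply Finset.coe_injective
    simp [hC]

theorem IsTubing.isTube (hT : IsTubing G T) (hs : s ∈ T ∪ universalTubes G) : IsTube G s := by
  rcases Finset.mem_union.1 hs with h | h
  · exact hT.tube s h
  · exact (mem_universalTubes.1 h).isTube

theorem mem_of_ssubset_of_isTube (hs : s ∈ T ∪ universalTubes G)
    (hst : s ⊂ t) (ht : IsTube G t) : s ∈ T := by
  rcases Finset.mem_union.1 hs with h | h
  · exact h
  · exact absurd hst ((mem_universalTubes.1 h).not_ssubset ht)

/-- Two tubes of a tubing that share a node or are joined by an edge are nested. -/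
theorem IsTubing.nested (hT : IsTubing G T) (hs : s ∈ T ∪ universalTubes G)
    (ht : t ∈ T ∪ universalTubes G) {a b : V} (ha : a ∈ s) (hb : b ∈ t) (hab : a = b ∨ G.Adj a b) :
    s ⊂ t ∨ s = t ∨ t ⊂ s := by
  have key : ∀ {s t : Finset V} {a b : V}, IsTube G t → IsUniversalTube G s → a ∈ s → b ∈ t →
      (a = b ∨ G.Adj a b) → t = s ∨ t ⊂ s := by
    intro s t a b ht hs ha hb hab
    have hbs : b ∈ s := by
      rcases hab with rfl | hab
      · exact ha
      · exact hs.mem_of_adj ha hab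
    exact (hs.subset_of_mem ht hbs hb).eq_or_ssubset
  rcases Finset.mem_union.1 hs with hs' | hs'
  · rcases Finset.mem_union.1 ht with ht' | ht'
    · by_cases hst : s = t
      · exact Or.inr (Or.inl hst)
      · rcases hT.compatible s hs' t ht' hst with h | h | ⟨hd, h⟩
        · exact Or.inl h
        · exact Or.inr (Or.inr h)
        · rcases hab with rfl | hab
          · exact absurd hb (Finset.disjoint_left.1 hd ha)
          · exact absurd hab (h a ha b hb)
    · rcases key (hT.isTube hs) (mem_universalTubes.1 ht') hb ha
        (hab.imp Eq.symm fun h => h.symm) with h | h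
      · exact Or.inr (Or.inl h)
      · exact Or.inl h
  · rcases key (hT.isTube ht) (mem_universalTubes.1 hs') ha hb hab with h | h
    · exact Or.inr (Or.inl h.symm)
    · exact Or.inr (Or.inr h)

/-- `s` is the smallest tube of `T`, possibly a universal one, that properly contains `t`. -/
structure IsParent (G : SimpleGraph V) (T : Finset (Finset V)) (t s : Finset V) : Prop where
  mem : s ∈ T ∪ universalTubes G
  ssubset : t ⊂ s
  subset : ∀ w ∈ T ∪ universalTubes G, t ⊂ w → s ⊆ w

theorem IsParent.eq {s' : Finset V} (h : IsParent G T t s) (h' : IsParent G T t s') : s = s' :=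
  subset_antisymm (h.subset _ h'.mem h'.ssubset) (h'.subset _ h.mem h.ssubset)

/-- The tubes that properly contain `t` share its nodes and are therefore nested; one with the
fewest nodes is contained in all of them. -/
theorem exists_isParent (hT : IsTubing G T) (ht : IsTube G t) (htU : ¬ IsUniversalTube G t) :
    ∃ s, IsParent G T t s := by
  obtain ⟨v, hv⟩ := ht.nonempty
  obtain ⟨u, hu, hvu⟩ := exists_universalTube_mem G v
  have hsub : t ⊂ u := (hu.subset_of_mem ht hvu hv).ssubset_of_ne (by rintro rfl; exact htU hu)
  obtain ⟨s, hs, hmin⟩ := Finset.exists_min_image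
    ((T ∪ universalTubes G).filter fun w => t ⊂ w) Finset.card
    ⟨u, by simp [hu, hsub]⟩
  rw [Finset.mem_filter] at hs
  refine ⟨s, hs.1, hs.2, fun w hw htw => ?_⟩
  rcases hT.nested hs.1 hw (hs.2.1 hv) (htw.1 hv) (Or.inl rfl) with h | h | h
  · exact h.1
  · exact h.subset
  · exact absurd (Finset.card_lt_card h) (not_lt.2 (hmin w (Finset.mem_filter.2 ⟨hw, htw⟩)))

/-! ### Cores -/

/-- Adjacency in the core of `s`, as a relation on all nodes. -/
def CoreAdj (G : SimpleGraph V) (T : Finset (Finset V)) (s : Finset V) (a b : V) : Prop :=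
  G.Adj a b ∨ ∃ t' ∈ T, t' ⊂ s ∧ (∃ c ∈ t', G.Adj a c) ∧ (∃ d ∈ t', G.Adj b d)

omit [Finite V] in
theorem CoreAdj.symm {a b : V} (h : CoreAdj G T s a b) : CoreAdj G T s b a := by
  rcases h with h | ⟨t', ht', hs, hc, hd⟩
  · exact Or.inl h.symm
  · exact Or.inr ⟨t', ht', hs, hd, hc⟩

/-- `X` is the disjoint union of two nonempty sets that are not related to each other by `R`. -/
def IsCut {V : Type u} (R : V → V → Prop) (X : Set V) : Prop :=
  ∃ A B : Set V, A.Nonempty ∧ B.Nonempty ∧ A ∪ B = X ∧ ∀ a ∈ A, ∀ b ∈ B, a ≠ b ∧ ¬ R a b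

-- Translates the definition of connectivity from subtypes into sets of nodes of `V`, where the
-- cores for different tubings can be compared.
omit [Finite V] in
theorem conn_spec (S : Set (coreSet T s)) :
    (¬ ((coreGraph G T s).induce Sᶜ).Preconnected ∨ Sᶜ.ncard ≤ 1) ↔
    (IsCut (CoreAdj G T s) (coreSet T s \ Subtype.val '' S) ∨
      (coreSet T s \ Subtype.val '' S).ncard ≤ 1) := by
  have himg : Subtype.val '' Sᶜ = coreSet T s \ Subtype.val '' S := by
    rw [Set.image_compl_eq_range_sdiff_image Subtype.val_injective, Subtype.range_coe]
  apply or_congr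
  · rw [preconnected_iff_forall_set]
    push Not
    constructor
    · rintro ⟨A, hA, hcl, b, hb⟩
      refine ⟨{v | ∃ h : v ∈ coreSet T s, ∃ h' : (⟨v, h⟩ : coreSet T s) ∈ Sᶜ, (⟨_, h'⟩ : Sᶜ.Elem) ∈ A},
        {v | ∃ h : v ∈ coreSet T s, ∃ h' : (⟨v, h⟩ : coreSet T s) ∈ Sᶜ, (⟨_, h'⟩ : Sᶜ.Elem) ∉ A},
        ?_, ?_, ?_, ?_⟩
      · obtain ⟨⟨⟨a, ha⟩, ha'⟩, haA⟩ := hA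
        exact ⟨a, ha, ha', haA⟩
      · obtain ⟨⟨b, hb1⟩, hb2⟩ := b
        exact ⟨b, hb1, hb2, hb⟩
      · rw [← himg]
        ext v
        constructor
        · rintro (⟨h, h', -⟩ | ⟨h, h', -⟩) <;> exact ⟨⟨v, h⟩, h', rfl⟩
        · rintro ⟨⟨v, h⟩, h', rfl⟩
          by_cases hv : (⟨_, h'⟩ : Sᶜ.Elem) ∈ A
          · exact Or.inl ⟨h, h', hv⟩
          · exact Or.inr ⟨h, h', hv⟩
      · rintro a ⟨ha, ha', haA⟩ b ⟨hb, hb', hbA⟩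
        have hne : a ≠ b := by rintro rfl; exact hbA haA
        refine ⟨hne, fun hab => hbA (hcl _ haA _ ?_)⟩
        exact ⟨fun e => hne (congrArg Subtype.val e), hab⟩
    · rintro ⟨A, B, ⟨a, ha⟩, ⟨b, hb⟩, hAB, hR⟩
      have hmem : ∀ v ∈ A ∪ B, ∃ h : v ∈ coreSet T s, (⟨v, h⟩ : coreSet T s) ∈ Sᶜ := by
        intro v hv
        rw [hAB, ← himg] at hv
        obtain ⟨⟨v, h⟩, h', rfl⟩ := hv
        exact ⟨h, h'⟩
      obtain ⟨ha1, ha2⟩ := hmem a (Or.inl ha)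
      obtain ⟨hb1, hb2⟩ := hmem b (Or.inr hb)
      refine ⟨{v | (v : coreSet T s).1 ∈ A}, ⟨⟨⟨a, ha1⟩, ha2⟩, ha⟩, ?_, ⟨⟨b, hb1⟩, hb2⟩, ?_⟩
      · rintro ⟨⟨x, hx⟩, hx'⟩ hxA ⟨⟨y, hy⟩, hy'⟩ hxy
        have hyAB : y ∈ A ∪ B := by
          rw [hAB, ← himg]
          exact ⟨⟨y, hy⟩, hy', rfl⟩
        rcases hyAB with h | h
        · exact h
        · exact absurd hxy.2 (hR x hxA y h).2
      · intro hbA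
        exact (hR b hbA b hb).1 rfl
  · rw [← himg, Set.ncard_image_of_injective _ Subtype.val_injective]

/-- The connectivity of the core of `s`. -/
noncomputable def conn (G : SimpleGraph V) (T : Finset (Finset V)) (s : Finset V) : ℕ :=
  connectivity (coreGraph G T s)

omit [Finite V] in
theorem conn_le {S : Set V} (hS : S ⊆ coreSet T s)
    (h : IsCut (CoreAdj G T s) (coreSet T s \ S) ∨ (coreSet T s \ S).ncard ≤ 1) :
    conn G T s ≤ S.ncard := by
  refine Nat.sInf_le ⟨Subtype.val ⁻¹' S, ?_, ?_⟩
  · rw [← Set.ncard_image_of_injective _ Subtype.val_injective, Subtype.image_preimage_coe,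
      Set.inter_eq_right.2 hS]
  · rw [conn_spec, Subtype.image_preimage_coe, Set.inter_eq_right.2 hS]
    exact h

omit [Finite V] in
theorem exists_ncard_eq_conn (G : SimpleGraph V) (T : Finset (Finset V)) (s : Finset V) :
    ∃ S ⊆ coreSet T s, S.ncard = conn G T s ∧
      (IsCut (CoreAdj G T s) (coreSet T s \ S) ∨ (coreSet T s \ S).ncard ≤ 1) := by
  have hne : {k | ∃ S : Set (coreSet T s), S.ncard = k ∧
      (¬ ((coreGraph G T s).induce Sᶜ).Preconnected ∨ Sᶜ.ncard ≤ 1)}.Nonempty :=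
    ⟨_, Set.univ, rfl, Or.inr (by simp)⟩
  obtain ⟨S, hS, h⟩ := Nat.sInf_mem hne
  refine ⟨Subtype.val '' S, ?_, ?_, (conn_spec S).1 h⟩
  · rintro _ ⟨v, -, rfl⟩
    exact v.2
  · rw [Set.ncard_image_of_injective _ Subtype.val_injective]
    exact hS

theorem conn_lt_ncard (h : (coreSet T s).Nonempty) : conn G T s < (coreSet T s).ncard := by
  obtain ⟨v, hv⟩ := h
  have h1 := Set.ncard_sdiff_singleton_add_one hv (Set.toFinite _)
  have h2 : conn G T s ≤ (coreSet T s \ {v}).ncard := conn_le Set.sdiff_subset (Or.inr (by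
    rw [Set.sdiff_sdiff_cancel_left (Set.singleton_subset_iff.2 hv), Set.ncard_singleton]))
  omega

/-- If the core is not complete, all sizes of cutsets from the connectivity on are possible. -/
theorem exists_isCut {j : ℕ} (h : conn G T s ≤ j) (hj : j + 2 ≤ (coreSet T s).ncard) :
    ∃ S ⊆ coreSet T s, S.ncard = j ∧ IsCut (CoreAdj G T s) (coreSet T s \ S) := by
  obtain ⟨S, hS, hSc, hcut⟩ := exists_ncard_eq_conn G T s
  have hsum := Set.ncard_sdiff_add_ncard_of_subset hS (Set.toFinite _)
  rcases hcut with ⟨A, B, ⟨a, ha⟩, ⟨b, hb⟩, hAB, hR⟩ | hle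
  swap
  · omega
  have haX : a ∈ coreSet T s \ S := hAB ▸ Or.inl ha
  have hbX : b ∈ coreSet T s \ S := hAB ▸ Or.inr hb
  have hab : ({a, b} : Set V).ncard = 2 := Set.ncard_pair (hR a ha b hb).1
  have hsub : ({a, b} : Set V) ⊆ coreSet T s := by
    rintro x (rfl | rfl)
    · exact haX.1
    · exact hbX.1
  have hd := Set.ncard_sdiff_add_ncard_of_subset hsub (Set.toFinite _)
  -- The cutset is enlarged without touching `a` and `b`, so both sides of the cut stay nonempty.
  obtain ⟨S', hSS', hS'X, hS'c⟩ := Set.exists_subsuperset_card_eq (s := S) (n := j)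
    (t := coreSet T s \ {a, b}) (by
      intro x hx
      refine ⟨hS hx, ?_⟩
      rintro (rfl | rfl)
      · exact haX.2 hx
      · exact hbX.2 hx) (by omega) (by omega)
  refine ⟨S', hS'X.trans Set.sdiff_subset, hS'c, A \ S', B \ S', ⟨a, ha, fun h => ?_⟩,
    ⟨b, hb, fun h => ?_⟩, ?_, fun a ha b hb => hR a ha.1 b hb.1⟩
  · exact (hS'X h).2 (Or.inl rfl)
  · exact (hS'X h).2 (Or.inr rfl)
  · rw [← Set.union_sdiff_distrib, hAB, Set.sdiff_sdiff, Set.union_eq_right.2 hSS']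

omit [Finite V] in
/-- The connectivity of a core depends only on its nodes and their adjacency. -/
theorem conn_eq_of_image {V' : Type u} [Finite V'] {G' : SimpleGraph V'} {T' : Finset (Finset V')}
    {s' : Finset V'} (e : V' → V) (he : Function.Injective e)
    (hX : coreSet T s = e '' coreSet T' s')
    (hR : ∀ a ∈ coreSet T' s', ∀ b ∈ coreSet T' s', a ≠ b →
      (CoreAdj G T s (e a) (e b) ↔ CoreAdj G' T' s' a b)) : conn G T s = conn G' T' s' := by
  apply le_antisymm
  · obtain ⟨S, hS, hSc, h⟩ := exists_ncard_eq_conn G' T' s'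
    rw [← hSc, ← Set.ncard_image_of_injective S he]
    have hd : coreSet T s \ e '' S = e '' (coreSet T' s' \ S) := by
      rw [hX, Set.image_sdiff he]
    refine conn_le (hX ▸ Set.image_mono hS) ?_
    rw [hd, Set.ncard_image_of_injective _ he]
    refine h.imp_left ?_
    rintro ⟨A, B, hA, hB, hAB, hAR⟩
    refine ⟨e '' A, e '' B, hA.image e, hB.image e, by rw [← Set.image_union, hAB], ?_⟩
    rintro _ ⟨a, ha, rfl⟩ _ ⟨b, hb, rfl⟩
    obtain ⟨hne, hab⟩ := hAR a ha b hb
    have haX : a ∈ coreSet T' s' \ S := hAB ▸ Or.inl ha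
    have hbX : b ∈ coreSet T' s' \ S := hAB ▸ Or.inr hb
    exact ⟨he.ne hne, by rwa [hR a haX.1 b hbX.1 hne]⟩
  · obtain ⟨S, hS, hSc, h⟩ := exists_ncard_eq_conn G T s
    rw [hX] at hS
    obtain ⟨S, hS', rfl⟩ := Set.subset_image_iff.1 hS
    rw [← hSc, Set.ncard_image_of_injective S he]
    have hd : coreSet T s \ e '' S = e '' (coreSet T' s' \ S) := by
      rw [hX, Set.image_sdiff he]
    refine conn_le hS' ?_
    rw [hd, Set.ncard_image_of_injective _ he] at h
    refine h.imp_left ?_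
    rintro ⟨A, B, hA, hB, hAB, hAR⟩
    have hA' : A ⊆ e '' (coreSet T' s' \ S) := hAB ▸ Set.subset_union_left
    have hB' : B ⊆ e '' (coreSet T' s' \ S) := hAB ▸ Set.subset_union_right
    obtain ⟨A, hA'', rfl⟩ := Set.subset_image_iff.1 hA'
    obtain ⟨B, hB'', rfl⟩ := Set.subset_image_iff.1 hB'
    refine ⟨A, B, hA.of_image, hB.of_image, ?_, ?_⟩
    · rw [← Set.image_union] at hAB
      exact he.image_injective hAB
    · intro a ha b hb
      obtain ⟨hne, hab⟩ := hAR _ ⟨a, ha, rfl⟩ _ ⟨b, hb, rfl⟩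
      have hne' : a ≠ b := fun h => hne (h ▸ rfl)
      exact ⟨hne', by rwa [hR a (hA'' ha).1 b (hB'' hb).1 hne'] at hab⟩

theorem conn_congr {T' : Finset (Finset V)} {s' : Finset V} (hX : coreSet T s = coreSet T' s')
    (hR : ∀ a ∈ coreSet T' s', ∀ b ∈ coreSet T' s', a ≠ b →
      (CoreAdj G T s a b ↔ CoreAdj G T' s' a b)) : conn G T s = conn G T' s' :=
  conn_eq_of_image id Function.injective_id (by simpa using hX) hR

/-- The core of a tube is connected. -/
theorem not_isCut_coreSet (hT : IsTubing G T) (hs : s ∈ T ∪ universalTubes G) :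
    ¬ IsCut (CoreAdj G T s) (coreSet T s) := by
  rintro ⟨A, B, ⟨a, ha⟩, ⟨b, hb⟩, hAB, hR⟩
  have hA : ∀ x ∈ A, x ∈ coreSet T s := fun x hx => hAB ▸ Or.inl hx
  have hB : ∀ x ∈ B, x ∈ coreSet T s := fun x hx => hAB ▸ Or.inr hx
  -- The side `A` of the cut, together with all tubes below `s` that have a neighbor in `A`, is
  -- closed under adjacency within `s`.
  have key := (hT.isTube hs).forall_mem_of_closed
    {v | v ∈ A ∨ ∃ t' ∈ T, t' ⊂ s ∧ v ∈ t' ∧ ∃ x ∈ A, ∃ c ∈ t', G.Adj x c} (hA a ha).1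
    (Or.inl ha) ?_ b (hB b hb).1
  · rcases key with h | ⟨t', ht', hts, hbt, -⟩
    · exact (hR b h b hb).1 rfl
    · exact (hB b hb).2 t' ht' hts hbt
  · intro v hvs hv w hws hvw
    by_cases hwc : w ∈ coreSet T s
    · left
      rw [← hAB] at hwc
      rcases hwc with h | h
      · exact h
      · exfalso
        rcases hv with hv | ⟨t', ht', hts, hvt, x, hx, c, hc, hxc⟩
        · exact (hR v hv w h).2 (Or.inl hvw)
        · exact (hR x hx w h).2 (Or.inr ⟨t', ht', hts, ⟨c, hc, hxc⟩, v, hvt, hvw.symm⟩)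
    · right
      have : ∃ t' ∈ T, t' ⊂ s ∧ w ∈ t' := by
        by_contra! hne
        exact hwc ⟨hws, hne⟩
      obtain ⟨t'', ht'', hts'', hwt⟩ := this
      rcases hv with hv | ⟨t', ht', hts, hvt, x, hx, c, hc, hxc⟩
      · exact ⟨t'', ht'', hts'', hwt, v, hv, w, hwt, hvw⟩
      · rcases hT.nested (Finset.mem_union_left _ ht') (Finset.mem_union_left _ ht'') hvt hwt
          (Or.inr hvw) with h | h | h
        · exact ⟨t'', ht'', hts'', hwt, x, hx, c, h.1 hc, hxc⟩
        · exact ⟨t'', ht'', hts'', hwt, x, hx, c, h ▸ hc, hxc⟩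
        · exact ⟨t', ht', hts, h.1 hwt, x, hx, c, hc, hxc⟩

/-! ### Adding a tube -/

/-- `t` is a new tube that is not universal, and `s` is the smallest tube that contains it. -/
structure IsExtension (G : SimpleGraph V) (T : Finset (Finset V)) (t s : Finset V) : Prop where
  isTubing : IsTubing G (insert t T)
  notMem : t ∉ T
  not_universal : ¬ IsUniversalTube G t
  isParent : IsParent G T t s

namespace IsExtension

theorem tubing (h : IsExtension G T t s) : IsTubing G T :=
  h.isTubing.mono (Finset.subset_insert _ _)

theorem notMem_union (h : IsExtension G T t s) : t ∉ T ∪ universalTubes G := by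
  simp [h.notMem, h.not_universal]

theorem ne_of_mem (h : IsExtension G T t s) (hw : w ∈ T ∪ universalTubes G) : w ≠ t := by
  rintro rfl
  exact h.notMem_union hw

theorem mem_insert (hw : w ∈ T ∪ universalTubes G) : w ∈ insert t T ∪ universalTubes G := by
  rw [Finset.insert_union]
  exact Finset.mem_insert_of_mem hw

theorem mem_self : t ∈ insert t T ∪ universalTubes G := by
  rw [Finset.insert_union]
  exact Finset.mem_insert_self _ _

theorem isTube (h : IsExtension G T t s) : IsTube G t :=
  h.isTubing.tube t (Finset.mem_insert_self _ _)

/-- A tube below the parent that touches the new tube lies in the new tube. -/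
theorem ssubset_of_touch (h : IsExtension G T t s) {t' : Finset V} (ht' : t' ∈ T) (hts : t' ⊂ s)
    {a b : V} (ha : a ∈ t') (hb : b ∈ t) (hab : a = b ∨ G.Adj a b) : t' ⊂ t := by
  rcases h.isTubing.nested (mem_insert (Finset.mem_union_left _ ht')) mem_self ha hb hab with
    h' | h' | h'
  · exact h'
  · exact absurd (h' ▸ ht') h.notMem
  · exact absurd (h.isParent.subset t' (Finset.mem_union_left _ ht') h') (not_subset_of_ssubset hts)

theorem coreSet_parent (h : IsExtension G T t s) :
    coreSet (insert t T) s = coreSet T s \ t := by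
  ext v
  simp only [coreSet, Finset.mem_insert, Set.mem_sdiff, Set.mem_ofPred_eq, Finset.mem_coe]
  constructor
  · rintro ⟨hvs, hv⟩
    exact ⟨⟨hvs, fun t' ht' => hv t' (Or.inr ht')⟩, hv t (Or.inl rfl) h.isParent.ssubset⟩
  · rintro ⟨⟨hvs, hv⟩, hvt⟩
    refine ⟨hvs, ?_⟩
    rintro t' (rfl | ht') hts
    · exact hvt
    · exact hv t' ht' hts

theorem coreSet_self (h : IsExtension G T t s) :
    coreSet (insert t T) t = coreSet T s ∩ t := by
  ext v
  simp only [coreSet, Finset.mem_insert, Set.mem_inter_iff, Set.mem_ofPred_eq, Finset.mem_coe]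
  constructor
  · rintro ⟨hvt, hv⟩
    refine ⟨⟨h.isParent.ssubset.1 hvt, fun t' ht' hts hvt' => ?_⟩, hvt⟩
    exact hv t' (Or.inr ht') (h.ssubset_of_touch ht' hts hvt' hvt (Or.inl rfl)) hvt'
  · rintro ⟨⟨hvs, hv⟩, hvt⟩
    refine ⟨hvt, ?_⟩
    rintro t' (rfl | ht') hts
    · exact absurd hts (ssubset_irrefl _)
    · exact hv t' ht' (hts.trans h.isParent.ssubset)

/-- A tube `w ≠ s` that properly contains `t` also contains `s` properly, and `s` already hides the
nodes of `t` from the core of `w`. -/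
theorem coreSet_of_ne (h : IsExtension G T t s) (hw : w ∈ T ∪ universalTubes G) (hws : w ≠ s) :
    coreSet (insert t T) w = coreSet T w := by
  ext v
  simp only [coreSet, Finset.mem_insert, Set.mem_ofPred_eq]
  constructor
  · rintro ⟨hvs, hv⟩
    exact ⟨hvs, fun t' ht' => hv t' (Or.inr ht')⟩
  · rintro ⟨hvs, hv⟩
    refine ⟨hvs, ?_⟩
    rintro t' (rfl | ht') hts
    · have hsw := (h.isParent.subset w hw hts).ssubset_of_ne (Ne.symm hws)
      have hsT := mem_of_ssubset_of_isTube h.isParent.mem hsw (h.tubing.isTube hw)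
      exact fun hvt => hv s hsT hsw (h.isParent.ssubset.1 hvt)
    · exact hv t' ht' hts

theorem coreAdj_self (h : IsExtension G T t s) {a b : V} (ha : a ∈ t) :
    CoreAdj G (insert t T) t a b ↔ CoreAdj G T s a b := by
  refine or_congr_right ⟨?_, ?_⟩
  · rintro ⟨t', ht', hts, hab⟩
    rcases Finset.mem_insert.1 ht' with rfl | ht'
    · exact absurd hts (ssubset_irrefl _)
    · exact ⟨t', ht', hts.trans h.isParent.ssubset, hab⟩
  · rintro ⟨t', ht', hts, ⟨c, hc, hac⟩, hb⟩
    exact ⟨t', Finset.mem_insert_of_mem ht',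
      h.ssubset_of_touch ht' hts hc ha (Or.inr hac.symm), ⟨c, hc, hac⟩, hb⟩

omit [Finite V] in
theorem coreAdj_insert (hts : t ⊂ s) {a b : V} :
    CoreAdj G (insert t T) s a b ↔
      CoreAdj G T s a b ∨ (∃ c ∈ t, G.Adj a c) ∧ (∃ d ∈ t, G.Adj b d) := by
  constructor
  · rintro (h | ⟨t', ht', hts, hab⟩)
    · exact Or.inl (Or.inl h)
    · rcases Finset.mem_insert.1 ht' with rfl | ht'
      · exact Or.inr hab
      · exact Or.inl (Or.inr ⟨t', ht', hts, hab⟩)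
  · rintro ((h | ⟨t', ht', hts, hab⟩) | h)
    · exact Or.inl h
    · exact Or.inr ⟨t', Finset.mem_insert_of_mem ht', hts, hab⟩
    · exact Or.inr ⟨t, Finset.mem_insert_self _ _, hts, h⟩

/-- If `t ⊂ w`, then also `s ⊂ w` with `s ∈ T`, so two nodes that are linked through `t` are already
linked through `s`. -/
theorem coreAdj_of_ne (h : IsExtension G T t s) (hw : w ∈ T ∪ universalTubes G) (hws : w ≠ s)
    {a b : V} : CoreAdj G (insert t T) w a b ↔ CoreAdj G T w a b := by
  by_cases htw : t ⊂ w
  · rw [coreAdj_insert htw, or_iff_left_of_imp]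
    rintro ⟨⟨c, hc, hac⟩, d, hd, hbd⟩
    have hsw := (h.isParent.subset w hw htw).ssubset_of_ne (Ne.symm hws)
    have hsT := mem_of_ssubset_of_isTube h.isParent.mem hsw (h.tubing.isTube hw)
    exact Or.inr ⟨s, hsT, hsw, ⟨c, h.isParent.ssubset.1 hc, hac⟩, d, h.isParent.ssubset.1 hd, hbd⟩
  · refine or_congr_right ⟨?_, ?_⟩
    · rintro ⟨t', ht', hts, hab⟩
      rcases Finset.mem_insert.1 ht' with rfl | ht'
      · exact absurd hts htw
      · exact ⟨t', ht', hts, hab⟩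
    · rintro ⟨t', ht', hts, hab⟩
      exact ⟨t', Finset.mem_insert_of_mem ht', hts, hab⟩

theorem conn_of_ne (h : IsExtension G T t s) (hw : w ∈ T ∪ universalTubes G) (hws : w ≠ s) :
    conn G (insert t T) w = conn G T w :=
  conn_congr (h.coreSet_of_ne hw hws) fun _ _ _ _ _ => h.coreAdj_of_ne hw hws

theorem ncard_coreSet (h : IsExtension G T t s) :
    (coreSet (insert t T) s).ncard + (coreSet (insert t T) t).ncard = (coreSet T s).ncard := by
  rw [h.coreSet_parent, h.coreSet_self, add_comm,
    Set.ncard_inter_add_ncard_sdiff_eq_ncard _ _ (Set.toFinite _)]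

/-- Adding `t` takes its nodes out of the core of `s` and makes the remaining neighbors of `t`
pairwise adjacent. A cut of the new core therefore has all these neighbors on one side, apart from
those in the cutset. If the core nodes in `t` are put on that side, the same set cuts the old core.
The second alternative occurs when the connectivity is attained only by leaving at most one node. -/
theorem conn_parent_le (h : IsExtension G T t s) : conn G T s ≤ conn G (insert t T) s ∨
    (coreSet (insert t T) s).ncard ≤ conn G (insert t T) s + 1 := by
  obtain ⟨S, hS, hSc, hcut | hcut⟩ := exists_ncard_eq_conn G (insert t T) s
  · left
    have hS' : S ⊆ coreSet T s := by
      rw [h.coreSet_parent] at hS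
      exact hS.trans Set.sdiff_subset
    rw [← hSc]
    refine conn_le hS' (Or.inl ?_)
    obtain ⟨A, B, hA, hB, hAB, hR⟩ := hcut
    have hadj : ∀ x y, x ∈ t → CoreAdj G T s x y → y ∉ t → ∃ d ∈ t, G.Adj y d := by
      rintro x y hx (hxy | ⟨t', ht', hts, ⟨c, hc, hxc⟩, d, hd, hyd⟩) hy
      · exact ⟨x, hx, hxy.symm⟩
      · exact ⟨d, (h.ssubset_of_touch ht' hts hc hx (Or.inr hxc.symm)).1 hd, hyd⟩
    have hnt : ∀ x ∈ A ∪ B, x ∉ t := by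
      intro x hx
      rw [hAB, h.coreSet_parent] at hx
      exact hx.1.2
    have hunion : A ∪ B ∪ (coreSet T s ∩ t) = coreSet T s \ S := by
      rw [hAB, h.coreSet_parent]
      rw [h.coreSet_parent] at hS
      ext x
      constructor
      · rintro (⟨⟨h1, h2⟩, h3⟩ | ⟨h1, h2⟩)
        · exact ⟨h1, h3⟩
        · exact ⟨h1, fun hx => (hS hx).2 h2⟩
      · rintro ⟨h1, h2⟩
        by_cases hx : x ∈ t
        · exact Or.inr ⟨h1, hx⟩
        · exact Or.inl ⟨⟨h1, hx⟩, h2⟩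
    have hR' : ∀ a ∈ A, ∀ b ∈ B, a ≠ b ∧ ¬ CoreAdj G T s a b := fun a ha b hb =>
      ⟨(hR a ha b hb).1, fun hh =>
        (hR a ha b hb).2 ((coreAdj_insert h.isParent.ssubset).2 (Or.inl hh))⟩
    -- Decides which side of the cut receives the core nodes in `t`: the one with neighbors of `t`,
    -- and `B` if `A` has none.
    by_cases hAt : ∃ a ∈ A, ∃ d ∈ t, G.Adj a d
    · obtain ⟨a, ha, had⟩ := hAt
      refine ⟨A ∪ (coreSet T s ∩ t), B, hA.inl, hB, ?_, ?_⟩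
      · rw [← hunion, Set.union_right_comm]
      · rintro x (hx | hx) b hb
        · exact hR' x hx b hb
        · refine ⟨?_, fun hxb => ?_⟩
          · rintro rfl
            exact hnt x (Or.inr hb) hx.2
          · exact (hR a ha b hb).2 ((coreAdj_insert h.isParent.ssubset).2
              (Or.inr ⟨had, hadj x b hx.2 hxb (hnt b (Or.inr hb))⟩))
    · refine ⟨A, B ∪ (coreSet T s ∩ t), hA, hB.inl, ?_, ?_⟩
      · rw [← hunion, Set.union_assoc]
      · rintro a ha x (hx | hx)
        · exact hR' a ha x hx
        · refine ⟨?_, fun hxb => ?_⟩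
          · rintro rfl
            exact hnt a (Or.inl ha) hx.2
          · exact hAt ⟨a, ha, hadj x a hx.2 hxb.symm (hnt a (Or.inl ha))⟩
  · right
    have := Set.ncard_sdiff_add_ncard_of_subset hS (Set.toFinite _)
    omega

/-- Removing the core nodes of `s` outside `t` and then a cutset of the core of `t` leaves the same
nodes, with the same adjacency, as removing the cutset from the core of `t`. -/
theorem conn_le_add (h : IsExtension G T t s) :
    conn G T s ≤ (coreSet (insert t T) s).ncard + conn G (insert t T) t := by
  obtain ⟨S, hS, hSc, hcut⟩ := exists_ncard_eq_conn G (insert t T) t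
  have hX : coreSet T s \ (coreSet (insert t T) s ∪ S) = coreSet (insert t T) t \ S := by
    rw [h.coreSet_parent, h.coreSet_self]
    ext x
    simp only [Set.mem_sdiff, Set.mem_union, Set.mem_inter_iff, Finset.mem_coe]
    tauto
  rw [← hSc]
  refine (conn_le (S := coreSet (insert t T) s ∪ S) ?_ ?_).trans (Set.ncard_union_le _ _)
  · refine Set.union_subset ?_ (hS.trans ?_)
    · rw [h.coreSet_parent]
      exact Set.sdiff_subset
    · rw [h.coreSet_self]
      exact Set.inter_subset_left
  · rw [hX]
    refine hcut.imp_left ?_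
    rintro ⟨A, B, hA, hB, hAB, hR⟩
    refine ⟨A, B, hA, hB, hAB, fun a ha b hb => ⟨(hR a ha b hb).1, fun hh => (hR a ha b hb).2 ?_⟩⟩
    have haX : a ∈ coreSet (insert t T) t \ S := hAB ▸ Or.inl ha
    exact (h.coreAdj_self haX.1.1).2 hh

end IsExtension

end Tubes
end ColorfulGA

namespace ColorfulGA

open scoped Classical

/-! ### Listings -/

namespace Blocks

variable {κ : Type v} {b b' : Blocks κ} {l l' : List κ}

/-- The number of colors whose position in a listing is fixed. -/
def prefixLength (b : Blocks κ) : ℕ := b.color.toList.length + b.outer.length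

theorem length_toList (o : Option κ) : o.toList.length = if o.isSome then 1 else 0 := by
  cases o <;> simp

theorem exists_isListing (b : Blocks κ) : ∃ l, b.IsListing l :=
  ⟨_, b.inner.toList, by simp, rfl⟩

theorem IsListing.coe_eq (h : b.IsListing l) : (l : Multiset κ) = b.colors := by
  obtain ⟨i, hi, rfl⟩ := h
  rw [colors, visible, hidden, ← hi]
  simp

theorem IsListing.length_eq (h : b.IsListing l) :
    l.length = b.prefixLength + b.inner.card := by
  obtain ⟨i, hi, rfl⟩ := h
  rw [← hi, prefixLength]
  simp [add_assoc]

theorem IsListing.take_eq (h : b.IsListing l) :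
    l.take b.prefixLength = b.color.toList ++ b.outer := by
  obtain ⟨i, hi, rfl⟩ := h
  rw [List.take_left' (by simp [prefixLength])]

/-- Only the inner colors, which come last, may be reordered. All comparisons of listings below
reduce to bounds on `prefixLength`. -/
theorem IsListing.iff (h : b.IsListing l) :
    b.IsListing l' ↔ l'.Perm l ∧ l'.take b.prefixLength = l.take b.prefixLength := by
  constructor
  · intro h'
    refine ⟨?_, by rw [h.take_eq, h'.take_eq]⟩
    rw [← Multiset.coe_eq_coe, h.coe_eq, h'.coe_eq]
  · rintro ⟨hp, ht⟩
    rw [h.take_eq] at ht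
    refine ⟨l'.drop b.prefixLength, ?_, by rw [← ht, List.take_append_drop]⟩
    obtain ⟨i, hi, rfl⟩ := h
    rw [← hi, Multiset.coe_eq_coe]
    rw [← List.take_append_drop b.prefixLength l', ht] at hp
    exact (List.perm_append_left_iff _).1 hp

/-- The tubing determines whether there is a color and how many outer blocks there are, so a listing
determines the blocks. Templates can thus be handled as families of lists. -/
theorem IsListing.eq (h : b.IsListing l) (h' : b'.IsListing l)
    (hc : b.color.isSome ↔ b'.color.isSome) (ho : b.outer.length = b'.outer.length) : b = b' := by
  have hlen : b.color.toList.length = b'.color.toList.length := by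
    rw [length_toList, length_toList, if_congr hc rfl rfl]
  have hp : b.prefixLength = b'.prefixLength := by rw [prefixLength, prefixLength, hlen, ho]
  have h1 := h.take_eq
  rw [hp, h'.take_eq] at h1
  obtain ⟨h2, h3⟩ := List.append_inj h1 hlen.symm
  have h4 : b.color = b'.color := by
    rcases hb : b.color with _ | c <;> rcases hb' : b'.color with _ | c' <;> simp_all
  have h5 := h.coe_eq.symm.trans h'.coe_eq
  rw [colors, colors, visible, visible, hidden, hidden, h4, h3, add_right_inj, add_right_inj] at h5
  exact Blocks.ext h4 h3.symm h5

theorem exists_isListing_of_length (c : Prop) [Decidable c] (k : ℕ) (l : List κ)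
    (h : (if c then 1 else 0) + k ≤ l.length) :
    ∃ b : Blocks κ, (b.color.isSome ↔ c) ∧ b.outer.length = k ∧ b.IsListing l := by
  by_cases hc : c
  · rw [if_pos hc] at h
    cases l with
    | nil => simp at h
    | cons a l =>
      refine ⟨⟨some a, l.take k, (l.drop k : List κ)⟩, by simp [hc], ?_, l.drop k, rfl, by simp⟩
      simp only [List.length_cons] at h
      simp
      omega
  · rw [if_neg hc] at h
    refine ⟨⟨none, l.take k, (l.drop k : List κ)⟩, by simp [hc], ?_, l.drop k, rfl, by simp⟩
    simp
    omega

end Blocks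

/-! ### Templates as families of listings -/

namespace Template

variable {V : Type u} [Finite V] {κ : Type v} {G : SimpleGraph V} {pal : Multiset κ}
  {x y z : Template G pal} {s t w : Finset V}

theorem coreSet_nonempty (x : Template G pal) (hw : w ∈ x.tubes ∪ universalTubes G) :
    (coreSet x.tubes w).Nonempty := by
  rw [← Set.ncard_pos, ← x.inner_card w hw]
  omega

theorem length_color (x : Template G pal) (w : Finset V) :
    (x.blocks w).color.toList.length = if w ∈ x.tubes then 1 else 0 := by
  rw [Blocks.length_toList, if_congr (x.color_isSome w) rfl rfl]

/-- A core with a single node has `conn` equal to 0; the truncated difference `0 - 1 = 0` then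
agrees with the convention `k = 1`. -/
theorem prefixLength_eq (x : Template G pal) (hw : w ∈ x.tubes ∪ universalTubes G) :
    (x.blocks w).prefixLength = (if w ∈ x.tubes then 1 else 0) + (conn G x.tubes w - 1) := by
  rw [Blocks.prefixLength, x.length_color, x.outer_length w hw, conn]

/-- A tube of the tubing has as many colors as core nodes; a universal tube outside the tubing has
one color fewer. -/
theorem length_listing (x : Template G pal) (hw : w ∈ x.tubes ∪ universalTubes G) {l : List κ}
    (hl : (x.blocks w).IsListing l) :
    l.length + 1 = (if w ∈ x.tubes then 1 else 0) + (coreSet x.tubes w).ncard := by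
  rw [hl.length_eq, ← x.inner_card w hw, Blocks.prefixLength, x.length_color]
  omega

/-- `L` lists all the blocks of the template `x`. -/
def Lists (x : Template G pal) (L : Finset V → List κ) : Prop :=
  ∀ w ∈ x.tubes ∪ universalTubes G, (x.blocks w).IsListing (L w)

theorem exists_lists (x : Template G pal) : ∃ L, x.Lists L := by
  choose L hL using fun w => (x.blocks w).exists_isListing
  exact ⟨L, fun w _ => hL w⟩

theorem Lists.total {L : Finset V → List κ} (h : x.Lists L) :
    ∑ w ∈ x.tubes ∪ universalTubes G, (L w : Multiset κ) + x.universalBlock = pal := by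
  refine Eq.trans ?_ x.total
  congr 1
  exact Finset.sum_congr rfl fun w hw => (h w hw).coe_eq

theorem blocks_eq_of_listing (hx : w ∈ x.tubes ∪ universalTubes G)
    (hy : w ∈ y.tubes ∪ universalTubes G) (ht : w ∈ x.tubes ↔ w ∈ y.tubes)
    (hc : conn G x.tubes w = conn G y.tubes w) {l : List κ} (hxl : (x.blocks w).IsListing l)
    (hyl : (y.blocks w).IsListing l) : x.blocks w = y.blocks w := by
  refine hxl.eq hyl (by rw [x.color_isSome, y.color_isSome, ht]) ?_
  rw [x.outer_length w hx, y.outer_length w hy]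
  exact congrArg (· - 1) hc

/-- A template is determined by its tubes and by listings of its blocks. -/
theorem eq_of_listing (h : x.tubes = y.tubes)
    (hl : ∀ w ∈ x.tubes ∪ universalTubes G, ∃ l, (x.blocks w).IsListing l ∧
      (y.blocks w).IsListing l) : x = y := by
  have hb : x.blocks = y.blocks := by
    funext w
    by_cases hw : w ∈ x.tubes ∪ universalTubes G
    · obtain ⟨l, hx, hy⟩ := hl w hw
      exact blocks_eq_of_listing hw (h ▸ hw) (by rw [h]) (by rw [h]) hx hy
    · rw [x.blocks_eq w hw, y.blocks_eq w (h ▸ hw)]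
  refine Template.ext h hb ?_
  -- The universal block is what the other blocks leave of the palette.
  have h1 := x.total
  have h2 := y.total
  rw [← h, ← hb] at h2
  exact add_left_cancel (h1.trans h2.symm)

theorem Lists.eq {L : Finset V → List κ} (hx : x.Lists L) (hy : y.Lists L)
    (h : x.tubes = y.tubes) : x = y :=
  eq_of_listing h fun w hw => ⟨L w, hx w hw, hy w (h ▸ hw)⟩

/-- Listings of the right lengths define a template. -/
theorem exists_of_lists {T : Finset (Finset V)} (hT : IsTubing G T) (L : Finset V → List κ)
    (hpos : ∀ w ∈ T ∪ universalTubes G, (coreSet T w).Nonempty)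
    (hlen : ∀ w ∈ T ∪ universalTubes G,
      (L w).length + 1 = (if w ∈ T then 1 else 0) + (coreSet T w).ncard)
    (ub : Multiset κ)
    (hub : ub.card + (T ∩ universalTubes G).card + 1 = Nat.card G.ConnectedComponent)
    (htot : ∑ w ∈ T ∪ universalTubes G, (L w : Multiset κ) + ub = pal) :
    ∃ x : Template G pal, x.tubes = T ∧ x.universalBlock = ub ∧ x.Lists L := by
  have hex : ∀ w, ∃ b : Blocks κ, (b.color.isSome ↔ w ∈ T) ∧
      (w ∈ T ∪ universalTubes G → b.outer.length = conn G T w - 1 ∧ b.IsListing (L w)) ∧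
      (w ∉ T ∪ universalTubes G → b = ⟨none, [], 0⟩) := by
    intro w
    by_cases hw : w ∈ T ∪ universalTubes G
    · obtain ⟨b, hb1, hb2, hb3⟩ := Blocks.exists_isListing_of_length (w ∈ T) (conn G T w - 1) (L w)
        (by have := conn_lt_ncard (G := G) (hpos w hw); have := hlen w hw; omega)
      exact ⟨b, hb1, fun _ => ⟨hb2, hb3⟩, fun h => absurd hw h⟩
    · refine ⟨⟨none, [], 0⟩, ?_, fun h => absurd h hw, fun _ => rfl⟩
      simp only [Finset.mem_union, not_or] at hw
      simp [hw.1]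
  choose b hb1 hb2 hb3 using hex
  refine ⟨⟨T, b, ub, hT, hb1, fun w hw => (hb2 w hw).1, fun w hw => ?_, hb3, hub, ?_⟩, rfl, rfl,
    fun w hw => (hb2 w hw).2⟩
  · have h1 := (hb2 w hw).2.length_eq
    have h2 := hlen w hw
    rw [Blocks.prefixLength, Blocks.length_toList, if_congr (hb1 w) rfl rfl] at h1
    omega
  · rw [← htot]
    congr 1
    exact Finset.sum_congr rfl fun w hw => ((hb2 w hw).2.coe_eq).symm

/-! ### Deleting a tube -/

theorem AddTube.isExtension (h : AddTube x y t) : ∃ s, IsExtension G y.tubes t s := by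
  obtain ⟨h1, h2, h3, s, hs, hts, hmin, -⟩ := h
  exact ⟨s, h3 ▸ x.isTubing, h1, h2, hs, hts, hmin⟩

theorem AddTube.tubes_eq (h : AddTube x y t) : x.tubes = insert t y.tubes := h.2.2.1

/-- This makes deletion well defined: whether the concatenation is a listing of the parent does not
depend on the listings chosen for `s` and `t`. -/
theorem listing_append_congr (hs : IsExtension G y.tubes t s) (hx : x.tubes = insert t y.tubes)
    {l₁ l₁' l₂ l₂' : List κ} (h₁ : (x.blocks s).IsListing l₁) (h₁' : (x.blocks s).IsListing l₁')
    (h₂ : (x.blocks t).IsListing l₂) (h₂' : (x.blocks t).IsListing l₂')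
    (h : (y.blocks s).IsListing (l₁ ++ l₂)) : (y.blocks s).IsListing (l₁' ++ l₂') := by
  have hsx : s ∈ x.tubes ∪ universalTubes G := hx ▸ IsExtension.mem_insert hs.isParent.mem
  have htx : t ∈ x.tubes ∪ universalTubes G := hx ▸ IsExtension.mem_self
  have hst : s ≠ t := hs.ne_of_mem hs.isParent.mem
  have hsT : s ∈ x.tubes ↔ s ∈ y.tubes := by simp [hx, hst]
  have hp₁ := h₁'.iff.1 h₁
  have hp₂ := h₂'.iff.1 h₂
  rw [h.iff]
  refine ⟨(hp₁.1.append hp₂.1).symm, ?_⟩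
  have e1 := x.prefixLength_eq hsx
  have e2 := x.prefixLength_eq htx
  have e3 := y.prefixLength_eq hs.isParent.mem
  have e4 := x.length_listing hsx h₁
  rw [if_congr hsT rfl rfl] at e1 e4
  rw [if_pos (by simp [hx])] at e2
  rw [hx] at e1 e2 e4
  have hlen := hp₁.1.length_eq
  rcases hs.conn_parent_le with hle | hle
  -- The connectivity does not decrease when `t` is added, so the fixed positions of `s` in `y` are
  -- already fixed in `x`.
  · have hpp : (y.blocks s).prefixLength ≤ (x.blocks s).prefixLength := by omega
    have hpl : (y.blocks s).prefixLength ≤ l₁.length := by rw [h₁.length_eq]; omega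
    rw [List.take_append_of_le_length hpl, List.take_append_of_le_length (hlen ▸ hpl),
      ← min_eq_left hpp, ← List.take_take, ← List.take_take, hp₁.2]
  -- Now the new core of `s` is complete. Its inner block has at most one color, so its listing is
  -- unique, and by `conn_le_add` the fixed positions of `y` beyond it are fixed positions of `t`.
  · have hll : l₁ = l₁' := by
      have h3 := hp₁.1
      rw [← List.take_append_drop (x.blocks s).prefixLength l₁,
        ← List.take_append_drop (x.blocks s).prefixLength l₁', hp₁.2,
        List.perm_append_left_iff] at h3
      have h4 : (l₁.drop (x.blocks s).prefixLength).length ≤ 1 := by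
        rw [List.length_drop]
        omega
      have h5 : l₁.drop (x.blocks s).prefixLength = l₁'.drop (x.blocks s).prefixLength := by
        rcases hd : l₁.drop (x.blocks s).prefixLength with _ | ⟨a, _ | ⟨a', r⟩⟩
        · rw [hd] at h3
          exact h3.nil_eq
        · rw [hd] at h3
          exact (List.perm_singleton.1 h3.symm).symm
        · rw [hd] at h4
          simp at h4
      rw [← List.take_append_drop (x.blocks s).prefixLength l₁, hp₁.2, h5, List.take_append_drop]
    subst hll
    have hk := hs.conn_le_add
    have hle2 : (y.blocks s).prefixLength - l₁.length ≤ (x.blocks t).prefixLength := by omega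
    rw [List.take_append, List.take_append, ← min_eq_left hle2, ← List.take_take,
      ← List.take_take, hp₂.2]

theorem AddTube.lists (h : AddTube x y t) (hs : IsExtension G y.tubes t s) {L : Finset V → List κ}
    (hL : x.Lists L) : y.Lists fun w => if w = s then L s ++ L t else L w := by
  obtain ⟨-, -, hx, s', hs', hts, hmin, hb, -, l₁, l₂, h₁, h₂, h₁₂⟩ := h
  obtain rfl : s = s' := hs.isParent.eq ⟨hs', hts, hmin⟩
  intro w hw
  by_cases hws : w = s
  · subst hws
    beta_reduce
    rw [if_pos rfl]
    exact listing_append_congr hs hx h₁ (hL _ (hx ▸ IsExtension.mem_insert hw)) h₂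
      (hL _ (hx ▸ IsExtension.mem_self)) h₁₂
  · beta_reduce
    rw [if_neg hws, ← hb w (hs.ne_of_mem hw) hws]
    exact hL w (hx ▸ IsExtension.mem_insert hw)

theorem AddTube.blocks_of_ne (h : AddTube x y t) (hs : IsExtension G y.tubes t s) (hwt : w ≠ t)
    (hws : w ≠ s) : x.blocks w = y.blocks w := by
  obtain ⟨-, -, hx, s', hs', hts, hmin, hb, -⟩ := h
  obtain rfl : s = s' := hs.isParent.eq ⟨hs', hts, hmin⟩
  exact hb w hwt hws

theorem AddTube.listing (h : AddTube x y t) (hs : IsExtension G y.tubes t s) {l₁ l₂ : List κ}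
    (h₁ : (x.blocks s).IsListing l₁) (h₂ : (x.blocks t).IsListing l₂) :
    (y.blocks s).IsListing (l₁ ++ l₂) := by
  obtain ⟨-, -, hx, s', hs', hts, hmin, -, -, l₁', l₂', h₁', h₂', h₁₂⟩ := h
  obtain rfl : s = s' := hs.isParent.eq ⟨hs', hts, hmin⟩
  exact listing_append_congr hs hx h₁' h₁ h₂' h₂ h₁₂

omit [Finite V] in
theorem sum_ite_append {W : Finset (Finset V)} (hs : s ∈ W) (L : Finset V → List κ) (l : List κ) :
    ∑ w ∈ W, ((if w = s then L s ++ l else L w : List κ) : Multiset κ) =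
      ∑ w ∈ W, (L w : Multiset κ) + l := by
  have : ∀ w ∈ W, ((if w = s then L s ++ l else L w : List κ) : Multiset κ) =
      (L w : Multiset κ) + if w = s then (l : Multiset κ) else 0 := by
    intro w _
    by_cases h : w = s
    · subst h
      simp
    · simp [h]
  rw [Finset.sum_congr rfl this, Finset.sum_add_distrib, Finset.sum_ite_eq' W s, if_pos hs]

/-- If listings of `y` arise from listings of `x` by merging those of `t` and its parent, then `x`
arises from `y` by adding `t`. -/
theorem addTube_of_lists (hs : IsExtension G y.tubes t s) (hx : x.tubes = insert t y.tubes)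
    {L : Finset V → List κ} (hL : x.Lists L)
    (hL' : y.Lists fun w => if w = s then L s ++ L t else L w) : AddTube x y t := by
  have hb : ∀ w, w ≠ t → w ≠ s → x.blocks w = y.blocks w := by
    intro w hwt hws
    by_cases hw : w ∈ y.tubes ∪ universalTubes G
    · have hwx : w ∈ x.tubes ∪ universalTubes G := hx ▸ IsExtension.mem_insert hw
      refine blocks_eq_of_listing hwx hw (by simp [hx, hwt]) (by rw [hx, hs.conn_of_ne hw hws])
        (hL w hwx) ?_
      have := hL' w hw
      beta_reduce at this
      rwa [if_neg hws] at this
    · have hwx : w ∉ x.tubes ∪ universalTubes G := by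
        rw [hx, Finset.insert_union, Finset.mem_insert]
        exact not_or.2 ⟨hwt, hw⟩
      rw [x.blocks_eq w hwx, y.blocks_eq w hw]
  refine ⟨hs.notMem, hs.not_universal, hx, s, hs.isParent.mem, hs.isParent.ssubset,
    hs.isParent.subset, hb, ?_, L s, L t, hL s (hx ▸ IsExtension.mem_insert hs.isParent.mem),
    hL t (hx ▸ IsExtension.mem_self), ?_⟩
  · have h1 := hL.total
    have h2 := hL'.total
    rw [sum_ite_append hs.isParent.mem] at h2
    rw [hx, Finset.insert_union, Finset.sum_insert hs.notMem_union] at h1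
    rw [add_comm (L t : Multiset κ)] at h1
    exact add_left_cancel (h1.trans h2.symm)
  · have := hL' s hs.isParent.mem
    beta_reduce at this
    rwa [if_pos rfl] at this

/-- The listing of `t` is appended to that of its parent. The lengths fit because the core of the
parent becomes the disjoint union of the two cores. -/
theorem exists_delete_of_not_universal (x : Template G pal) (ht : t ∈ x.tubes)
    (htU : ¬ IsUniversalTube G t) : ∃ y, AddTube x y t := by
  have hins : insert t (x.tubes.erase t) = x.tubes := Finset.insert_erase ht
  have hT : IsTubing G (x.tubes.erase t) := x.isTubing.mono (Finset.erase_subset _ _)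
  obtain ⟨s, hs⟩ := exists_isParent hT (x.isTubing.tube t ht) htU
  have hs : IsExtension G (x.tubes.erase t) t s :=
    ⟨hins.symm ▸ x.isTubing, Finset.notMem_erase _ _, htU, hs⟩
  obtain ⟨L, hL⟩ := x.exists_lists
  have hmem : ∀ w ∈ x.tubes.erase t ∪ universalTubes G, w ∈ x.tubes ∪ universalTubes G :=
    fun w hw => hins ▸ IsExtension.mem_insert hw
  have htx : t ∈ x.tubes ∪ universalTubes G := Finset.mem_union_left _ ht
  have hcore : ∀ w ∈ x.tubes.erase t ∪ universalTubes G, w ≠ s →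
      coreSet (x.tubes.erase t) w = coreSet x.tubes w := by
    intro w hw hws
    rw [← hs.coreSet_of_ne hw hws, hins]
  have hsum : (coreSet x.tubes s).ncard + (coreSet x.tubes t).ncard =
      (coreSet (x.tubes.erase t) s).ncard := by
    have := hs.ncard_coreSet
    rwa [hins] at this
  have hite : ∀ w ∈ x.tubes.erase t ∪ universalTubes G,
      (w ∈ x.tubes.erase t ↔ w ∈ x.tubes) := by
    intro w hw
    rw [Finset.mem_erase, and_iff_right (hs.ne_of_mem hw)]
  have hex : ∃ y : Template G pal, y.tubes = x.tubes.erase t ∧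
      y.universalBlock = x.universalBlock ∧
      y.Lists fun w => if w = s then L s ++ L t else L w := by
    refine exists_of_lists hT _ ?_ ?_ _ ?_ ?_
    · intro w hw
      by_cases hws : w = s
      · subst hws
        have := x.coreSet_nonempty htx
        rw [← Set.ncard_pos] at this ⊢
        omega
      · rw [hcore w hw hws]
        exact x.coreSet_nonempty (hmem w hw)
    · intro w hw
      rw [if_congr (hite w hw) rfl rfl]
      have h1 := x.length_listing (hmem w hw) (hL w (hmem w hw))
      by_cases hws : w = s
      · subst hws
        have h2 := x.length_listing htx (hL t htx)
        rw [if_pos ht] at h2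
        rw [if_pos rfl, List.length_append]
        omega
      · rw [if_neg hws, hcore w hw hws]
        exact h1
    · rw [← x.universalBlock_card, Finset.erase_inter, Finset.erase_eq_of_notMem (by simp [htU])]
    · have h1 := hL.total
      rw [← hins, Finset.insert_union, Finset.sum_insert hs.notMem_union] at h1
      rw [sum_ite_append hs.isParent.mem, add_comm _ (L t : Multiset κ)]
      exact h1
  obtain ⟨y, hy, -, hyL⟩ := hex
  exact ⟨y, addTube_of_lists (hy ▸ hs) (by rw [hy, hins]) hL hyL⟩

/-! ### Universal tubes -/

omit [Finite V] in
theorem coreSet_insert_universal {T : Finset (Finset V)} (ht : IsUniversalTube G t)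
    (hw : IsTube G w) : coreSet (insert t T) w = coreSet T w := by
  ext v
  simp only [coreSet, Finset.mem_insert, Set.mem_ofPred_eq]
  refine and_congr_right fun _ => ⟨fun h t' ht' => h t' (Or.inr ht'), ?_⟩
  rintro h t' (rfl | ht') hts
  · exact absurd hts (ht.not_ssubset hw)
  · exact h t' ht' hts

theorem conn_insert_universal {T : Finset (Finset V)} (ht : IsUniversalTube G t)
    (hw : IsTube G w) : conn G (insert t T) w = conn G T w := by
  refine conn_congr (coreSet_insert_universal ht hw) fun a _ b _ _ => or_congr_right ⟨?_, ?_⟩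
  · rintro ⟨t', ht', hts, hab⟩
    rcases Finset.mem_insert.1 ht' with rfl | ht'
    · exact absurd hts (ht.not_ssubset hw)
    · exact ⟨t', ht', hts, hab⟩
  · rintro ⟨t', ht', hts, hab⟩
    exact ⟨t', Finset.mem_insert_of_mem ht', hts, hab⟩

theorem insert_union_universalTubes {T : Finset (Finset V)} (ht : IsUniversalTube G t) :
    insert t T ∪ universalTubes G = T ∪ universalTubes G := by
  rw [Finset.insert_union, Finset.insert_eq_of_mem]
  exact Finset.mem_union_right _ (mem_universalTubes.2 ht)

theorem AddUniversalTube.tubes_eq (h : AddUniversalTube x y t) : x.tubes = insert t y.tubes :=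
  h.2.2.1

theorem AddUniversalTube.union_eq (h : AddUniversalTube x y t) :
    x.tubes ∪ universalTubes G = y.tubes ∪ universalTubes G := by
  rw [h.tubes_eq, insert_union_universalTubes h.2.1]

theorem AddUniversalTube.color_eq_none (h : AddUniversalTube x y t) : (y.blocks t).color = none := by
  have := (y.color_isSome t).not.2 h.1
  simpa using this

theorem AddUniversalTube.listing (h : AddUniversalTube x y t) {l : List κ}
    (hl : (x.blocks w).IsListing l) : (y.blocks w).IsListing (if w = t then l.tail else l) := by
  have hnone := h.color_eq_none
  obtain ⟨-, -, -, hb, c, -, hc, ho, hi⟩ := h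
  by_cases hwt : w = t
  · subst hwt
    rw [if_pos rfl]
    obtain ⟨i, hi', hl⟩ := hl
    refine ⟨i, by rw [hi', hi], ?_⟩
    rw [hl, hc, hnone, ho]
    simp
  · rwa [if_neg hwt, ← hb w hwt]

theorem AddUniversalTube.listing_cons (h : AddUniversalTube x y t) {l : List κ} {c : κ}
    (hc : (x.blocks t).color = some c) (hl : (y.blocks t).IsListing l) :
    (x.blocks t).IsListing (c :: l) := by
  have hnone := h.color_eq_none
  obtain ⟨-, -, -, hb, -, -, -, ho, hi⟩ := h
  obtain ⟨i, hi', hl⟩ := hl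
  refine ⟨i, by rw [hi', hi], ?_⟩
  rw [hl, hc, hnone, ho]
  simp

theorem AddUniversalTube.lists (h : AddUniversalTube x y t) {L : Finset V → List κ}
    (hL : x.Lists L) : y.Lists fun w => if w = t then (L t).tail else L w := by
  intro w hw
  have := h.listing (hL w (h.union_eq ▸ hw))
  by_cases hwt : w = t
  · subst hwt
    simpa using this
  · simpa [hwt] using this

/-- No tube properly contains a universal one, so all cores stay as they are, and only the color of
`t` returns to the universal block. -/
theorem exists_delete_of_universal (x : Template G pal) (ht : t ∈ x.tubes)
    (htU : IsUniversalTube G t) : ∃ y, AddUniversalTube x y t := by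
  have hins : insert t (x.tubes.erase t) = x.tubes := Finset.insert_erase ht
  have hT : IsTubing G (x.tubes.erase t) := x.isTubing.mono (Finset.erase_subset _ _)
  have hW : x.tubes ∪ universalTubes G = x.tubes.erase t ∪ universalTubes G := by
    rw [← insert_union_universalTubes (T := x.tubes.erase t) htU, hins]
  obtain ⟨c, hc⟩ := Option.isSome_iff_exists.1 ((x.color_isSome t).2 ht)
  have hcore : ∀ w ∈ x.tubes.erase t ∪ universalTubes G,
      coreSet (x.tubes.erase t) w = coreSet x.tubes w := by
    intro w hw
    rw [← coreSet_insert_universal htU (hT.isTube hw), hins]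
  have hconn : ∀ w ∈ x.tubes.erase t ∪ universalTubes G,
      conn G (x.tubes.erase t) w = conn G x.tubes w := by
    intro w hw
    rw [← conn_insert_universal htU (hT.isTube hw), hins]
  have hcard : (x.tubes.erase t ∩ universalTubes G).card + 1 =
      (x.tubes ∩ universalTubes G).card := by
    rw [Finset.erase_inter, Finset.card_erase_add_one]
    simp [ht, htU]
  refine ⟨⟨x.tubes.erase t, fun w => if w = t then ⟨none, (x.blocks t).outer, (x.blocks t).inner⟩
    else x.blocks w, c ::ₘ x.universalBlock, hT, ?_, ?_, ?_, ?_, ?_, ?_⟩, ?_⟩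
  · intro w
    by_cases hwt : w = t
    · simp [hwt]
    · simp [hwt, x.color_isSome]
  · intro w hw
    have := x.outer_length w (hW ▸ hw)
    have h2 := hconn w hw
    rw [conn, conn] at h2
    rw [h2, ← this]
    by_cases hwt : w = t
    · simp [hwt]
    · simp [hwt]
  · intro w hw
    rw [hcore w hw, ← x.inner_card w (hW ▸ hw)]
    by_cases hwt : w = t
    · simp [hwt]
    · simp [hwt]
  · intro w hw
    have hwt : w ≠ t := by
      rintro rfl
      exact hw (Finset.mem_union_right _ (mem_universalTubes.2 htU))
    rw [if_neg hwt]
    exact x.blocks_eq w (hW ▸ hw)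
  · rw [← x.universalBlock_card, ← hcard, Multiset.card_cons]
    omega
  · have h1 := x.total
    have htm : t ∈ x.tubes.erase t ∪ universalTubes G :=
      Finset.mem_union_right _ (mem_universalTubes.2 htU)
    rw [hW, ← Finset.add_sum_erase _ _ htm] at h1
    rw [← Finset.add_sum_erase _ _ htm, if_pos rfl]
    refine Eq.trans ?_ h1
    have : ∀ w ∈ (x.tubes.erase t ∪ universalTubes G).erase t,
        (if w = t then (⟨none, (x.blocks t).outer, (x.blocks t).inner⟩ : Blocks κ)
          else x.blocks w).colors = (x.blocks w).colors := by
      intro w hw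
      rw [if_neg (Finset.ne_of_mem_erase hw)]
    rw [Finset.sum_congr rfl this]
    simp only [Blocks.colors, Blocks.visible, Blocks.hidden, hc]
    simp only [Option.toList_none, Option.toList_some, Multiset.coe_nil, zero_add,
      Multiset.coe_singleton, ← Multiset.singleton_add]
    abel
  · refine ⟨Finset.notMem_erase _ _, htU, hins.symm, ?_, c, rfl, hc, ?_, ?_⟩
    · intro w hw
      simp [hw]
    · simp
    · simp

/-! ### Deletions generate the order -/

/-- `x` arises from `y` by adding the tube `t`. -/
def AddAt (x : Template G pal) (t : Finset V) (y : Template G pal) : Prop :=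
  AddTube x y t ∨ AddUniversalTube x y t

theorem AddAt.notMem (h : AddAt x t y) : t ∉ y.tubes := h.elim (fun h => h.1) fun h => h.1

theorem AddAt.tubes_eq (h : AddAt x t y) : x.tubes = insert t y.tubes :=
  h.elim (fun h => h.tubes_eq) fun h => h.tubes_eq

theorem exists_addAt (ht : t ∈ x.tubes) : ∃ y, AddAt x t y := by
  by_cases h : IsUniversalTube G t
  · obtain ⟨y, hy⟩ := x.exists_delete_of_universal ht h
    exact ⟨y, Or.inr hy⟩
  · obtain ⟨y, hy⟩ := x.exists_delete_of_not_universal ht h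
    exact ⟨y, Or.inl hy⟩

/-- Listings of `x` yield listings of the result that depend only on `x` and `t`. -/
theorem AddAt.unique {y' : Template G pal} (h : AddAt x t y) (h' : AddAt x t y') : y = y' := by
  have htub : y.tubes = y'.tubes := by
    rw [← Finset.erase_insert h.notMem, ← Finset.erase_insert h'.notMem, ← h.tubes_eq,
      ← h'.tubes_eq]
  obtain ⟨L, hL⟩ := x.exists_lists
  rcases h with h | h <;> rcases h' with h' | h'
  · obtain ⟨s, hs⟩ := h.isExtension
    exact (h.lists hs hL).eq (h'.lists (htub ▸ hs) hL) htub
  · exact absurd h'.2.1 h.2.1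
  · exact absurd h.2.1 h'.2.1
  · exact (h.lists hL).eq (h'.lists hL) htub

theorem le_of_addAt (h : AddAt x t y) : x ≤ y := Relation.ReflTransGen.single ⟨t, h⟩

end Template
end ColorfulGA

namespace ColorfulGA

open scoped Classical

/-! ### Commutation of deletions -/

section Tubes

variable {V : Type u} [Finite V] {G : SimpleGraph V} {T : Finset (Finset V)} {s t p w : Finset V}

/-- The parent of `t` after another tube has been added. -/
theorem IsParent.eq_or_of_insert {t' : Finset V} (hs : IsParent G (insert t' T) t s)
    (hp : IsParent G T t p) : s = p ∨ s = t' := by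
  have hm := hs.mem
  rw [Finset.insert_union, Finset.mem_insert] at hm
  rcases hm with h | h
  · exact Or.inr h
  · exact Or.inl (subset_antisymm (hs.subset _ (IsExtension.mem_insert hp.mem) hp.ssubset)
      (hp.subset _ h hs.ssubset))

/-- The nested case: when `t'` is deleted, a tube directly inside it passes to the parent of `t'`.
-/
theorem IsParent.eq_of_insert_eq {t' q : Finset V} (hs : IsParent G (insert t' T) t t')
    (hp : IsParent G T t p) (hq : IsExtension G T t' q) : p = q := by
  refine subset_antisymm (hp.subset q hq.isParent.mem (hs.ssubset.trans hq.isParent.ssubset))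
    (hq.isParent.subset p hp.mem ?_)
  refine (hs.subset p (IsExtension.mem_insert hp.mem) hp.ssubset).ssubset_of_ne ?_
  rintro rfl
  exact hq.notMem_union hp.mem

/-- If two tubes have the same parent, then the core that remains is a cutset. -/
theorem conn_le_of_siblings {t' q : Finset V} (h : IsExtension G T t q) (h' : IsExtension G T t' q)
    (ht : IsExtension G (insert t' T) t q) (ht' : IsExtension G (insert t T) t' q)
    (hne : (coreSet (insert t T) t).Nonempty) (hne' : (coreSet (insert t' T) t').Nonempty) :
    conn G T q ≤ (coreSet (insert t (insert t' T)) q).ncard := by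
  have hX : coreSet (insert t (insert t' T)) q = (coreSet T q \ t') \ t := by
    rw [ht.coreSet_parent, h'.coreSet_parent]
  have htt : t ≠ t' := by
    rintro rfl
    exact ht.notMem (Finset.mem_insert_self _ _)
  have hsep : ∀ a ∈ t, ∀ b ∈ t', ¬ (a = b ∨ G.Adj a b) := by
    intro a ha b hb hab
    rcases ht.isTubing.nested IsExtension.mem_self
      (IsExtension.mem_insert IsExtension.mem_self) ha hb hab with hh | hh | hh
    · exact not_subset_of_ssubset h'.isParent.ssubset
        (ht.isParent.subset t' IsExtension.mem_self hh)
    · exact htt hh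
    · exact not_subset_of_ssubset h.isParent.ssubset
        (ht'.isParent.subset t IsExtension.mem_self hh)
  rw [hX]
  refine conn_le (Set.sdiff_subset.trans Set.sdiff_subset) (Or.inl ?_)
  rw [h.coreSet_self] at hne
  rw [h'.coreSet_self] at hne'
  refine ⟨_, _, hne, hne', ?_, ?_⟩
  · ext x
    simp only [Set.mem_union, Set.mem_inter_iff, Set.mem_sdiff, Finset.mem_coe]
    tauto
  · rintro a ⟨-, ha⟩ b ⟨-, hb⟩
    refine ⟨fun hab => hsep a ha b hb (Or.inl hab), ?_⟩
    rintro (hab | ⟨t'', ht'', hts, ⟨c, hc, hac⟩, d, hd, hbd⟩)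
    · exact hsep a ha b hb (Or.inr hab)
    · exact hsep d ((h.ssubset_of_touch ht'' hts hc ha (Or.inr hac.symm)).1 hd) b hb
        (Or.inr hbd.symm)

end Tubes

namespace Template

variable {V : Type u} [Finite V] {κ : Type v} {G : SimpleGraph V} {pal : Multiset κ}
  {x y y' z z' : Template G pal} {s t t' w : Finset V}

theorem tubes_eq_of_addAt_addAt (h₁ : AddAt x t y) (h₂ : AddAt y t' z)
    (h₃ : AddAt x t' y') (h₄ : AddAt y' t z') : z.tubes = z'.tubes := by
  have e1 : z.tubes = (x.tubes.erase t).erase t' := by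
    rw [h₁.tubes_eq, Finset.erase_insert h₁.notMem, h₂.tubes_eq, Finset.erase_insert h₂.notMem]
  have e2 : z'.tubes = (x.tubes.erase t').erase t := by
    rw [h₃.tubes_eq, Finset.erase_insert h₃.notMem, h₄.tubes_eq, Finset.erase_insert h₄.notMem]
  rw [e1, e2, Finset.erase_right_comm]

/-- There are three configurations. If the parents differ and the tubes are not nested, the two
merges are independent. If one tube lies directly in the other, concatenation is associative. If the
tubes have a common parent, their lists are appended in opposite orders, but `conn_le_of_siblings`
shows that both come after the fixed positions. -/
theorem addTube_comm (htt : t ≠ t') (h₁ : AddTube x y t) (h₂ : AddTube y z t')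
    (h₃ : AddTube x y' t') (h₄ : AddTube y' z' t) : z = z' := by
  have htub := tubes_eq_of_addAt_addAt (Or.inl h₁) (Or.inl h₂) (Or.inl h₃) (Or.inl h₄)
  obtain ⟨s, hs⟩ := h₁.isExtension
  obtain ⟨p', hp'⟩ := h₂.isExtension
  obtain ⟨s', hs'⟩ := h₃.isExtension
  obtain ⟨p, hp⟩ := h₄.isExtension
  obtain ⟨L, hL⟩ := x.exists_lists
  have hz := h₂.lists hp' (h₁.lists hs hL)
  have hz' := h₄.lists hp (h₃.lists hs' hL)
  have hsy := h₂.tubes_eq ▸ hs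
  have hsy' := h₄.tubes_eq ▸ hs'
  rw [← htub] at hp hsy'
  have hpt' : p ≠ t' := hp'.ne_of_mem hp.isParent.mem
  have hpt : p' ≠ t := hp.ne_of_mem hp'.isParent.mem
  refine eq_of_listing htub fun w hw => ?_
  have hzw := hz w hw
  have hzw' := hz' w (htub ▸ hw)
  have hwt : w ≠ t := hp.ne_of_mem hw
  have hwt' : w ≠ t' := hp'.ne_of_mem hw
  beta_reduce at hzw hzw'
  rcases hsy.isParent.eq_or_of_insert hp.isParent with e | e
  · rcases hsy'.isParent.eq_or_of_insert hp'.isParent with e' | e'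
    · subst e e'
      by_cases hss : s = s'
      · subst hss
        by_cases hws : w = s
        · subst hws
          simp only [if_true, if_neg hwt.symm, if_neg hwt'.symm] at hzw hzw'
          refine ⟨_, hzw, (hzw'.iff).2 ⟨?_, ?_⟩⟩
          · rw [List.append_assoc, List.append_assoc]
            exact List.perm_append_comm.append_left _
          -- The nodes left in the core of `w` cut it, so its prefix in `z'` is no longer than `L
          -- w`.
          · have hcn := conn_le_of_siblings hp hp' hsy hsy'
              (by
                have := y'.coreSet_nonempty (w := t)
                  (by rw [h₄.tubes_eq]; exact IsExtension.mem_self)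
                rwa [h₄.tubes_eq, ← htub] at this)
              (by
                have := y.coreSet_nonempty (w := t')
                  (by rw [h₂.tubes_eq]; exact IsExtension.mem_self)
                rwa [h₂.tubes_eq] at this)
            have e1 := z'.prefixLength_eq (htub ▸ hw)
            have hwx : w ∈ x.tubes ∪ universalTubes G := by
              rw [h₁.tubes_eq, h₂.tubes_eq]
              exact IsExtension.mem_insert (IsExtension.mem_insert hw)
            have e2 := x.length_listing hwx (hL w hwx)
            have hiff : w ∈ x.tubes ↔ w ∈ z'.tubes := by
              rw [h₁.tubes_eq, h₂.tubes_eq, ← htub]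
              simp [hwt, hwt']
            rw [if_congr hiff rfl rfl] at e2
            have e3 := x.coreSet_nonempty hwx
            rw [← Set.ncard_pos] at e3
            rw [h₁.tubes_eq, h₂.tubes_eq] at e2 e3
            rw [← htub] at e1 e2
            have hle : (z'.blocks w).prefixLength ≤ (L w).length := by omega
            rw [List.append_assoc, List.append_assoc, List.take_append_of_le_length hle,
              List.take_append_of_le_length hle]
        · simp only [if_neg hws] at hzw hzw'
          exact ⟨_, hzw, hzw'⟩
      · by_cases hws : w = s
        · subst hws
          simp only [if_true, if_neg hss, if_neg hpt.symm] at hzw hzw'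
          exact ⟨_, hzw, hzw'⟩
        · by_cases hws' : w = s'
          · subst hws'
            simp only [if_true, if_neg hws, if_neg hpt'.symm] at hzw hzw'
            exact ⟨_, hzw, hzw'⟩
          · simp only [if_neg hws, if_neg hws'] at hzw hzw'
            exact ⟨_, hzw, hzw'⟩
    · subst e e'
      -- Here `t'` lies directly in `t`, so it inherits the parent of `t`.
      obtain rfl : p' = s := hsy'.isParent.eq_of_insert_eq hp'.isParent hp
      by_cases hws : w = p'
      · subst hws
        simp only [if_true, if_neg hwt, if_neg hwt'.symm] at hzw hzw'
        rw [List.append_assoc] at hzw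
        exact ⟨_, hzw, hzw'⟩
      · simp only [if_neg hws, if_neg hwt] at hzw hzw'
        exact ⟨_, hzw, hzw'⟩
  · rcases hsy'.isParent.eq_or_of_insert hp'.isParent with e' | e'
    · subst e e'
      obtain rfl : p = s' := hsy.isParent.eq_of_insert_eq hp.isParent hp'
      by_cases hws : w = p
      · subst hws
        simp only [if_true, if_neg hwt', if_neg hwt.symm] at hzw hzw'
        rw [List.append_assoc] at hzw'
        exact ⟨_, hzw, hzw'⟩
      · simp only [if_neg hws, if_neg hwt'] at hzw hzw'
        exact ⟨_, hzw, hzw'⟩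
    -- Each of the two tubes would properly contain the other.
    · rw [e] at hsy
      rw [e'] at hsy'
      exact absurd hsy'.isParent.ssubset.1 (not_subset_of_ssubset hsy.isParent.ssubset)

/-- The color of a universal tube is the head of its listing, while the colors of a deleted tube are
appended at the end. -/
theorem addTube_addUniversalTube_comm (htt : t ≠ t') (h₁ : AddTube x y t)
    (h₂ : AddUniversalTube y z t') (h₃ : AddUniversalTube x y' t') (h₄ : AddTube y' z' t) :
    z = z' := by
  have htub := tubes_eq_of_addAt_addAt (Or.inl h₁) (Or.inr h₂) (Or.inr h₃) (Or.inl h₄)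
  obtain ⟨s, hs⟩ := h₁.isExtension
  obtain ⟨p, hp⟩ := h₄.isExtension
  obtain ⟨L, hL⟩ := x.exists_lists
  have hz := h₂.lists (h₁.lists hs hL)
  have hz' := h₄.lists hp (h₃.lists hL)
  obtain rfl : s = p := by
    refine hs.isParent.eq ⟨?_, hp.isParent.ssubset, fun w hw => hp.isParent.subset w ?_⟩
    · have := hp.isParent.mem
      rwa [← htub, ← h₂.union_eq] at this
    · rwa [← htub, ← h₂.union_eq]
  refine eq_of_listing htub fun w hw => ?_
  have hzw := hz w hw
  have hzw' := hz' w (htub ▸ hw)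
  beta_reduce at hzw hzw'
  have hwt : w ≠ t := hp.ne_of_mem (htub ▸ hw)
  by_cases hws : w = s
  · subst hws
    by_cases hwt' : w = t'
    · subst hwt'
      simp only [if_true, if_neg hwt.symm] at hzw hzw'
      -- `L w` contains at least the color of `w`, so its head can be removed before or after
      -- appending `L t`.
      have hlen : L w ≠ [] := by
        have hwx : w ∈ x.tubes ∪ universalTubes G :=
          Finset.mem_union_right _ (mem_universalTubes.2 h₃.2.1)
        have := x.length_listing hwx (hL w hwx)
        have hpos := x.coreSet_nonempty hwx
        rw [← Set.ncard_pos] at hpos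
        rw [if_pos (h₃.tubes_eq ▸ Finset.mem_insert_self _ _)] at this
        intro h0
        rw [h0, List.length_nil] at this
        omega
      rw [List.tail_append_of_ne_nil hlen] at hzw
      exact ⟨_, hzw, hzw'⟩
    · simp only [if_true, if_neg hwt', if_neg htt] at hzw hzw'
      exact ⟨_, hzw, hzw'⟩
  · by_cases hwt' : w = t'
    · subst hwt'
      simp only [if_true, if_neg hws] at hzw hzw'
      exact ⟨_, hzw, hzw'⟩
    · simp only [if_neg hws, if_neg hwt'] at hzw hzw'
      exact ⟨_, hzw, hzw'⟩

theorem addUniversalTube_comm (htt : t ≠ t') (h₁ : AddUniversalTube x y t)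
    (h₂ : AddUniversalTube y z t') (h₃ : AddUniversalTube x y' t')
    (h₄ : AddUniversalTube y' z' t) : z = z' := by
  have htub := tubes_eq_of_addAt_addAt (Or.inr h₁) (Or.inr h₂) (Or.inr h₃) (Or.inr h₄)
  obtain ⟨L, hL⟩ := x.exists_lists
  have hz := h₂.lists (h₁.lists hL)
  have hz' := h₄.lists (h₃.lists hL)
  refine eq_of_listing htub fun w hw => ⟨_, hz w hw, ?_⟩
  have hzw' := hz' w (htub ▸ hw)
  beta_reduce at hzw' ⊢
  by_cases hwt : w = t
  · subst hwt
    simpa [htt, htt.symm] using hzw'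
  · by_cases hwt' : w = t'
    · subst hwt'
      simpa [htt, htt.symm] using hzw'
    · simpa [hwt, hwt'] using hzw'

theorem addAt_comm (htt : t ≠ t') (h₁ : AddAt x t y) (h₂ : AddAt y t' z) (h₃ : AddAt x t' y')
    (h₄ : AddAt y' t z') : z = z' := by
  rcases h₁ with h₁ | h₁ <;> rcases h₂ with h₂ | h₂ <;> rcases h₃ with h₃ | h₃ <;>
    rcases h₄ with h₄ | h₄ <;> try exact absurd h₄.2.1 h₁.2.1
  all_goals try exact absurd h₁.2.1 h₄.2.1
  all_goals try exact absurd h₂.2.1 h₃.2.1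
  all_goals try exact absurd h₃.2.1 h₂.2.1
  · exact addTube_comm htt h₁ h₂ h₃ h₄
  · exact addTube_addUniversalTube_comm htt h₁ h₂ h₃ h₄
  · exact (addTube_addUniversalTube_comm htt.symm h₃ h₄ h₁ h₂).symm
  · exact addUniversalTube_comm htt h₁ h₂ h₃ h₄

theorem isBooleanAbove (G : SimpleGraph V) (pal : Multiset κ) :
    IsBooleanAbove (fun x : Template G pal => x.tubes) :=
  isBooleanAbove_of_deletion _ AddAt (fun _ _ => Iff.rfl) (fun h => ⟨h.notMem, h.tubes_eq⟩)
    exists_addAt AddAt.unique addAt_comm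

end Template
end ColorfulGA

namespace ColorfulGA

open scoped Classical

/-! ### Tubes with a single core node; existence of smaller faces; edges -/

section Tubes

variable {V : Type u} [Finite V] {G : SimpleGraph V} {T : Finset (Finset V)} {s t w : Finset V}
  {a b : V}

omit [Finite V] in
theorem isTubing_insert (hT : IsTubing G T) (ht : IsTube G t)
    (hprop : ∃ s, IsUniversalTube G s ∧ s ∉ insert t T)
    (h : ∀ w ∈ T, ∀ a ∈ w, ∀ b ∈ t, (a = b ∨ G.Adj a b) → w ⊂ t ∨ w = t ∨ t ⊂ w) :
    IsTubing G (insert t T) where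
  tube w hw := by
    rcases Finset.mem_insert.1 hw with rfl | hw
    · exact ht
    · exact hT.tube w hw
  compatible := by
    have key : ∀ w ∈ T, w ≠ t → w ⊂ t ∨ t ⊂ w ∨ ∀ a ∈ w, ∀ b ∈ t, a ≠ b ∧ ¬ G.Adj a b := by
      intro w hw hwt
      by_contra! hcon
      obtain ⟨h1, h2, a, ha, b, hb, hab⟩ := hcon
      rcases h w hw a ha b hb (or_iff_not_imp_left.2 hab) with h3 | h3 | h3
      · exact h1 h3
      · exact hwt h3
      · exact h2 h3
    intro w hw w' hw' hne
    rcases Finset.mem_insert.1 hw with rfl | hwT <;> rcases Finset.mem_insert.1 hw' with rfl | hwT'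
    · exact absurd rfl hne
    · rcases key w' hwT' hne.symm with h | h | h
      · exact Or.inr (Or.inl h)
      · exact Or.inl h
      · exact Or.inr (Or.inr ⟨Finset.disjoint_left.2 fun a ha ha' => (h a ha' a ha).1 rfl,
          fun a ha b hb hab => (h b hb a ha).2 hab.symm⟩)
    · rcases key w hwT hne with h | h | h
      · exact Or.inl h
      · exact Or.inr (Or.inl h)
      · exact Or.inr (Or.inr ⟨Finset.disjoint_left.2 fun a ha ha' => (h a ha a ha').1 rfl,
          fun a ha b hb hab => (h a ha b hb).2 hab⟩)
    · exact hT.compatible w hwT w' hwT' hne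
  proper := hprop

/-- The smallest tube that contains the node `a` of the core of `s`. -/
noncomputable def nodeTube (G : SimpleGraph V) (T : Finset (Finset V)) (s : Finset V) (a : V) :
    Finset V :=
  insert a ((T.filter fun t' => t' ⊂ s ∧ ∃ c ∈ t', G.Adj a c).biUnion id)

omit [Finite V] in
theorem mem_nodeTube {v : V} : v ∈ nodeTube G T s a ↔
    v = a ∨ ∃ t' ∈ T, t' ⊂ s ∧ (∃ c ∈ t', G.Adj a c) ∧ v ∈ t' := by
  simp only [nodeTube, Finset.mem_insert, Finset.mem_biUnion, Finset.mem_filter, id]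
  refine or_congr_right ⟨?_, ?_⟩
  · rintro ⟨t', ⟨h1, h2, h3⟩, h4⟩
    exact ⟨t', h1, h2, h3, h4⟩
  · rintro ⟨t', h1, h2, h3, h4⟩
    exact ⟨t', ⟨h1, h2, h3⟩, h4⟩

omit [Finite V] in
theorem self_mem_nodeTube : a ∈ nodeTube G T s a := mem_nodeTube.2 (Or.inl rfl)

omit [Finite V] in
theorem subset_nodeTube {t' : Finset V} (h : t' ∈ T) (hs : t' ⊂ s) (ha : ∃ c ∈ t', G.Adj a c) :
    t' ⊆ nodeTube G T s a := fun _ hv => mem_nodeTube.2 (Or.inr ⟨t', h, hs, ha, hv⟩)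

omit [Finite V] in
/-- Adjacency to the smallest tube of a node is adjacency to the node in the core. -/
theorem exists_adj_nodeTube_iff : (∃ c ∈ nodeTube G T s a, G.Adj b c) ↔ CoreAdj G T s b a := by
  constructor
  · rintro ⟨c, hc, hbc⟩
    rcases mem_nodeTube.1 hc with rfl | ⟨t', h1, h2, h3, h4⟩
    · exact Or.inl hbc
    · exact Or.inr ⟨t', h1, h2, ⟨c, h4, hbc⟩, h3⟩
  · rintro (h | ⟨t', h1, h2, ⟨c, hc, hbc⟩, h3⟩)
    · exact ⟨a, self_mem_nodeTube, h⟩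
    · exact ⟨c, subset_nodeTube h1 h2 h3 hc, hbc⟩

omit [Finite V] in
theorem coreSet_inter_nodeTube (ha : a ∈ coreSet T s) :
    coreSet T s ∩ nodeTube G T s a = {a} := by
  ext v
  simp only [Set.mem_inter_iff, Finset.mem_coe, Set.mem_singleton_iff]
  constructor
  · rintro ⟨h, h'⟩
    rcases mem_nodeTube.1 h' with rfl | ⟨t', h1, h2, -, h4⟩
    · rfl
    · exact absurd h4 (h.2 t' h1 h2)
  · rintro rfl
    exact ⟨ha, self_mem_nodeTube⟩

omit [Finite V] in
theorem nodeTube_subset (ha : a ∈ coreSet T s) : nodeTube G T s a ⊆ s := by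
  intro v hv
  rcases mem_nodeTube.1 hv with rfl | ⟨t', h1, h2, -, h4⟩
  · exact ha.1
  · exact h2.1 h4

/-- The hypothesis `h2` makes the new tube proper in `s`. A tube below `s` that touches it cannot
contain the core node `a`; it has a neighbor of `a` or is contained in one of the tubes collected
around `a`, so in either case it lies in the new tube. -/
theorem isExtension_nodeTube (hT : IsTubing G T) (hs : s ∈ T ∪ universalTubes G)
    (ha : a ∈ coreSet T s) (h2 : 2 ≤ (coreSet T s).ncard) :
    IsExtension G T (nodeTube G T s a) s := by
  have hss : nodeTube G T s a ⊂ s := by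
    obtain ⟨b, hb, hba⟩ := Set.exists_ne_of_one_lt_ncard (s := coreSet T s) (by omega) a
    refine ⟨nodeTube_subset ha, fun h => hba ?_⟩
    have : b ∈ coreSet T s ∩ nodeTube G T s a := ⟨hb, h hb.1⟩
    rwa [coreSet_inter_nodeTube ha] at this
  have htube : IsTube G (nodeTube G T s a) := by
    refine isTube_of_forall self_mem_nodeTube fun X haX hX b hb => ?_
    rcases mem_nodeTube.1 hb with rfl | ⟨t', h1, h2, ⟨c, hc, hac⟩, h4⟩
    · exact haX
    · have hsub := subset_nodeTube h1 h2 ⟨c, hc, hac⟩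
      exact (hT.tube t' h1).forall_mem_of_closed X hc
        (hX a self_mem_nodeTube haX c (hsub hc) hac)
        (fun x hx hxX y hy hxy => hX x (hsub hx) hxX y (hsub hy) hxy) b h4
  have hU : ¬ IsUniversalTube G (nodeTube G T s a) := fun h => h.not_ssubset (hT.isTube hs) hss
  refine ⟨isTubing_insert hT htube ?_ ?_, ?_, hU, hs, hss, ?_⟩
  · obtain ⟨u, hu, huT⟩ := hT.proper
    refine ⟨u, hu, fun h => ?_⟩
    rcases Finset.mem_insert.1 h with rfl | h
    · exact hU hu
    · exact huT h
  · intro w hw x hx y hy hxy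
    rcases hT.nested (Finset.mem_union_left _ hw) hs hx (hss.1 hy) hxy with h | h | h
    · left
      refine ⟨?_, fun hsub => ha.2 w hw h (hsub self_mem_nodeTube)⟩
      rcases mem_nodeTube.1 hy with rfl | ⟨t', h1, h2, ⟨c, hc, hac⟩, h4⟩
      · rcases hxy with rfl | hxy
        · exact absurd hx (ha.2 w hw h)
        · exact subset_nodeTube hw h ⟨x, hx, hxy.symm⟩
      · rcases hT.nested (Finset.mem_union_left _ hw) (Finset.mem_union_left _ h1) hx h4 hxy
          with h5 | h5 | h5
        · exact h5.1.trans (subset_nodeTube h1 h2 ⟨c, hc, hac⟩)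
        · exact subset_nodeTube hw h ⟨c, h5 ▸ hc, hac⟩
        · exact subset_nodeTube hw h ⟨c, h5.1 hc, hac⟩
    · exact Or.inr (Or.inr (h ▸ hss))
    · exact Or.inr (Or.inr (hss.trans h))
  · intro h
    exact ha.2 _ h hss self_mem_nodeTube
  · intro w hw htw
    rcases hT.nested hw hs (htw.1 self_mem_nodeTube) ha.1 (Or.inl rfl) with h | h | h
    · exact absurd (htw.1 self_mem_nodeTube)
        (ha.2 w (mem_of_ssubset_of_isTube hw h (hT.isTube hs)) h)
    · exact h.ge
    · exact h.subset

/-- A new tube whose core is a single node is the smallest tube of that node. -/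
theorem IsExtension.eq_nodeTube (h : IsExtension G T t s) (ha : coreSet (insert t T) t = {a}) :
    t = nodeTube G T s a := by
  have hat : a ∈ coreSet T s ∩ t := by
    rw [← h.coreSet_self, ha]
    rfl
  apply subset_antisymm
  · refine h.isTube.forall_mem_of_closed {v | v ∈ nodeTube G T s a} hat.2 self_mem_nodeTube ?_
    intro v hvt hv w hwt hvw
    by_cases hwa : w = a
    · subst hwa
      exact self_mem_nodeTube
    have hw : ∃ t' ∈ T, t' ⊂ t ∧ w ∈ t' := by
      by_contra! hne
      refine hwa ?_
      have : w ∈ coreSet (insert t T) t := by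
        refine ⟨hwt, fun t' ht' hts => ?_⟩
        rcases Finset.mem_insert.1 ht' with rfl | ht'
        · exact absurd hts (ssubset_irrefl _)
        · exact hne t' ht' hts
      rwa [ha] at this
    obtain ⟨t'', ht'', hts'', hwt''⟩ := hw
    have hs'' := hts''.trans h.isParent.ssubset
    rcases mem_nodeTube.1 hv with rfl | ⟨t', h1, h2, ⟨c, hc, hac⟩, h4⟩
    · exact subset_nodeTube ht'' hs'' ⟨w, hwt'', hvw⟩ hwt''
    · rcases h.tubing.nested (Finset.mem_union_left _ h1) (Finset.mem_union_left _ ht'') h4 hwt''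
        (Or.inr hvw) with h5 | h5 | h5
      · exact subset_nodeTube ht'' hs'' ⟨c, h5.1 hc, hac⟩ hwt''
      · exact subset_nodeTube ht'' hs'' ⟨c, h5 ▸ hc, hac⟩ hwt''
      · exact subset_nodeTube h1 h2 ⟨c, hc, hac⟩ (h5.1 hwt'')
  · intro v hv
    rcases mem_nodeTube.1 hv with rfl | ⟨t', h1, h2, ⟨c, hc, hac⟩, h4⟩
    · exact hat.2
    · exact (h.ssubset_of_touch h1 h2 hc hat.2 (Or.inr hac.symm)).1 h4

theorem coreSet_nodeTube (h : IsExtension G T (nodeTube G T s a) s) (ha : a ∈ coreSet T s) :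
    coreSet (insert (nodeTube G T s a) T) (nodeTube G T s a) = {a} := by
  rw [h.coreSet_self, coreSet_inter_nodeTube ha]

theorem coreSet_insert_nodeTube (h : IsExtension G T (nodeTube G T s a) s)
    (ha : a ∈ coreSet T s) :
    coreSet (insert (nodeTube G T s a) T) s = coreSet T s \ {a} := by
  rw [h.coreSet_parent, ← coreSet_inter_nodeTube ha, Set.sdiff_self_inter]

end Tubes

theorem Blocks.IsListing.eq_of_card_inner_le_one {κ : Type v} {b : Blocks κ} {l l' : List κ}
    (h : b.IsListing l) (h' : b.IsListing l') (hc : b.inner.card ≤ 1) : l = l' := by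
  obtain ⟨i, hi, rfl⟩ := h
  obtain ⟨i', hi', rfl⟩ := h'
  have hp : i.Perm i' := Multiset.coe_eq_coe.1 (hi.trans hi'.symm)
  rw [← hi, Multiset.coe_card] at hc
  congr 1
  rcases i with _ | ⟨a, _ | ⟨a', r⟩⟩
  · exact hp.nil_eq
  · exact (List.perm_singleton.1 hp.symm).symm
  · simp at hc

namespace Template

variable {V : Type u} [Finite V] {κ : Type v} {G : SimpleGraph V} {pal : Multiset κ}
  {x x' y y' z z' : Template G pal} {s t t' w : Finset V} {a : V}

theorem card_colors (x : Template G pal) (hw : w ∈ x.tubes ∪ universalTubes G) :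
    (x.blocks w).colors.card = (if w ∈ x.tubes then 1 else 0) + ((coreSet x.tubes w).ncard - 1) := by
  obtain ⟨l, hl⟩ := (x.blocks w).exists_isListing
  have h1 := x.length_listing hw hl
  have h2 := x.coreSet_nonempty hw
  rw [← Set.ncard_pos] at h2
  rw [← hl.coe_eq, Multiset.coe_card]
  omega

/-- The colors of a template that do not color tubes are those that can still be moved. -/
theorem card_tubes_add (x : Template G pal) :
    x.tubes.card + ∑ w ∈ x.tubes ∪ universalTubes G, ((coreSet x.tubes w).ncard - 1) +
      x.universalBlock.card = pal.card := by
  have h := congrArg Multiset.card x.total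
  rw [Multiset.card_add, Multiset.card_sum, Finset.sum_congr rfl fun w hw => x.card_colors hw,
    Finset.sum_add_distrib, Finset.sum_boole, Finset.filter_mem_eq_inter,
    Finset.inter_eq_right.2 Finset.subset_union_left] at h
  exact h

theorem card_tubes_le (x : Template G pal) : x.tubes.card ≤ pal.card := by
  have := x.card_tubes_add
  omega

/-- A tube can be added if its parent and the tube receive the right numbers of colors. -/
theorem exists_addTube (hs : IsExtension G y.tubes t s) {l₁ l₂ : List κ}
    (hl : (y.blocks s).IsListing (l₁ ++ l₂)) (hpos : (coreSet (insert t y.tubes) t).Nonempty)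
    (hpos' : (coreSet (insert t y.tubes) s).Nonempty)
    (hlen : l₁.length + 1 =
      (if s ∈ y.tubes then 1 else 0) + (coreSet (insert t y.tubes) s).ncard) :
    ∃ x, AddTube x y t ∧ (x.blocks s).IsListing l₁ ∧ (x.blocks t).IsListing l₂ := by
  obtain ⟨L, hL⟩ := y.exists_lists
  have hst : s ≠ t := hs.ne_of_mem hs.isParent.mem
  set L' : Finset V → List κ := fun w => if w = s then l₁ else if w = t then l₂ else L w with hL'
  have hL's : L' s = l₁ := by simp [hL']
  have hL't : L' t = l₂ := by simp [hL', hst.symm]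
  have hL'w : ∀ w, w ≠ s → w ≠ t → L' w = L w := by
    intro w hws hwt
    simp [hL', hws, hwt]
  have hmerge : y.Lists fun w => if w = s then L' s ++ L' t else L' w := by
    intro w hw
    beta_reduce
    by_cases hws : w = s
    · subst hws
      rwa [if_pos rfl, hL's, hL't]
    · rw [if_neg hws, hL'w w hws (hs.ne_of_mem hw)]
      exact hL w hw
  have hex : ∃ x : Template G pal, x.tubes = insert t y.tubes ∧
      x.universalBlock = y.universalBlock ∧ x.Lists L' := by
    refine exists_of_lists hs.isTubing _ ?_ ?_ _ ?_ ?_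
    · intro w hw
      by_cases hws : w = s
      · exact hws ▸ hpos'
      · rw [Finset.insert_union, Finset.mem_insert] at hw
        rcases hw with rfl | hw
        · exact hpos
        · rw [hs.coreSet_of_ne hw hws]
          exact y.coreSet_nonempty hw
    · intro w hw
      by_cases hws : w = s
      · subst hws
        rw [hL's, hlen]
        simp [hst]
      · rw [Finset.insert_union, Finset.mem_insert] at hw
        rcases hw with rfl | hw
        · have h1 := y.length_listing hs.isParent.mem hl
          have h2 := hs.ncard_coreSet
          rw [List.length_append] at h1
          rw [hL't, if_pos (Finset.mem_insert_self _ _)]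
          omega
        · have hwt := hs.ne_of_mem hw
          rw [hs.coreSet_of_ne hw hws, hL'w w hws hwt, y.length_listing hw (hL w hw)]
          simp [hwt]
    · rw [← y.universalBlock_card, Finset.insert_inter_of_notMem]
      simp [hs.not_universal]
    · have := hmerge.total
      rw [sum_ite_append hs.isParent.mem] at this
      rw [Finset.insert_union, Finset.sum_insert hs.notMem_union, add_comm (L' t : Multiset κ)]
      exact this
  obtain ⟨x, hx, -, hxL⟩ := hex
  refine ⟨x, addTube_of_lists hs hx hxL hmerge, ?_, ?_⟩
  · rw [← hL's]
    exact hxL s (hx ▸ IsExtension.mem_insert hs.isParent.mem)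
  · rw [← hL't]
    exact hxL t (hx ▸ IsExtension.mem_self)

/-- The color of the last place of a tube can be moved to a new tube with a single core node. -/
theorem exists_addTube_nodeTube (hs : s ∈ y.tubes ∪ universalTubes G)
    (h2 : 2 ≤ (coreSet y.tubes s).ncard) (ha : a ∈ coreSet y.tubes s) {l : List κ} {c : κ}
    (hl : (y.blocks s).IsListing (l ++ [c])) :
    ∃ x, AddTube x y (nodeTube G y.tubes s a) ∧ (x.blocks s).IsListing l ∧
      (x.blocks (nodeTube G y.tubes s a)).IsListing [c] := by
  have hext := isExtension_nodeTube y.isTubing hs ha h2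
  have h3 := coreSet_nodeTube hext ha
  have h4 := hext.ncard_coreSet
  rw [h3, Set.ncard_singleton] at h4
  have h5 := y.length_listing hs hl
  rw [List.length_append, List.length_singleton] at h5
  refine exists_addTube hext hl ?_ ?_ (by omega)
  · rw [h3]
    exact Set.singleton_nonempty a
  · rw [← Set.ncard_pos]
    omega

theorem exists_listing_append_singleton (hs : s ∈ y.tubes ∪ universalTubes G)
    (h2 : 2 ≤ (coreSet y.tubes s).ncard) : ∃ l c, (y.blocks s).IsListing (l ++ [c]) := by
  obtain ⟨l, hl⟩ := (y.blocks s).exists_isListing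
  have := y.length_listing hs hl
  have hne : l ≠ [] := by
    rintro rfl
    rw [List.length_nil] at this
    omega
  exact ⟨l.dropLast, l.getLast hne, by rwa [List.dropLast_append_getLast hne]⟩

/-- There is always one more missing universal tube than there are colors in the universal block, so
placing a color never completes the set of universal tubes. -/
theorem card_universalTubes_sdiff (y : Template G pal) :
    (universalTubes G \ y.tubes).card = y.universalBlock.card + 1 := by
  have h1 := y.universalBlock_card
  rw [← card_universalTubes] at h1
  have h2 := Finset.card_sdiff_add_card_inter (universalTubes G) y.tubes
  rw [Finset.inter_comm] at h2
  omega

theorem exists_addUniversalTube (ht : IsUniversalTube G t) (htT : t ∉ y.tubes) {c : κ}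
    {ub : Multiset κ} (hub : y.universalBlock = c ::ₘ ub) :
    ∃ x, AddUniversalTube x y t ∧ (x.blocks t).color = some c ∧ x.universalBlock = ub := by
  have hc := y.card_universalTubes_sdiff
  rw [hub, Multiset.card_cons] at hc
  have htU : t ∈ universalTubes G := mem_universalTubes.2 ht
  have hT : IsTubing G (insert t y.tubes) := by
    refine isTubing_insert y.isTubing ht.isTube ?_ ?_
    · obtain ⟨u, hu, hut⟩ := Finset.exists_mem_ne
        (s := universalTubes G \ y.tubes) (by omega) t
      rw [Finset.mem_sdiff, mem_universalTubes] at hu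
      exact ⟨u, hu.1, by simp [hut, hu.2]⟩
    · intro w hw a ha b hb hab
      exact y.isTubing.nested (Finset.mem_union_left _ hw) (Finset.mem_union_right _ htU) ha hb hab
  have hW : insert t y.tubes ∪ universalTubes G = y.tubes ∪ universalTubes G :=
    insert_union_universalTubes ht
  have hnone : (y.blocks t).color = none := by
    have := (y.color_isSome t).not.2 htT
    simpa using this
  have hcard : (insert t y.tubes ∩ universalTubes G).card =
      (y.tubes ∩ universalTubes G).card + 1 := by
    rw [Finset.insert_inter_of_mem htU, Finset.card_insert_of_notMem]
    simp [htT]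
  refine ⟨⟨insert t y.tubes, fun w => if w = t then ⟨some c, (y.blocks t).outer,
    (y.blocks t).inner⟩ else y.blocks w, ub, hT, ?_, ?_, ?_, ?_, ?_, ?_⟩, ?_, ?_, rfl⟩
  · intro w
    by_cases hwt : w = t
    · simp [hwt]
    · simp [hwt, y.color_isSome]
  · intro w hw
    have h1 := y.outer_length w (hW ▸ hw)
    have h2 := conn_insert_universal (T := y.tubes) ht (y.isTubing.isTube (hW ▸ hw))
    rw [conn, conn] at h2
    rw [h2, ← h1]
    by_cases hwt : w = t
    · simp [hwt]
    · simp [hwt]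
  · intro w hw
    rw [coreSet_insert_universal ht (y.isTubing.isTube (hW ▸ hw)), ← y.inner_card w (hW ▸ hw)]
    by_cases hwt : w = t
    · simp [hwt]
    · simp [hwt]
  · intro w hw
    have hwt : w ≠ t := by
      rintro rfl
      exact hw (Finset.mem_union_right _ htU)
    rw [if_neg hwt]
    exact y.blocks_eq w (hW ▸ hw)
  · rw [← y.universalBlock_card, hub, Multiset.card_cons, hcard]
    omega
  · have htm : t ∈ y.tubes ∪ universalTubes G := Finset.mem_union_right _ htU
    have h1 := y.total
    rw [← Finset.add_sum_erase _ _ htm] at h1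
    rw [hW, ← Finset.add_sum_erase _ _ htm, if_pos rfl]
    refine Eq.trans ?_ h1
    have : ∀ w ∈ (y.tubes ∪ universalTubes G).erase t,
        (if w = t then (⟨some c, (y.blocks t).outer, (y.blocks t).inner⟩ : Blocks κ)
          else y.blocks w).colors = (y.blocks w).colors := by
      intro w hw
      rw [if_neg (Finset.ne_of_mem_erase hw)]
    rw [Finset.sum_congr rfl this, hub]
    simp only [Blocks.colors, Blocks.visible, Blocks.hidden, hnone, Option.toList_none,
      Option.toList_some, Multiset.coe_nil, zero_add, Multiset.coe_singleton,
      ← Multiset.singleton_add]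
    abel
  · refine ⟨htT, ht, rfl, ?_, c, hub, ?_, ?_, ?_⟩
    · intro w hw
      simp [hw]
    all_goals simp
  · simp

theorem lt_of_addAt (h : AddAt x t y) : x < y := by
  refine lt_of_le_of_ne (le_of_addAt h) ?_
  rintro rfl
  exact h.notMem (h.tubes_eq ▸ Finset.mem_insert_self _ _)

/-- By `card_tubes_add` some color can still be moved: it is in the universal block or belongs to a
tube with at least two core nodes. -/
theorem exists_lt (h : y.tubes.card < pal.card) : ∃ x, x < y := by
  have hsum := y.card_tubes_add
  by_cases hub : y.universalBlock = 0
  · rw [hub, Multiset.card_zero] at hsum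
    obtain ⟨s, hs, hne⟩ := Finset.exists_ne_zero_of_sum_ne_zero
      (s := y.tubes ∪ universalTubes G) (f := fun w => (coreSet y.tubes w).ncard - 1) (by omega)
    obtain ⟨l, c, hl⟩ := y.exists_listing_append_singleton hs (by omega)
    obtain ⟨a, ha⟩ := y.coreSet_nonempty hs
    obtain ⟨x, hx, -⟩ := exists_addTube_nodeTube hs (by omega) ha hl
    exact ⟨x, lt_of_addAt (Or.inl hx)⟩
  · obtain ⟨c, hc⟩ := Multiset.exists_mem_of_ne_zero hub
    obtain ⟨ub, hub'⟩ := Multiset.exists_cons_of_mem hc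
    obtain ⟨u, hu⟩ : (universalTubes G \ y.tubes).Nonempty := by
      rw [← Finset.card_pos, y.card_universalTubes_sdiff]
      omega
    rw [Finset.mem_sdiff, mem_universalTubes] at hu
    obtain ⟨x, hx, -⟩ := exists_addUniversalTube hu.1 hu.2 hub'
    exact ⟨x, lt_of_addAt (Or.inr hx)⟩

/-- Above `x`, a face is determined by its tubes, so `y` is the result of deleting the one tube that
it lacks. -/
theorem exists_addAt_of_card_eq (hle : x ≤ y) (hc : x.tubes.card = y.tubes.card + 1) :
    ∃ t, AddAt x t y := by
  have hsub := (isBooleanAbove G pal).subset hle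
  obtain ⟨t, htx, hty⟩ := Finset.exists_of_ssubset (Finset.ssubset_iff_subset_ne.2
    ⟨hsub, fun e => by rw [e] at hc; omega⟩)
  obtain ⟨y', hy'⟩ := exists_addAt htx
  refine ⟨t, ?_⟩
  rwa [(isBooleanAbove G pal).eq_of_eq hle (le_of_addAt hy') ?_]
  have h1 := hy'.tubes_eq
  have h2 := Finset.card_insert_of_notMem hy'.notMem
  apply Finset.eq_of_subset_of_card_le
  · intro w hw
    have hwx := hsub hw
    beta_reduce at hwx
    rw [h1, Finset.mem_insert] at hwx
    rcases hwx with rfl | hwx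
    · exact absurd hw hty
    · exact hwx
  · rw [← h1] at h2
    omega

/-- Adding a tube to `y` is determined by the listings of the tube and its parent. -/
theorem AddTube.eq_of_listing (h : AddTube x y t) (h' : AddTube x' y t)
    (hs : IsExtension G y.tubes t s) {l₁ l₂ : List κ}
    (h₁ : (x.blocks s).IsListing l₁) (h₁' : (x'.blocks s).IsListing l₁)
    (h₂ : (x.blocks t).IsListing l₂) (h₂' : (x'.blocks t).IsListing l₂) : x = x' := by
  refine Template.eq_of_listing (by rw [h.tubes_eq, h'.tubes_eq]) fun w _ => ?_
  by_cases hwt : w = t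
  · subst hwt
    exact ⟨_, h₂, h₂'⟩
  · by_cases hws : w = s
    · subst hws
      exact ⟨_, h₁, h₁'⟩
    · rw [h.blocks_of_ne hs hwt hws, h'.blocks_of_ne hs hwt hws]
      obtain ⟨l, hl⟩ := (y.blocks w).exists_isListing
      exact ⟨l, hl, hl⟩

theorem AddUniversalTube.eq_of_color (h : AddUniversalTube x y t) (h' : AddUniversalTube x' y t)
    (hc : (x.blocks t).color = (x'.blocks t).color) : x = x' := by
  obtain ⟨-, -, hx, hb, -, -, -, ho, hi⟩ := h
  obtain ⟨-, -, hx', hb', -, -, -, ho', hi'⟩ := h'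
  refine Template.eq_of_listing (by rw [hx, hx']) fun w _ => ?_
  obtain ⟨l, hl⟩ := (x.blocks w).exists_isListing
  refine ⟨l, hl, ?_⟩
  by_cases hwt : w = t
  · subst hwt
    rwa [← Blocks.ext hc (ho.trans ho'.symm) (hi.trans hi'.symm)]
  · rwa [hb' w hwt, ← hb w hwt]

theorem two_le_ncard_coreSet_of_addTube (h : AddTube x y t) (hs : IsExtension G y.tubes t s) :
    2 ≤ (coreSet y.tubes s).ncard := by
  have h1 := x.coreSet_nonempty (w := s)
    (by rw [h.tubes_eq]; exact IsExtension.mem_insert hs.isParent.mem)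
  have h2 := x.coreSet_nonempty (w := t) (by rw [h.tubes_eq]; exact IsExtension.mem_self)
  rw [← Set.ncard_pos, h.tubes_eq] at h1 h2
  have := hs.ncard_coreSet
  omega

/-- Edges have two vertices. -/
theorem ncard_Iio_of_card (h : y.tubes.card + 1 = pal.card) : (Set.Iio y).ncard = 2 := by
  have hsum := y.card_tubes_add
  have hstep : ∀ x < y, ∃ t, AddAt x t y := fun x hx => by
    have h1 := (isBooleanAbove G pal).card_lt hx
    have h2 := x.card_tubes_le
    beta_reduce at h1
    exact exists_addAt_of_card_eq hx.le (by omega)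
  by_cases hub : y.universalBlock = 0
  · rw [hub, Multiset.card_zero] at hsum
    obtain ⟨s, hs, hne⟩ := Finset.exists_ne_zero_of_sum_ne_zero
      (s := y.tubes ∪ universalTubes G) (f := fun w => (coreSet y.tubes w).ncard - 1) (by omega)
    rw [← Finset.add_sum_erase _ _ hs] at hsum
    -- The only movable color belongs to `s`, and it can go to the smallest tube of either of the
    -- two core nodes.
    have hs2 : (coreSet y.tubes s).ncard = 2 := by omega
    have hone : ∀ w ∈ y.tubes ∪ universalTubes G, 2 ≤ (coreSet y.tubes w).ncard → w = s := by
      intro w hw h2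
      by_contra hws
      have := Finset.single_le_sum (s := (y.tubes ∪ universalTubes G).erase s)
        (f := fun w => (coreSet y.tubes w).ncard - 1) (fun _ _ => Nat.zero_le _)
        (Finset.mem_erase.2 ⟨hws, hw⟩)
      beta_reduce at this
      omega
    obtain ⟨a, b, hab, hcore⟩ := Set.ncard_eq_two.1 hs2
    have ha : a ∈ coreSet y.tubes s := hcore ▸ Or.inl rfl
    have hb : b ∈ coreSet y.tubes s := hcore ▸ Or.inr rfl
    obtain ⟨l, c, hl⟩ := y.exists_listing_append_singleton hs hs2.ge
    obtain ⟨xa, hxa, hxa1, hxa2⟩ := exists_addTube_nodeTube hs hs2.ge ha hl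
    obtain ⟨xb, hxb, hxb1, hxb2⟩ := exists_addTube_nodeTube hs hs2.ge hb hl
    have hea := isExtension_nodeTube y.isTubing hs ha hs2.ge
    have heb := isExtension_nodeTube y.isTubing hs hb hs2.ge
    have hnab : nodeTube G y.tubes s a ≠ nodeTube G y.tubes s b := by
      intro e
      have h1 := coreSet_inter_nodeTube (G := G) ha
      rw [e, coreSet_inter_nodeTube hb] at h1
      exact hab (Set.singleton_injective h1).symm
    rw [Set.ncard_eq_two]
    refine ⟨xa, xb, ?_, Set.ext fun x => ⟨fun hx => ?_, ?_⟩⟩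
    · rintro rfl
      have h1 : nodeTube G y.tubes s b ∈ insert (nodeTube G y.tubes s a) y.tubes := by
        rw [← hxa.tubes_eq, hxb.tubes_eq]
        exact Finset.mem_insert_self _ _
      rcases Finset.mem_insert.1 h1 with h1 | h1
      · exact hnab h1.symm
      · exact heb.notMem h1
    · obtain ⟨t, ht | ht⟩ := hstep x hx
      · obtain ⟨s', hs'⟩ := ht.isExtension
        obtain rfl := hone s' hs'.isParent.mem (two_le_ncard_coreSet_of_addTube ht hs')
        have htx : t ∈ x.tubes ∪ universalTubes G := by
          rw [ht.tubes_eq]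
          exact IsExtension.mem_self
        have hsx : s' ∈ x.tubes ∪ universalTubes G := by
          rw [ht.tubes_eq]
          exact IsExtension.mem_insert hs
        have hct := x.coreSet_nonempty htx
        have hcs := x.coreSet_nonempty hsx
        have hn := hs'.ncard_coreSet
        rw [ht.tubes_eq] at hct hcs
        rw [← Set.ncard_pos] at hct hcs
        obtain ⟨d, hd⟩ := Set.ncard_eq_one.1
          (show (coreSet (insert t y.tubes) t).ncard = 1 by omega)
        obtain ⟨l₁, hl₁⟩ := (x.blocks s').exists_isListing
        obtain ⟨l₂, hl₂⟩ := (x.blocks t).exists_isListing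
        -- Two core nodes leave at most one inner color. The listing is then unique, which fixes the
        -- color of the new tube.
        have hi : (y.blocks s').inner.card ≤ 1 := by
          have := y.inner_card s' hs
          omega
        have hll := (ht.listing hs' hl₁ hl₂).eq_of_card_inner_le_one hl hi
        have e1 := x.length_listing htx hl₂
        rw [if_pos (ht.tubes_eq ▸ Finset.mem_insert_self _ _), ht.tubes_eq] at e1
        obtain ⟨rfl, rfl⟩ := List.append_inj' hll (by simp; omega)
        have hdt := hs'.eq_nodeTube hd
        have hdc : d ∈ coreSet y.tubes s' := by
          have : d ∈ coreSet (insert t y.tubes) t := hd ▸ rfl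
          rw [hs'.coreSet_self] at this
          exact this.1
        rw [hcore] at hdc
        rcases hdc with rfl | rfl
        · left
          subst hdt
          exact ht.eq_of_listing hxa hs' hl₁ hxa1 hl₂ hxa2
        · right
          subst hdt
          exact ht.eq_of_listing hxb hs' hl₁ hxb1 hl₂ hxb2
      · obtain ⟨-, -, -, -, c, hc, -⟩ := ht
        rw [hub] at hc
        exact absurd hc (Multiset.zero_ne_cons)
    · rintro (rfl | rfl)
      · exact lt_of_addAt (Or.inl hxa)
      · exact lt_of_addAt (Or.inl hxb)
  -- The only movable color is in the universal block, and exactly two universal tubes are missing.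
  · have hub1 : y.universalBlock.card = 1 := by
      have := Multiset.card_pos.2 hub
      omega
    have hzero : ∑ w ∈ y.tubes ∪ universalTubes G, ((coreSet y.tubes w).ncard - 1) = 0 := by omega
    rw [Finset.sum_eq_zero_iff] at hzero
    obtain ⟨c, hc⟩ := Multiset.card_eq_one.1 hub1
    have hU := y.card_universalTubes_sdiff
    rw [hub1] at hU
    obtain ⟨u, u', huu, hU⟩ := Finset.card_eq_two.1 hU
    have hmem : ∀ w, IsUniversalTube G w ∧ w ∉ y.tubes ↔ w = u ∨ w = u' := by
      intro w
      rw [← mem_universalTubes, ← Finset.mem_sdiff, hU]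
      simp
    obtain ⟨hu1, hu2⟩ := (hmem u).2 (Or.inl rfl)
    obtain ⟨hu1', hu2'⟩ := (hmem u').2 (Or.inr rfl)
    obtain ⟨x, hx, hxc, -⟩ := exists_addUniversalTube (c := c) (ub := 0) hu1 hu2 hc
    obtain ⟨x', hx', hxc', -⟩ := exists_addUniversalTube (c := c) (ub := 0) hu1' hu2' hc
    rw [Set.ncard_eq_two]
    refine ⟨x, x', ?_, Set.ext fun z => ⟨fun hz => ?_, ?_⟩⟩
    · rintro rfl
      have h1 : u ∈ insert u' y.tubes := by
        rw [← hx'.tubes_eq, hx.tubes_eq]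
        exact Finset.mem_insert_self _ _
      rcases Finset.mem_insert.1 h1 with h1 | h1
      · exact huu h1
      · exact hu2 h1
    · obtain ⟨t, ht | ht⟩ := hstep z hz
      · obtain ⟨s', hs'⟩ := ht.isExtension
        have h1 := two_le_ncard_coreSet_of_addTube ht hs'
        have h2 := hzero s' hs'.isParent.mem
        omega
      · have htc : (z.blocks t).color = some c := by
          obtain ⟨-, -, -, -, c', hc', hcol, -⟩ := ht
          have : c' ∈ ({c} : Multiset κ) := by
            rw [← hc, hc']
            exact Multiset.mem_cons_self _ _
          rwa [Multiset.mem_singleton.1 this] at hcol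
        rcases (hmem t).1 ⟨ht.2.1, ht.1⟩ with rfl | rfl
        · exact Or.inl (ht.eq_of_color hx (htc.trans hxc.symm))
        · exact Or.inr (ht.eq_of_color hx' (htc.trans hxc'.symm))
    · rintro (rfl | rfl)
      · exact lt_of_addAt (Or.inr hx)
      · exact lt_of_addAt (Or.inr hx')

end Template
end ColorfulGA

namespace ColorfulGA

open scoped Classical

/-! ### Reduction to node facets, and facets that belong to different tubes -/

section Tubes

variable {V : Type u} [Finite V] {G : SimpleGraph V} {T : Finset (Finset V)} {s s' t w : Finset V}
  {a b : V}

theorem nodeTube_insert_of_ne (h : IsExtension G T t s) (hs' : s' ∈ T ∪ universalTubes G)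
    (hne : s' ≠ s) : nodeTube G (insert t T) s' a = nodeTube G T s' a := by
  ext v
  rw [mem_nodeTube, mem_nodeTube]
  refine or_congr_right ⟨?_, ?_⟩
  · rintro ⟨t', h1, h2, ⟨c, hc, hac⟩, h4⟩
    rcases Finset.mem_insert.1 h1 with rfl | h1
    · have hss := (h.isParent.subset s' hs' h2).ssubset_of_ne hne.symm
      exact ⟨s, mem_of_ssubset_of_isTube h.isParent.mem hss (h.tubing.isTube hs'), hss,
        ⟨c, h.isParent.ssubset.1 hc, hac⟩, h.isParent.ssubset.1 h4⟩
    · exact ⟨t', h1, h2, ⟨c, hc, hac⟩, h4⟩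
  · rintro ⟨t', h1, h⟩
    exact ⟨t', Finset.mem_insert_of_mem h1, h⟩

omit [Finite V] in
theorem nodeTube_insert_universal (h : IsUniversalTube G t) (hs : IsTube G s) :
    nodeTube G (insert t T) s a = nodeTube G T s a := by
  ext v
  rw [mem_nodeTube, mem_nodeTube]
  refine or_congr_right ⟨?_, ?_⟩
  · rintro ⟨t', h1, h2, h3⟩
    rcases Finset.mem_insert.1 h1 with rfl | h1
    · exact absurd h2 (h.not_ssubset hs)
    · exact ⟨t', h1, h2, h3⟩
  · rintro ⟨t', h1, h⟩
    exact ⟨t', Finset.mem_insert_of_mem h1, h⟩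

-- Once the tube of `a` has been added, it is a tube below `s` with a neighbor of `b`, so the
-- smallest tube of `b` absorbs it.
omit [Finite V] in
theorem nodeTube_insert_of_adj (hts : nodeTube G T s a ⊂ s) (hab : CoreAdj G T s b a) :
    nodeTube G (insert (nodeTube G T s a) T) s b = nodeTube G T s b ∪ nodeTube G T s a := by
  ext v
  rw [Finset.mem_union, mem_nodeTube, mem_nodeTube (a := b)]
  constructor
  · rintro (rfl | ⟨t', h1, h2, h3, h4⟩)
    · exact Or.inl (Or.inl rfl)
    · rcases Finset.mem_insert.1 h1 with rfl | h1
      · exact Or.inr h4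
      · exact Or.inl (Or.inr ⟨t', h1, h2, h3, h4⟩)
  · rintro ((rfl | ⟨t', h1, h2, h3, h4⟩) | h)
    · exact Or.inl rfl
    · exact Or.inr ⟨t', Finset.mem_insert_of_mem h1, h2, h3, h4⟩
    · exact Or.inr ⟨_, Finset.mem_insert_self _ _, hts, exists_adj_nodeTube_iff.2 hab, h⟩

omit [Finite V] in
theorem nodeTube_insert_of_not_adj (hab : ¬ CoreAdj G T s b a) :
    nodeTube G (insert (nodeTube G T s a) T) s b = nodeTube G T s b := by
  ext v
  rw [mem_nodeTube, mem_nodeTube (a := b)]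
  constructor
  · rintro (rfl | ⟨t', h1, h2, h3, h4⟩)
    · exact Or.inl rfl
    · rcases Finset.mem_insert.1 h1 with rfl | h1
      · exact absurd (exists_adj_nodeTube_iff.1 h3) hab
      · exact Or.inr ⟨t', h1, h2, h3, h4⟩
  · rintro (rfl | ⟨t', h1, h2, h3, h4⟩)
    · exact Or.inl rfl
    · exact Or.inr ⟨t', Finset.mem_insert_of_mem h1, h2, h3, h4⟩

end Tubes

namespace Template

variable {V : Type u} [Finite V] {κ : Type v} {G : SimpleGraph V} {pal : Multiset κ}
  {f f' g x x' y y' z z' : Template G pal} {s s' t t' w : Finset V} {a b : V}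

theorem exists_vertex_le (x : Template G pal) : ∃ v ≤ x, v.tubes.card = pal.card := by
  induction hn : pal.card - x.tubes.card using Nat.strong_induction_on generalizing x with
  | _ n ih =>
    by_cases hc : x.tubes.card = pal.card
    · exact ⟨x, le_rfl, hc⟩
    · have := x.card_tubes_le
      obtain ⟨z, hz⟩ := exists_lt (y := x) (by omega)
      have h1 := (isBooleanAbove G pal).card_lt hz
      obtain ⟨v, hv, hvc⟩ := ih _ (by omega) z rfl
      exact ⟨v, hv.trans hz.le, hvc⟩

theorem addAt_of_le (hle : x ≤ y) (ht : t ∉ y.tubes) (hx : x.tubes = insert t y.tubes) :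
    AddAt x t y := by
  obtain ⟨t', h⟩ := exists_addAt_of_card_eq hle (by rw [hx, Finset.card_insert_of_notMem ht])
  have : t' ∈ insert t y.tubes := by
    rw [← hx, h.tubes_eq]
    exact Finset.mem_insert_self _ _
  rcases Finset.mem_insert.1 this with rfl | h'
  · exact h
  · exact absurd h' h.notMem

/-- Two tubes that have been added one after the other can be added in the other order. -/
theorem exists_add_swap (h : AddAt f t y) (h' : AddAt z t' f) :
    ∃ g, AddAt z t g ∧ AddAt g t' y := by
  have htt : t' ∉ insert t y.tubes := h.tubes_eq ▸ h'.notMem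
  rw [Finset.mem_insert, not_or] at htt
  have hz : z.tubes = insert t (insert t' y.tubes) := by
    rw [h'.tubes_eq, h.tubes_eq, Finset.insert_comm]
  obtain ⟨g, hzg, hg⟩ := (isBooleanAbove G pal).exists_above z (S := insert t' y.tubes)
    (by rw [hz]; exact Finset.subset_insert _ _)
  refine ⟨g, addAt_of_le hzg ?_ (by rw [hz, hg]), addAt_of_le ?_ htt.2 hg⟩
  · rw [hg, Finset.mem_insert, not_or]
    exact ⟨fun e => htt.1 e.symm, h.notMem⟩
  · refine (isBooleanAbove G pal).le_of_subset hzg ((le_of_addAt h').trans (le_of_addAt h)) ?_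
    rw [hg]
    exact Finset.subset_insert _ _

/-- The basic way of joining facets: `f` and `g` both lie above `z`, in which two tubes have been
added to `y`. -/
theorem joined_of_add (h : AddAt f t y) (h' : AddAt z t' f) (hzg : AddAt z s g)
    (hg : AddAt g s' y) : Joined (Set.Iio y) f g :=
  Joined.of_common_lower ((lt_of_addAt h').trans (lt_of_addAt h)) (lt_of_addAt h) (lt_of_addAt hg)
    (le_of_addAt h') (le_of_addAt hzg)

/-- `f` arises from `y` by adding the smallest tube of the node `a` of the core of `s`, and by
giving it the last color of the listing `l` of `s`. -/
structure IsNodeFacet (f y : Template G pal) (s : Finset V) (a : V) (l : List κ) : Prop where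
  mem : s ∈ y.tubes ∪ universalTubes G
  two_le : 2 ≤ (coreSet y.tubes s).ncard
  mem_core : a ∈ coreSet y.tubes s
  addTube : AddTube f y (nodeTube G y.tubes s a)
  exists_eq : ∃ l' c, l = l' ++ [c] ∧ (f.blocks s).IsListing l' ∧
    (f.blocks (nodeTube G y.tubes s a)).IsListing [c]

namespace IsNodeFacet

variable {l l' : List κ}

theorem isExtension (h : IsNodeFacet f y s a l) :
    IsExtension G y.tubes (nodeTube G y.tubes s a) s :=
  isExtension_nodeTube y.isTubing h.mem h.mem_core h.two_le

theorem isListing (h : IsNodeFacet f y s a l) : (y.blocks s).IsListing l := by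
  obtain ⟨l', c, rfl, h1, h2⟩ := h.exists_eq
  exact h.addTube.listing h.isExtension h1 h2

theorem eq (h : IsNodeFacet f y s a l) (h' : IsNodeFacet f' y s a l) : f = f' := by
  obtain ⟨l₁, c, rfl, h1, h2⟩ := h.exists_eq
  obtain ⟨l₁', c', e, h1', h2'⟩ := h'.exists_eq
  obtain ⟨rfl, e⟩ := List.append_inj' e rfl
  obtain rfl : c = c' := by simpa using e
  exact h.addTube.eq_of_listing h'.addTube h.isExtension h1 h1' h2 h2'

end IsNodeFacet

theorem exists_isNodeFacet (hs : s ∈ y.tubes ∪ universalTubes G)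
    (h2 : 2 ≤ (coreSet y.tubes s).ncard) (ha : a ∈ coreSet y.tubes s) {l : List κ}
    (hl : (y.blocks s).IsListing l) : ∃ f, IsNodeFacet f y s a l := by
  have := y.length_listing hs hl
  obtain ⟨l', c, rfl⟩ : ∃ l' c, l = l' ++ [c] := by
    have hne : l ≠ [] := by
      rintro rfl
      rw [List.length_nil] at this
      omega
    exact ⟨l.dropLast, l.getLast hne, (List.dropLast_append_getLast hne).symm⟩
  obtain ⟨f, hf, hf1, hf2⟩ := exists_addTube_nodeTube hs h2 ha hl
  exact ⟨f, hs, h2, ha, hf, l', c, rfl, hf1, hf2⟩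

theorem isNodeFacet_of_addTube (hs : s ∈ y.tubes ∪ universalTubes G)
    (h2 : 2 ≤ (coreSet y.tubes s).ncard) (ha : a ∈ coreSet y.tubes s)
    (h : AddTube f y (nodeTube G y.tubes s a)) : ∃ l, IsNodeFacet f y s a l := by
  have hext := isExtension_nodeTube y.isTubing hs ha h2
  have htf : nodeTube G y.tubes s a ∈ f.tubes ∪ universalTubes G := by
    rw [h.tubes_eq]
    exact IsExtension.mem_self
  obtain ⟨l₁, hl₁⟩ := (f.blocks s).exists_isListing
  obtain ⟨l₂, hl₂⟩ := (f.blocks (nodeTube G y.tubes s a)).exists_isListing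
  have hlen := f.length_listing htf hl₂
  rw [if_pos (h.tubes_eq ▸ Finset.mem_insert_self _ _), h.tubes_eq, coreSet_nodeTube hext ha,
    Set.ncard_singleton] at hlen
  obtain ⟨c, rfl⟩ := List.length_eq_one_iff.1 (show l₂.length = 1 by omega)
  exact ⟨_, hs, h2, ha, h, l₁, c, rfl, hl₁, hl₂⟩

/-- Every face below `y` is connected to one that arises by adding a universal tube or a tube with
a single core node. -/
theorem exists_joined_facet (hxy : x < y) : ∃ f, Joined (Set.Iio y) x f ∧
    ((∃ t, AddUniversalTube f y t) ∨ ∃ s a l, IsNodeFacet f y s a l) := by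
  obtain ⟨v, hvx, hv⟩ := x.exists_vertex_le
  have hvy := hvx.trans_lt hxy
  have hsub := (isBooleanAbove G pal).subset hvy.le
  have hlt := (isBooleanAbove G pal).card_lt hvy
  -- Since `t` is a smallest new tube of the vertex `v`, no other new tube lies inside it. It
  -- therefore has the same core in `f` as in `v`, where every core is a single node.
  obtain ⟨t, ht, hmin⟩ := Finset.exists_min_image (v.tubes \ y.tubes) Finset.card (by
    rw [← Finset.card_pos, Finset.card_sdiff_of_subset hsub]
    omega)
  rw [Finset.mem_sdiff] at ht
  obtain ⟨f, hvf, hf⟩ := (isBooleanAbove G pal).exists_above v (S := insert t y.tubes)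
    (Finset.insert_subset ht.1 hsub)
  have hfy : f ≤ y := (isBooleanAbove G pal).le_of_subset hvf hvy.le (by
    rw [hf]
    exact Finset.subset_insert _ _)
  have hadd := addAt_of_le hfy ht.2 hf
  refine ⟨f, (Joined.of_common_lower hvy hxy (lt_of_addAt hadd) hvx hvf), ?_⟩
  rcases hadd with hadd | hadd
  · right
    obtain ⟨s, hs⟩ := hadd.isExtension
    have hcore : coreSet f.tubes t = coreSet v.tubes t := by
      ext a
      refine and_congr_right fun _ => ⟨fun h t' ht' htt => ?_, fun h t' ht' htt => ?_⟩
      · by_cases hy : t' ∈ y.tubes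
        · exact h t' (by rw [hf]; exact Finset.mem_insert_of_mem hy) htt
        · have h1 := hmin t' (Finset.mem_sdiff.2 ⟨ht', hy⟩)
          have h2 := Finset.card_lt_card htt
          omega
      · exact h t' ((isBooleanAbove G pal).subset hvf ht') htt
    have htv : t ∈ v.tubes ∪ universalTubes G := Finset.mem_union_left _ ht.1
    have hv1 := v.card_tubes_add
    have hv2 : ∑ w ∈ v.tubes ∪ universalTubes G, ((coreSet v.tubes w).ncard - 1) = 0 := by omega
    have hv3 := Finset.sum_eq_zero_iff.1 hv2 t htv
    have hv4 := v.coreSet_nonempty htv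
    rw [← Set.ncard_pos] at hv4
    obtain ⟨a, ha⟩ := Set.ncard_eq_one.1 (show (coreSet v.tubes t).ncard = 1 by omega)
    rw [← hcore, hadd.tubes_eq] at ha
    obtain rfl := hs.eq_nodeTube ha
    have hac : a ∈ coreSet y.tubes s ∩ nodeTube G y.tubes s a := by
      rw [← hs.coreSet_self, ha]
      rfl
    obtain ⟨l, hl⟩ := isNodeFacet_of_addTube hs.isParent.mem
      (two_le_ncard_coreSet_of_addTube hadd hs) hac.1 hadd
    exact ⟨s, a, l, hl⟩
  · exact Or.inl ⟨t, hadd⟩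

/-- Splitting colors off two different tubes does not interfere: both node tubes can be added, and
either of them can be deleted again. -/
theorem joined_of_ne {l l' : List κ} (h : IsNodeFacet f y s a l)
    (h' : IsNodeFacet f' y s' b l') (hne : s' ≠ s) : Joined (Set.Iio y) f f' := by
  have hext := h.isExtension
  have hext' := h'.isExtension
  obtain ⟨l₁, c, rfl, h1, h2⟩ := h'.exists_eq
  have hst : s' ≠ nodeTube G y.tubes s a := hext.ne_of_mem h'.mem
  have hf := h.addTube.tubes_eq
  have hcore : coreSet f.tubes s' = coreSet y.tubes s' := by
    rw [hf, hext.coreSet_of_ne h'.mem hne]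
  have hnode : nodeTube G f.tubes s' b = nodeTube G y.tubes s' b := by
    rw [hf, nodeTube_insert_of_ne hext h'.mem hne]
  have hsf : s' ∈ f.tubes ∪ universalTubes G := by
    rw [hf]
    exact IsExtension.mem_insert h'.mem
  obtain ⟨z, hz, hz1, hz2⟩ := exists_addTube_nodeTube hsf (hcore ▸ h'.two_le) (hcore ▸ h'.mem_core)
    (l := l₁) (c := c) (by
      rw [h.addTube.blocks_of_ne hext hst hne]
      exact h'.isListing)
  rw [hnode] at hz hz2
  obtain ⟨g, hzg, hg⟩ := exists_add_swap (Or.inl h.addTube) (Or.inl hz)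
  have hj := joined_of_add (Or.inl h.addTube) (Or.inl hz) hzg hg
  have hg := hg.resolve_right fun hh => hext'.not_universal hh.2.1
  have hzg := hzg.resolve_right fun hh => hext.not_universal hh.2.1
  obtain ⟨p, hp⟩ := hzg.isExtension
  rw [hg.tubes_eq] at hp
  -- If the tube of `b` were the parent of the tube of `a`, then `s` and `s'` would be the same
  -- tube.
  obtain rfl : p = s := by
    rcases hp.isParent.eq_or_of_insert hext.isParent with e | e
    · exact e
    · subst e
      exact absurd (hp.isParent.eq_of_insert_eq hext.isParent hext').symm hne
  have hb : ∀ w, w ≠ nodeTube G y.tubes p a → w ≠ p → z.blocks w = g.blocks w := by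
    intro w
    exact hzg.blocks_of_ne (hg.tubes_eq ▸ hp)
  have htt : nodeTube G y.tubes s' b ≠ nodeTube G y.tubes p a := by
    intro e
    refine hz.1 ?_
    rw [hf, e]
    exact Finset.mem_insert_self _ _
  rw [hb s' hst hne] at hz1
  rw [hb _ htt (hext'.ne_of_mem h.mem).symm] at hz2
  rwa [hg.eq_of_listing h'.addTube hext' hz1 h1 hz2 h2] at hj

theorem joined_universal_node {l : List κ} (h : AddUniversalTube f y t)
    (h' : IsNodeFacet f' y s b l) : Joined (Set.Iio y) f f' := by
  have hext' := h'.isExtension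
  obtain ⟨l₁, c, rfl, h1, h2⟩ := h'.exists_eq
  have hf := h.tubes_eq
  have hts := y.isTubing.isTube h'.mem
  have hcore : coreSet f.tubes s = coreSet y.tubes s := by
    rw [hf, coreSet_insert_universal h.2.1 hts]
  have hnode : nodeTube G f.tubes s b = nodeTube G y.tubes s b := by
    rw [hf, nodeTube_insert_universal h.2.1 hts]
  have hsf : s ∈ f.tubes ∪ universalTubes G := h.union_eq ▸ h'.mem
  obtain ⟨d, hd⟩ := Option.isSome_iff_exists.1
    ((f.color_isSome t).2 (hf ▸ Finset.mem_insert_self _ _))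
  have hnt : nodeTube G y.tubes s b ≠ t := by
    intro e
    exact hext'.not_universal (e ▸ h.2.1)
  obtain ⟨z, hz, hz1, hz2⟩ := exists_addTube_nodeTube hsf (hcore ▸ h'.two_le) (hcore ▸ h'.mem_core)
    -- If `s` is the universal tube that has been added, its listing now starts with its color `d`;
    -- the last color is still the one that is split off.
    (l := if s = t then d :: l₁ else l₁) (c := c) (by
      by_cases hst : s = t
      · subst hst
        rw [if_pos rfl]
        exact h.listing_cons hd h'.isListing
      · rw [if_neg hst, h.2.2.2.1 s hst]
        exact h'.isListing)
  rw [hnode] at hz hz2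
  obtain ⟨g, hzg, hg⟩ := exists_add_swap (Or.inr h) (Or.inl hz)
  have hj := joined_of_add (Or.inr h) (Or.inl hz) hzg hg
  have hg := hg.resolve_right fun hh => hext'.not_universal hh.2.1
  have hzg := hzg.resolve_left fun hh => hh.2.1 h.2.1
  have hz1 := hzg.listing hz1
  have hz2 := hzg.listing hz2
  rw [if_neg hnt] at hz2
  have hz1 : (g.blocks s).IsListing l₁ := by
    by_cases hst : s = t
    · simpa [hst] using hz1
    · simpa [hst] using hz1
  rwa [hg.eq_of_listing h'.addTube hext' hz1 h1 hz2 h2] at hj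

/-- By `hub`, the universal block has a place for each of the two colors, which may be equal, so
both tubes can be added together. -/
theorem joined_universal_of_ne {c c' : κ} {m : Multiset κ} (h : AddUniversalTube f y t)
    (h' : AddUniversalTube f' y t') (hne : t ≠ t') (hc : (f.blocks t).color = some c)
    (hc' : (f'.blocks t').color = some c') (hub : y.universalBlock = c ::ₘ c' ::ₘ m) :
    Joined (Set.Iio y) f f' := by
  have hfub : f.universalBlock = c' ::ₘ m := by
    obtain ⟨-, -, -, -, d, hd, hdc, -⟩ := h
    obtain rfl : c = d := Option.some_injective _ (hc.symm.trans hdc)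
    rw [hub] at hd
    exact ((Multiset.cons_inj_right _).1 hd).symm
  obtain ⟨z, hz, hzc, -⟩ := exists_addUniversalTube (y := f) h'.2.1 (by
    rw [h.tubes_eq, Finset.mem_insert, not_or]
    exact ⟨hne.symm, h'.1⟩) hfub
  obtain ⟨g, hzg, hg⟩ := exists_add_swap (Or.inr h) (Or.inr hz)
  have hj := joined_of_add (Or.inr h) (Or.inr hz) hzg hg
  have hg := hg.resolve_left fun hh => hh.2.1 h'.2.1
  have hzg := hzg.resolve_left fun hh => hh.2.1 h.2.1
  rw [hzg.2.2.2.1 t' hne.symm] at hzc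
  rwa [hg.eq_of_color h' (hzc.trans hc'.symm)] at hj

/-- With at least two colors in the universal block, at least three universal tubes are missing, so
a third one is available for a detour. -/
theorem joined_universal (h : AddUniversalTube f y t) (h' : AddUniversalTube f' y t')
    (h2 : 2 ≤ y.universalBlock.card) : Joined (Set.Iio y) f f' := by
  have hcol : ∀ {f t}, AddUniversalTube f y t →
      ∃ c, (f.blocks t).color = some c ∧ c ∈ y.universalBlock := by
    rintro f t ⟨-, -, -, -, d, hd, hdc, -⟩
    exact ⟨d, hdc, hd ▸ Multiset.mem_cons_self _ _⟩
  have hother : ∀ t t', ∃ u, u ≠ t ∧ u ≠ t' ∧ IsUniversalTube G u ∧ u ∉ y.tubes := by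
    intro t t'
    have hU := y.card_universalTubes_sdiff
    obtain ⟨u, hu⟩ : (((universalTubes G \ y.tubes).erase t).erase t').Nonempty := by
      rw [← Finset.card_pos]
      have h3 := Finset.pred_card_le_card_erase (s := universalTubes G \ y.tubes) (a := t)
      have h4 := Finset.pred_card_le_card_erase (s := (universalTubes G \ y.tubes).erase t)
        (a := t')
      omega
    rw [Finset.mem_erase, Finset.mem_erase, Finset.mem_sdiff, mem_universalTubes] at hu
    exact ⟨u, hu.2.1, hu.1, hu.2.2.1, hu.2.2.2⟩
  -- There may be only one copy of `c`. Giving another color `d` to a third tube `u` is compatible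
  -- with either facet.
  have hsame : ∀ {f f' t t' c}, AddUniversalTube f y t → AddUniversalTube f' y t' → t ≠ t' →
      (f.blocks t).color = some c → (f'.blocks t').color = some c → Joined (Set.Iio y) f f' := by
    intro f f' t t' c h h' hne hc hc'
    obtain ⟨c', hc1, hcm⟩ := hcol h
    obtain rfl : c = c' := Option.some_injective _ (hc.symm.trans hc1)
    obtain ⟨m, hm⟩ := Multiset.exists_cons_of_mem hcm
    obtain ⟨d, hd⟩ := Multiset.card_pos_iff_exists_mem.1
      (show 0 < m.card by rw [hm, Multiset.card_cons] at h2; omega)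
    obtain ⟨m, rfl⟩ := Multiset.exists_cons_of_mem hd
    obtain ⟨u, hut, hut', hu, huy⟩ := hother t t'
    obtain ⟨g, hg, hgc, -⟩ := exists_addUniversalTube (y := y) hu huy (c := d) (ub := c ::ₘ m)
      (by rw [hm, Multiset.cons_swap])
    exact (joined_universal_of_ne h hg hut.symm hc hgc hm).trans
      (joined_universal_of_ne h' hg hut'.symm hc' hgc hm).symm
  have hdiff : ∀ {f f' t t' c c'}, AddUniversalTube f y t → AddUniversalTube f' y t' → t ≠ t' →
      (f.blocks t).color = some c → (f'.blocks t').color = some c' → Joined (Set.Iio y) f f' := by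
    intro f f' t t' c c' h h' hne hc hc'
    by_cases hcc : c = c'
    · subst hcc
      exact hsame h h' hne hc hc'
    · obtain ⟨d, hd, hdm⟩ := hcol h
      obtain rfl : c = d := Option.some_injective _ (hc.symm.trans hd)
      obtain ⟨d, hd', hdm'⟩ := hcol h'
      obtain rfl : c' = d := Option.some_injective _ (hc'.symm.trans hd')
      obtain ⟨m, hm⟩ := Multiset.exists_cons_of_mem hdm
      rw [hm, Multiset.mem_cons] at hdm'
      obtain ⟨m, rfl⟩ := Multiset.exists_cons_of_mem (hdm'.resolve_left fun e => hcc e.symm)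
      exact joined_universal_of_ne h h' hne hc hc' hm
  obtain ⟨c, hc, hcm⟩ := hcol h
  obtain ⟨c', hc', -⟩ := hcol h'
  by_cases htt : t = t'
  · subst htt
    obtain ⟨u, hut, -, hu, huy⟩ := hother t t
    obtain ⟨m, hm⟩ := Multiset.exists_cons_of_mem hcm
    obtain ⟨g, hg, hgc, -⟩ := exists_addUniversalTube (y := y) hu huy hm
    exact (hdiff h hg hut.symm hc hgc).trans (hdiff h' hg hut.symm hc' hgc).symm
  · exact hdiff h h' htt hc hc'

end Template
end ColorfulGA

namespace ColorfulGA

open scoped Classical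

namespace Template

variable {V : Type u} [Finite V] {κ : Type v} {G : SimpleGraph V} {pal : Multiset κ}
  {f f' g x x' y y' z z' : Template G pal} {s s' t t' w : Finset V} {a b : V}

/-! ### Tubes with a single core node inside the same tube -/

namespace IsNodeFacet

variable {l l' m : List κ} {p r : κ}

theorem ne_nodeTube (h : IsNodeFacet f y s a l) (hw : w ∈ y.tubes ∪ universalTubes G) :
    w ≠ nodeTube G y.tubes s a := h.isExtension.ne_of_mem hw

theorem mem_union (h : IsNodeFacet f y s a l) (hw : w ∈ y.tubes ∪ universalTubes G) :
    w ∈ f.tubes ∪ universalTubes G := h.addTube.tubes_eq ▸ IsExtension.mem_insert hw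

theorem mem_iff (h : IsNodeFacet f y s a l) : s ∈ f.tubes ↔ s ∈ y.tubes := by
  rw [h.addTube.tubes_eq, Finset.mem_insert, or_iff_right (h.ne_nodeTube h.mem)]

theorem coreSet_eq (h : IsNodeFacet f y s a l) : coreSet f.tubes s = coreSet y.tubes s \ {a} := by
  rw [h.addTube.tubes_eq, coreSet_insert_nodeTube h.isExtension h.mem_core]

theorem ncard_coreSet (h : IsNodeFacet f y s a l) :
    (coreSet f.tubes s).ncard + 1 = (coreSet y.tubes s).ncard := by
  rw [h.coreSet_eq, Set.ncard_sdiff_singleton_add_one h.mem_core]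

theorem listings (h : IsNodeFacet f y s a (m ++ [p])) : (f.blocks s).IsListing m ∧
    (f.blocks (nodeTube G y.tubes s a)).IsListing [p] := by
  obtain ⟨l', c, e, h1, h2⟩ := h.exists_eq
  obtain ⟨rfl, e⟩ := List.append_inj' e rfl
  obtain rfl : p = c := by simpa using e
  exact ⟨h1, h2⟩

theorem exists_add_node (h : IsNodeFacet f y s a (m ++ [p] ++ [r]))
    (h3 : 3 ≤ (coreSet y.tubes s).ncard) (hb : b ∈ coreSet y.tubes s) (hab : b ≠ a) :
    ∃ z, AddTube z f (nodeTube G f.tubes s b) ∧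
      IsExtension G f.tubes (nodeTube G f.tubes s b) s ∧ (z.blocks s).IsListing m ∧
      (z.blocks (nodeTube G f.tubes s b)).IsListing [p] ∧
      (z.blocks (nodeTube G y.tubes s a)).IsListing [r] := by
  have hc := h.ncard_coreSet
  have hbf : b ∈ coreSet f.tubes s := by
    rw [h.coreSet_eq]
    exact ⟨hb, hab⟩
  obtain ⟨z, hz, hz1, hz2⟩ := exists_addTube_nodeTube (h.mem_union h.mem) (by omega) hbf
    h.listings.1
  have hext := isExtension_nodeTube f.isTubing (h.mem_union h.mem) hbf (by omega)
  refine ⟨z, hz, hext, hz1, hz2, ?_⟩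
  rw [hz.blocks_of_ne hext]
  · exact h.listings.2
  · intro e
    refine hz.1 (e ▸ ?_)
    rw [h.addTube.tubes_eq]
    exact Finset.mem_insert_self _ _
  · exact (h.ne_nodeTube h.mem).symm

theorem notMem_nodeTube (h : IsNodeFacet f y s a l) (hb : b ∈ coreSet y.tubes s) (hab : b ≠ a) :
    b ∉ nodeTube G y.tubes s a := by
  intro hmem
  have : b ∈ coreSet y.tubes s ∩ nodeTube G y.tubes s a := ⟨hb, hmem⟩
  rw [coreSet_inter_nodeTube h.mem_core] at this
  exact hab this

/-- Both node tubes are added, and the inner one is deleted again. What remains is a single tube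
around `a` and `b` with the list of `p` and `r`; it does not show at which node the construction
started. -/
theorem exists_joined_pair (h : IsNodeFacet f y s a (m ++ [p] ++ [r]))
    (h3 : 3 ≤ (coreSet y.tubes s).ncard) (hb : b ∈ coreSet y.tubes s) (hab : b ≠ a)
    (hadj : CoreAdj G y.tubes s b a) :
    ∃ g, Joined (Set.Iio y) f g ∧ AddTube g y (nodeTube G y.tubes s b ∪ nodeTube G y.tubes s a) ∧
      IsExtension G y.tubes (nodeTube G y.tubes s b ∪ nodeTube G y.tubes s a) s ∧
      (g.blocks s).IsListing m ∧
      (g.blocks (nodeTube G y.tubes s b ∪ nodeTube G y.tubes s a)).IsListing ([p] ++ [r]) := by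
  obtain ⟨z, hz, hext, hz1, hz2, hz3⟩ := h.exists_add_node h3 hb hab
  have hq : nodeTube G f.tubes s b = nodeTube G y.tubes s b ∪ nodeTube G y.tubes s a := by
    rw [h.addTube.tubes_eq, nodeTube_insert_of_adj h.isExtension.isParent.ssubset hadj]
  rw [hq] at hz hext hz2
  obtain ⟨g, hzg, hg⟩ := exists_add_swap (Or.inl h.addTube) (Or.inl hz)
  have hj := joined_of_add (Or.inl h.addTube) (Or.inl hz) hzg hg
  have hg := hg.resolve_right fun hh => hz.2.1 hh.2.1
  have hzg := hzg.resolve_right fun hh => h.addTube.2.1 hh.2.1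
  obtain ⟨s₁, hs₁⟩ := hg.isExtension
  obtain rfl : s = s₁ := by
    have hp := hext.isParent
    rw [h.addTube.tubes_eq] at hp
    exact (hp.eq_or_of_insert hs₁.isParent).resolve_right (h.ne_nodeTube h.mem)
  obtain ⟨s₂, hs₂⟩ := hzg.isExtension
  have hs₂' := hs₂.isParent
  rw [hg.tubes_eq] at hs₂'
  have hss : nodeTube G y.tubes s a ⊂ nodeTube G y.tubes s b ∪ nodeTube G y.tubes s a :=
    Finset.ssubset_iff_subset_ne.2 ⟨Finset.subset_union_right, fun e =>
      h.notMem_nodeTube hb hab (e ▸ Finset.mem_union_left _ self_mem_nodeTube)⟩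
  have hsub := hs₂'.subset _ IsExtension.mem_self hss
  -- The tube of `a` now lies inside the joint tube, which is strictly smaller than `s`, so `s`
  -- cannot be its parent.
  have hs₂q := (hs₂'.eq_or_of_insert h.isExtension.isParent).resolve_left fun e =>
    hs₁.isParent.ssubset.2 (e.symm.subset.trans hsub)
  subst hs₂q
  refine ⟨g, hj, hg, hs₁, ?_, hzg.listing hs₂ hz2 hz3⟩
  rwa [← hzg.blocks_of_ne hs₂ (h.ne_nodeTube h.mem) (hs₁.ne_of_mem h.mem)]

/-- The faces that `exists_joined_pair` provides for `a`, `b` and for `b`, `a` coincide. -/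
theorem joined_of_coreAdj (h : IsNodeFacet f y s a l) (h' : IsNodeFacet f' y s b l)
    (h3 : 3 ≤ (coreSet y.tubes s).ncard) (hab : b ≠ a) (hadj : CoreAdj G y.tubes s b a) :
    Joined (Set.Iio y) f f' := by
  obtain ⟨l', r, rfl, -⟩ := h.exists_eq
  have hlen := y.length_listing h.mem h.isListing
  obtain ⟨m, p, rfl⟩ : ∃ m p, l' = m ++ [p] := by
    have hne : l' ≠ [] := by
      rintro rfl
      simp at hlen
      split_ifs at hlen <;> omega
    exact ⟨l'.dropLast, l'.getLast hne, (List.dropLast_append_getLast hne).symm⟩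
  obtain ⟨g, hj, hg, hext, hg1, hg2⟩ := h.exists_joined_pair h3 h'.mem_core hab hadj
  obtain ⟨g', hj', hg', hext', hg1', hg2'⟩ :=
    h'.exists_joined_pair h3 h.mem_core hab.symm hadj.symm
  rw [Finset.union_comm] at hg' hg2'
  rw [hg.eq_of_listing hg' hext hg1 hg1' hg2 hg2'] at hj
  exact hj.trans hj'.symm

/-- Both node tubes have the parent `s`. The first one added takes `r` and the second takes `p`;
when the first is deleted, `r` returns to the end of the listing of `s`. Passing to a nonadjacent
node thus exchanges the last two colors. -/
theorem joined_of_not_coreAdj (h : IsNodeFacet f y s a (m ++ [p] ++ [r]))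
    (h3 : 3 ≤ (coreSet y.tubes s).ncard) (hb : b ∈ coreSet y.tubes s) (hab : b ≠ a)
    (hadj : ¬ CoreAdj G y.tubes s b a) :
    ∃ g, Joined (Set.Iio y) f g ∧ IsNodeFacet g y s b (m ++ [r] ++ [p]) := by
  obtain ⟨z, hz, hext, hz1, hz2, hz3⟩ := h.exists_add_node h3 hb hab
  have hq : nodeTube G f.tubes s b = nodeTube G y.tubes s b := by
    rw [h.addTube.tubes_eq, nodeTube_insert_of_not_adj hadj]
  rw [hq] at hz hext hz2
  obtain ⟨g, hzg, hg⟩ := exists_add_swap (Or.inl h.addTube) (Or.inl hz)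
  have hj := joined_of_add (Or.inl h.addTube) (Or.inl hz) hzg hg
  have hg := hg.resolve_right fun hh => hz.2.1 hh.2.1
  have hzg := hzg.resolve_right fun hh => h.addTube.2.1 hh.2.1
  obtain ⟨s₂, hs₂⟩ := hzg.isExtension
  have hs₂' := hs₂.isParent
  rw [hg.tubes_eq] at hs₂'
  have hs₂s := (hs₂'.eq_or_of_insert h.isExtension.isParent).resolve_right fun e => by
    have ha : a ∈ coreSet y.tubes s ∩ nodeTube G y.tubes s b :=
      ⟨h.mem_core, e ▸ hs₂'.ssubset.1 self_mem_nodeTube⟩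
    rw [coreSet_inter_nodeTube hb] at ha
    exact hab ha.symm
  subst hs₂s
  refine ⟨g, hj, h.mem, h.two_le, hb, hg, _, _, rfl, hzg.listing hs₂ hz1 hz3, ?_⟩
  rwa [← hzg.blocks_of_ne hs₂ ?_ (hext.ne_of_mem (h.mem_union h.mem)).symm]
  intro e
  refine hz.1 (e ▸ ?_)
  rw [h.addTube.tubes_eq]
  exact Finset.mem_insert_self _ _

/-- The core of `s` is connected, so steps between adjacent nodes reach every core node with the
listing unchanged. -/
theorem joined_of_listing_eq (h : IsNodeFacet f y s a l) (h' : IsNodeFacet f' y s b l)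
    (h3 : 3 ≤ (coreSet y.tubes s).ncard) : Joined (Set.Iio y) f f' := by
  by_contra hcon
  refine not_isCut_coreSet y.isTubing h.mem
    ⟨{c | c ∈ coreSet y.tubes s ∧ ∀ g, IsNodeFacet g y s c l → Joined (Set.Iio y) f g},
      {c | c ∈ coreSet y.tubes s ∧ ¬ ∀ g, IsNodeFacet g y s c l → Joined (Set.Iio y) f g},
      ⟨a, h.mem_core, fun g hg => h.eq hg ▸ Joined.refl _ _⟩,
      ⟨b, h'.mem_core, fun hh => hcon (hh f' h')⟩, ?_, ?_⟩
  · ext c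
    simp only [Set.mem_union, Set.mem_ofPred_eq]
    tauto
  · rintro c ⟨hc, hcj⟩ d ⟨hd, hdj⟩
    obtain ⟨g, hg⟩ := exists_isNodeFacet h.mem h.two_le hc h.isListing
    have hne : c ≠ d := by
      rintro rfl
      exact hdj hcj
    exact ⟨hne, fun hcd => hdj fun g' hg' => (hcj g hg).trans
      (hg.joined_of_coreAdj hg' h3 hne.symm hcd.symm)⟩

end IsNodeFacet

theorem isListing_swap {b : Blocks κ} {m n : List κ} {p r : κ}
    (h : b.IsListing (m ++ p :: r :: n)) (hm : b.prefixLength ≤ m.length) :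
    b.IsListing (m ++ r :: p :: n) := by
  rw [h.iff]
  refine ⟨(List.perm_append_left_iff _).2 (List.Perm.swap _ _ _), ?_⟩
  rw [List.take_append_of_le_length hm, List.take_append_of_le_length hm]

namespace IsNodeFacet

variable {l l' m n : List κ} {p r : κ}

/-- The two colors are inner colors. If they are the last two, the exchange comes from a pair of
nonadjacent nodes. Otherwise the last color is split off at a node whose removal leaves both of them
in the inner block, where their order is immaterial. -/
theorem joined_of_swap (h : IsNodeFacet f y s a (m ++ p :: r :: n))
    (h' : IsNodeFacet f' y s b (m ++ r :: p :: n)) (h3 : 3 ≤ (coreSet y.tubes s).ncard)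
    (hm : (y.blocks s).prefixLength ≤ m.length) : Joined (Set.Iio y) f f' := by
  have hlen := y.length_listing h.mem h.isListing
  have hpre := y.prefixLength_eq h.mem
  simp only [List.length_append, List.length_cons] at hlen
  -- The size of `S` is chosen so that the core nodes outside it are as many as the colors `p`, `r`
  -- and those of `n`. By `hm` it is at least the connectivity.
  obtain ⟨S, hS, hSc, A, B, ⟨a', ha'⟩, ⟨b', hb'⟩, hAB, hcut⟩ :=
    exists_isCut (G := G) (T := y.tubes) (s := s)
      (j := m.length - (if s ∈ y.tubes then 1 else 0) + 1) (by omega) (by omega)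
  have hA : ∀ {c}, c ∈ A → c ∈ coreSet y.tubes s \ S := fun hc => hAB ▸ Or.inl hc
  have hB : ∀ {c}, c ∈ B → c ∈ coreSet y.tubes s \ S := fun hc => hAB ▸ Or.inr hc
  -- If `n` is empty, exactly two nodes remain outside `S`, and they are not adjacent.
  rcases List.eq_nil_or_concat n with rfl | ⟨n, c, rfl⟩
  · have e : ∀ p r : κ, m ++ [p, r] = m ++ [p] ++ [r] := by simp
    obtain ⟨g, hg⟩ := exists_isNodeFacet h.mem h.two_le (hA ha').1 h.isListing
    have hg' := hg
    rw [e] at hg'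
    obtain ⟨g', hj, hg'⟩ := hg'.joined_of_not_coreAdj h3 (hB hb').1 (hcut _ ha' _ hb').1.symm
      fun hh => (hcut _ ha' _ hb').2 hh.symm
    rw [← e] at hg'
    exact (h.joined_of_listing_eq hg h3).trans (hj.trans (hg'.joined_of_listing_eq h' h3))
  -- A node outside `S` that can be removed while both sides of the cut stay nonempty.
  · obtain ⟨e, he, heS⟩ : ∃ e ∈ coreSet y.tubes s, e ∉ insert a' (insert b' S) := by
      refine Set.exists_mem_notMem_of_ncard_lt_ncard ?_
      have h1 := Set.ncard_insert_le a' (insert b' S)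
      have h2 := Set.ncard_insert_le b' S
      simp only [List.concat_eq_append, List.length_append, List.length_singleton] at hlen
      omega
    simp only [Set.mem_insert_iff, not_or] at heS
    obtain ⟨g, hg⟩ := exists_isNodeFacet h.mem h.two_le he h.isListing
    have e1 : m ++ p :: r :: n.concat c = m ++ p :: r :: n ++ [c] := by simp
    have e2 : m ++ r :: p :: n.concat c = m ++ r :: p :: n ++ [c] := by simp
    have hgl := hg
    rw [e1] at hgl
    -- Adding the tube of `e` only links neighbors of `e`, and these do not lie on both sides of the
    -- cut; so `S` still cuts the core.
    have hconn : conn G g.tubes s ≤ S.ncard := by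
      have hce := hg.coreSet_eq
      refine conn_le (fun c hc => hce ▸ ⟨hS hc, fun hce' => heS.2.2 (hce' ▸ hc)⟩) (Or.inl
        ⟨A \ {e}, B \ {e}, ⟨a', ha', Ne.symm heS.1⟩, ⟨b', hb', Ne.symm heS.2.1⟩, ?_, ?_⟩)
      · rw [hce, ← Set.union_sdiff_distrib, hAB, Set.sdiff_sdiff_comm]
      · rintro c ⟨hc, -⟩ d ⟨hd, -⟩
        refine ⟨(hcut c hc d hd).1, ?_⟩
        rw [hg.addTube.tubes_eq, IsExtension.coreAdj_insert hg.isExtension.isParent.ssubset,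
          exists_adj_nodeTube_iff, exists_adj_nodeTube_iff]
        rintro (hh | ⟨hce, hde⟩)
        · exact (hcut c hc d hd).2 hh
        · have heAB : e ∈ A ∪ B := hAB ▸ ⟨he, heS.2.2⟩
          rcases heAB with heA | heB
          · exact (hcut e heA d hd).2 hde.symm
          · exact (hcut c hc e heB).2 hce
    have hgpre := g.prefixLength_eq (hg.mem_union hg.mem)
    rw [if_congr hg.mem_iff rfl rfl] at hgpre
    -- The same facet belongs to both listings of `s`.
    have hg' : IsNodeFacet g y s e (m ++ r :: p :: n.concat c) :=
      ⟨hg.mem, hg.two_le, he, hg.addTube, _, _, e2,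
        isListing_swap hgl.listings.1 (by omega), hgl.listings.2⟩
    exact (h.joined_of_listing_eq hg h3).trans (hg'.joined_of_listing_eq h' h3)

/-- Adjacent exchanges generate all permutations of the inner colors; `m` collects the colors in
front that already agree. -/
theorem joined_of_perm (hl : l.Perm l') (h3 : 3 ≤ (coreSet y.tubes s).ncard) {f f' a b m}
    (hm : (y.blocks s).prefixLength ≤ m.length)
    (h : IsNodeFacet f y s a (m ++ l)) (h' : IsNodeFacet f' y s b (m ++ l')) :
    Joined (Set.Iio y) f f' := by
  induction hl generalizing f f' a b m with
  | nil => exact h.joined_of_listing_eq h' h3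
  | cons c _ ih =>
    refine ih (m := m ++ [c]) ?_ (by simpa using h) (by simpa using h')
    rw [List.length_append]
    omega
  | swap p r n => exact h.joined_of_swap h' h3 hm
  | trans hp _ ih ih' =>
    rename_i l₁ l₂ l₃ _
    have hl₂ : (y.blocks s).IsListing (m ++ l₂) := by
      rw [h.isListing.iff, List.perm_append_left_iff, List.take_append_of_le_length hm,
        List.take_append_of_le_length hm]
      exact ⟨hp.symm, rfl⟩
    obtain ⟨g, hg⟩ := exists_isNodeFacet h.mem h.two_le h.mem_core hl₂
    exact (ih hm h hg).trans (ih' hm hg h')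

theorem joined_of_eq (h : IsNodeFacet f y s a l) (h' : IsNodeFacet f' y s b l')
    (h3 : 3 ≤ (coreSet y.tubes s).ncard) : Joined (Set.Iio y) f f' := by
  obtain ⟨hp, ht⟩ := h.isListing.iff.1 h'.isListing
  rw [← List.take_append_drop (y.blocks s).prefixLength l] at h
  rw [← List.take_append_drop (y.blocks s).prefixLength l', ht] at h'
  have hlen := h.isListing.length_eq
  refine joined_of_perm ?_ h3 ?_ h h'
  · rw [← List.perm_append_left_iff (l.take (y.blocks s).prefixLength), List.take_append_drop, ← ht,
      List.take_append_drop]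
    exact hp.symm
  · rw [List.take_append_drop] at hlen
    rw [List.length_take]
    omega

end IsNodeFacet

/-! ### Connectedness of the faces below a given one -/

/-- If `s` has only two core nodes, its facets cannot be joined by moves at `s` alone. As `y` has
rank at least 2, there is another movable color, and a facet that uses it is joined to both. -/
theorem joined_node_node {l l' : List κ} (hy : y.tubes.card + 2 ≤ pal.card)
    (h : IsNodeFacet f y s a l) (h' : IsNodeFacet f' y s' b l') : Joined (Set.Iio y) f f' := by
  by_cases hss : s' = s
  · subst hss
    by_cases h3 : 3 ≤ (coreSet y.tubes s').ncard
    · exact h.joined_of_eq h' h3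
    · have hc := y.card_tubes_add
      have h2 := h.two_le
      rw [← Finset.add_sum_erase _ _ h.mem] at hc
      by_cases hub : y.universalBlock = 0
      · rw [hub, Multiset.card_zero] at hc
        obtain ⟨w, hw, hwc⟩ := Finset.exists_ne_zero_of_sum_ne_zero
          (s := (y.tubes ∪ universalTubes G).erase s')
          (f := fun w => (coreSet y.tubes w).ncard - 1) (by omega)
        rw [Finset.mem_erase] at hw
        have hw2 : 2 ≤ (coreSet y.tubes w).ncard := by omega
        obtain ⟨c, hcw⟩ := y.coreSet_nonempty hw.2
        obtain ⟨l₀, hl₀⟩ := (y.blocks w).exists_isListing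
        obtain ⟨g, hg⟩ := exists_isNodeFacet hw.2 hw2 hcw hl₀
        exact (joined_of_ne h hg hw.1).trans (joined_of_ne h' hg hw.1).symm
      · obtain ⟨c, hcu⟩ := Multiset.exists_mem_of_ne_zero hub
        obtain ⟨ub, hub⟩ := Multiset.exists_cons_of_mem hcu
        obtain ⟨u, hu⟩ : (universalTubes G \ y.tubes).Nonempty := by
          rw [← Finset.card_pos, y.card_universalTubes_sdiff]
          omega
        rw [Finset.mem_sdiff, mem_universalTubes] at hu
        obtain ⟨g, hg, -⟩ := exists_addUniversalTube hu.1 hu.2 hub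
        exact (joined_universal_node hg h).symm.trans (joined_universal_node hg h')
  · exact joined_of_ne h h' hss

theorem joined_universal_universal (hy : y.tubes.card + 2 ≤ pal.card)
    (h : AddUniversalTube f y t) (h' : AddUniversalTube f' y t') : Joined (Set.Iio y) f f' := by
  by_cases hub : 2 ≤ y.universalBlock.card
  · exact joined_universal h h' hub
  · have hc := y.card_tubes_add
    obtain ⟨w, hw, hwc⟩ := Finset.exists_ne_zero_of_sum_ne_zero
      (s := y.tubes ∪ universalTubes G)
      (f := fun w => (coreSet y.tubes w).ncard - 1) (by omega)
    have hw2 : 2 ≤ (coreSet y.tubes w).ncard := by omega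
    obtain ⟨c, hcw⟩ := y.coreSet_nonempty hw
    obtain ⟨l₀, hl₀⟩ := (y.blocks w).exists_isListing
    obtain ⟨g, hg⟩ := exists_isNodeFacet hw hw2 hcw hl₀
    exact (joined_universal_node h hg).trans (joined_universal_node h' hg).symm

theorem joined_Iio (hy : y.tubes.card + 2 ≤ pal.card) (hx : x < y) (hx' : x' < y) :
    Joined (Set.Iio y) x x' := by
  obtain ⟨f, hj, hf⟩ := exists_joined_facet hx
  obtain ⟨f', hj', hf'⟩ := exists_joined_facet hx'
  refine hj.trans (Joined.trans ?_ hj'.symm)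
  rcases hf with ⟨t, ht⟩ | ⟨s, a, l, hl⟩ <;> rcases hf' with ⟨t', ht'⟩ | ⟨s', a', l', hl'⟩
  · exact joined_universal_universal hy ht ht'
  · exact joined_universal_node ht hl'
  · exact (joined_universal_node ht' hl).symm
  · exact joined_node_node hy hl hl'

end Template
end ColorfulGA

namespace ColorfulGA

open scoped Classical

/-! ### Connected components of a poset -/

section Component

variable {P : Type*} [PartialOrder P] {ι : Type*} {T : P → Finset ι} {C : Component P} {x y : P}

theorem mk_eq_of_le (h : x ≤ y) :
    (Quot.mk _ x : Component P) = Quot.mk _ y := Quot.sound h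

namespace IsBooleanAbove

theorem exists_greatest (h : IsBooleanAbove T) (x : P) : ∃ t, x ≤ t ∧ T t = ∅ :=
  h.exists_above x (Finset.empty_subset _)

/-- Two elements are in the same component if and only if they have a common upper bound. -/
theorem mk_eq_mk_iff (h : IsBooleanAbove T) :
    (Quot.mk _ x : Component P) = Quot.mk _ y ↔ ∃ t, x ≤ t ∧ y ≤ t ∧ T t = ∅ := by
  constructor
  · intro hxy
    induction Quot.eqvGen_exact hxy with
    | rel a b hab =>
      obtain ⟨t, ht, ht'⟩ := h.exists_greatest b
      exact ⟨t, hab.trans ht, ht, ht'⟩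
    | refl a =>
      obtain ⟨t, ht, ht'⟩ := h.exists_greatest a
      exact ⟨t, ht, ht, ht'⟩
    | symm a b _ ih =>
      obtain ⟨t, h1, h2, h3⟩ := ih (Quot.eqvGen_sound ‹_›)
      exact ⟨t, h2, h1, h3⟩
    | trans a b c _ _ ih ih' =>
      obtain ⟨t, h1, h2, h3⟩ := ih (Quot.eqvGen_sound ‹_›)
      obtain ⟨t', h1', h2', h3'⟩ := ih' (Quot.eqvGen_sound ‹_›)
      obtain rfl := h.eq_of_eq h2 h1' (h3.trans h3'.symm)
      exact ⟨t, h1, h2', h3⟩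
  · rintro ⟨t, hx, hy, -⟩
    exact (mk_eq_of_le hx).trans (mk_eq_of_le hy).symm

theorem faces (h : IsBooleanAbove T) (C : Component P) :
    IsBooleanAbove fun x : Faces C => T x.1 where
  subset hxy := h.subset hxy
  exists_above x S hS := by
    obtain ⟨y, hxy, hy⟩ := h.exists_above x.1 hS
    exact ⟨⟨y, (mk_eq_of_le hxy).symm.trans x.2⟩, hxy, hy⟩
  le_of_subset hxy hxz hS := h.le_of_subset (x := Subtype.val _) hxy hxz hS

/-- A common upper bound without labels exists for any two members of the component and is
determined by either of them. -/
theorem exists_greatest_faces (h : IsBooleanAbove T) (C : Component P) :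
    ∃ t : Faces C, ∀ x, x ≤ t := by
  obtain ⟨x, hx⟩ := Quot.exists_rep C
  obtain ⟨t, hxt, ht⟩ := h.exists_greatest x
  refine ⟨⟨t, (mk_eq_of_le hxt).symm.trans hx⟩, fun y => ?_⟩
  obtain ⟨t', hyt, hxt', ht'⟩ := h.mk_eq_mk_iff.1 (y.2.trans hx.symm)
  rwa [h.eq_of_eq hxt' hxt (ht'.trans ht.symm)] at hyt

end IsBooleanAbove

theorem Joined.faces {y : Faces C} {a b : Faces C} (h : Joined (Set.Iio y.1) a.1 b.1) :
    Joined (Set.Iio y) a b := by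
  intro S hS
  have key := h (fun c => ∃ hc : Quot.mk _ c = C, S ⟨c, hc⟩) ?_
  · exact ⟨fun ha => (key.1 ⟨a.2, ha⟩).2, fun hb => (key.2 ⟨b.2, hb⟩).2⟩
  · intro c hc d hd hcd
    constructor
    · rintro ⟨hcC, hcS⟩
      have hdC := (mk_eq_of_le hcd).symm.trans hcC
      exact ⟨hdC, (hS ⟨c, hcC⟩ hc ⟨d, hdC⟩ hd hcd).1 hcS⟩
    · rintro ⟨hdC, hdS⟩
      have hcC := (mk_eq_of_le hcd).trans hdC
      exact ⟨hcC, (hS ⟨c, hcC⟩ hc ⟨d, hdC⟩ hd hcd).2 hdS⟩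

theorem image_Iio_faces (y : Faces C) : Subtype.val '' Set.Iio y = Set.Iio y.1 := by
  ext c
  constructor
  · rintro ⟨x, hx, rfl⟩
    exact hx
  · intro hc
    exact ⟨⟨c, (mk_eq_of_le (le_of_lt hc)).trans y.2⟩, hc, rfl⟩

end Component

/-! ### The members of the collection are simple polytopes -/

namespace Template

variable {V : Type u} [Finite V] {κ : Type v} {G : SimpleGraph V} {pal : Multiset κ}

theorem isPolytope_facePoset (C : Component (Template G pal)) :
    IsAbstractPolytope (FacePoset C) pal.card ∧ IsSimplePolytope (FacePoset C) pal.card := by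
  have h := isBooleanAbove G pal
  have hN : ∀ x : Faces C, x.1.tubes.card ≤ pal.card := fun x => x.1.card_tubes_le
  have hlow : ∀ y : Faces C, y.1.tubes.card < pal.card → ∃ x, x < y := by
    intro y hy
    obtain ⟨x, hx⟩ := exists_lt hy
    exact ⟨⟨x, (mk_eq_of_le hx.le).trans y.2⟩, hx⟩
  refine ⟨(h.faces C).isAbstractPolytope hN (h.exists_greatest_faces C) hlow ?_ ?_,
    (h.faces C).isSimplePolytope hN (h.exists_greatest_faces C) hlow⟩
  · intro y hy
    rw [← Set.ncard_image_of_injective _ Subtype.val_injective, image_Iio_faces]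
    exact ncard_Iio_of_card hy
  · intro y hy a ha b hb
    exact (joined_Iio hy ha hb).faces

end Template
end ColorfulGA

namespace ColorfulGA

open scoped Classical

/-! ### Universal tubes as connected components -/

section Tubes

variable {V : Type u} [Finite V] {G : SimpleGraph V} {s t w : Finset V}

/-- The universal tube of a connected component. -/
noncomputable def componentTube (C : G.ConnectedComponent) : Finset V :=
  (Set.toFinite C.supp).toFinset

@[simp]
theorem coe_componentTube (C : G.ConnectedComponent) : (componentTube C : Set V) = C.supp := by
  simp [componentTube]

@[simp]
theorem mem_componentTube {C : G.ConnectedComponent} {v : V} :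
    v ∈ componentTube C ↔ v ∈ C.supp := by
  rw [← coe_componentTube, Finset.mem_coe]

theorem isUniversalTube_componentTube (C : G.ConnectedComponent) :
    IsUniversalTube G (componentTube C) := ⟨C, coe_componentTube C⟩

theorem isUniversalTube_iff : IsUniversalTube G s ↔ ∃ C : G.ConnectedComponent, s = componentTube C := by
  simp only [IsUniversalTube, ← coe_componentTube, Finset.coe_inj]

theorem componentTube_injective :
    Function.Injective (componentTube : G.ConnectedComponent → Finset V) := by
  intro C D h
  rw [← SimpleGraph.ConnectedComponent.supp_inj, ← coe_componentTube, h, coe_componentTube]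

theorem IsTube.subset_componentTube_iff (h : IsTube G s) {v : V} (hv : v ∈ s)
    {C : G.ConnectedComponent} : (s : Set V) ⊆ C.supp ↔ G.connectedComponentMk v = C := by
  constructor
  · intro hs
    exact hs hv
  · intro hC
    rw [← coe_componentTube, Finset.coe_subset]
    exact (isUniversalTube_componentTube C).subset_of_mem h (mem_componentTube.2 hC) hv

theorem componentTube_subset_iff {C D : G.ConnectedComponent} :
    (componentTube C : Set V) ⊆ D.supp ↔ C = D := by
  obtain ⟨v, hv⟩ := (isUniversalTube_componentTube C).isTube.nonempty
  rw [(isUniversalTube_componentTube C).isTube.subset_componentTube_iff hv,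
    show G.connectedComponentMk v = C from mem_componentTube.1 hv]

theorem sum_componentTube {M : Type*} [AddCommMonoid M] {ι : Type*} [Fintype ι]
    (comp : ι ≃ G.ConnectedComponent) (f : Finset V → M) :
    ∑ t ∈ universalTubes G, f t = ∑ i, f (componentTube (comp i)) := by
  refine (Finset.sum_bij (fun i _ => componentTube (comp i)) ?_ ?_ ?_ ?_).symm
  · intro i _
    exact mem_universalTubes.2 (isUniversalTube_componentTube _)
  · intro i _ j _ h
    exact comp.injective (componentTube_injective h)
  · intro t ht
    obtain ⟨C, rfl⟩ := isUniversalTube_iff.1 (mem_universalTubes.1 ht)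
    exact ⟨comp.symm C, Finset.mem_univ _, by simp⟩
  · intro i _
    rfl

theorem sum_sum_filter_subset {M : Type*} [AddCommMonoid M] {ι : Type*} [Fintype ι]
    (comp : ι ≃ G.ConnectedComponent) (f : Finset V → M) {W : Finset (Finset V)}
    (hW : ∀ w ∈ W, IsTube G w) :
    ∑ i, ∑ w ∈ W.filter (fun w : Finset V => (w : Set V) ⊆ (comp i).supp), f w =
      ∑ w ∈ W, f w := by
  simp only [Finset.sum_filter]
  rw [Finset.sum_comm]
  refine Finset.sum_congr rfl fun w hw => ?_
  obtain ⟨v, hv⟩ := (hW w hw).nonempty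
  simp only [(hW w hw).subset_componentTube_iff hv, ← Equiv.symm_apply_eq]
  rw [Finset.sum_ite_eq, if_pos (Finset.mem_univ _)]

end Tubes

namespace Template

variable {V : Type u} [Finite V] {κ : Type v} {G : SimpleGraph V} {pal : Multiset κ}
  {x y : Template G pal} {s t w : Finset V}

/-! ### The colors used in a component -/

/-- Merging appends colors at the end, so the first entry of the listing of the parent stays the
same. -/
theorem AddTube.color_eq (h : AddTube x y t) (hs : IsExtension G y.tubes t s) :
    (x.blocks s).color = (y.blocks s).color := by
  obtain ⟨l₁, i₁, hi₁, rfl⟩ := (x.blocks s).exists_isListing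
  obtain ⟨l₂, hl₂⟩ := (x.blocks t).exists_isListing
  obtain ⟨i, -, hl⟩ := h.listing hs ⟨i₁, hi₁, rfl⟩ hl₂
  have hiff : (x.blocks s).color.isSome ↔ (y.blocks s).color.isSome := by
    rw [x.color_isSome, y.color_isSome, h.tubes_eq, Finset.mem_insert,
      or_iff_right (hs.ne_of_mem hs.isParent.mem)]
  rcases hx : (x.blocks s).color with _ | c <;> rcases hy : (y.blocks s).color with _ | c'
  · rfl
  · simp [hx, hy] at hiff
  · simp [hx, hy] at hiff
  · simp only [hx, hy, Option.toList_some, List.cons_append, List.cons.injEq] at hl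
    rw [hl.1]

/-- The colors of the blocks of a tube, except for the color of a universal tube. -/
noncomputable def innerColors (x : Template G pal) (t : Finset V) : Multiset κ :=
  if IsUniversalTube G t then (x.blocks t).hidden else (x.blocks t).colors

theorem componentColors_eq (x : Template G pal) (C : G.ConnectedComponent) :
    x.componentColors C =
      ∑ t ∈ (x.tubes ∪ universalTubes G).filter (fun t : Finset V => (t : Set V) ⊆ C.supp),
        x.innerColors t := rfl

theorem innerColors_add_visible (x : Template G pal) (t : Finset V) :
    (if IsUniversalTube G t then (x.blocks t).visible else 0) + x.innerColors t =
      (x.blocks t).colors := by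
  rw [innerColors]
  split_ifs
  · rfl
  · rw [zero_add]

theorem AddTube.innerColors_add (h : AddTube x y t) (hs : IsExtension G y.tubes t s) :
    x.innerColors t + x.innerColors s = y.innerColors s := by
  obtain ⟨l₁, hl₁⟩ := (x.blocks s).exists_isListing
  obtain ⟨l₂, hl₂⟩ := (x.blocks t).exists_isListing
  have hl := (h.listing hs hl₁ hl₂).coe_eq
  rw [← Multiset.coe_add, hl₁.coe_eq, hl₂.coe_eq, ← innerColors_add_visible,
    ← innerColors_add_visible, ← innerColors_add_visible, if_neg h.2.1, zero_add, Blocks.visible,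
    Blocks.visible, h.color_eq hs, add_assoc, add_right_inj, add_comm] at hl
  exact hl

theorem AddTube.innerColors_of_ne (h : AddTube x y t) (hs : IsExtension G y.tubes t s)
    (ht : w ≠ t) (hws : w ≠ s) : x.innerColors w = y.innerColors w := by
  rw [innerColors, innerColors, h.blocks_of_ne hs ht hws]

theorem AddTube.componentColors_eq (h : AddTube x y t) (C : G.ConnectedComponent) :
    x.componentColors C = y.componentColors C := by
  obtain ⟨s, hs⟩ := h.isExtension
  rw [Template.componentColors_eq, Template.componentColors_eq, h.tubes_eq, Finset.insert_union,
    Finset.filter_insert]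
  obtain ⟨v, hv⟩ := hs.isTube.nonempty
  have hsub : (t : Set V) ⊆ C.supp ↔ (s : Set V) ⊆ C.supp := by
    rw [hs.isTube.subset_componentTube_iff hv,
      (y.isTubing.isTube hs.isParent.mem).subset_componentTube_iff (hs.isParent.ssubset.1 hv)]
  by_cases hC : (t : Set V) ⊆ C.supp
  · have hsm : s ∈ (y.tubes ∪ universalTubes G).filter
        (fun t : Finset V => (t : Set V) ⊆ C.supp) :=
      Finset.mem_filter.2 ⟨hs.isParent.mem, hsub.1 hC⟩
    rw [if_pos hC, Finset.sum_insert (fun hm => hs.notMem_union (Finset.mem_filter.1 hm).1),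
      ← Finset.add_sum_erase _ _ hsm, ← Finset.add_sum_erase _ _ hsm, ← add_assoc,
      h.innerColors_add hs]
    congr 1
    refine Finset.sum_congr rfl fun w hw => ?_
    rw [Finset.mem_erase, Finset.mem_filter] at hw
    exact h.innerColors_of_ne hs (hs.ne_of_mem hw.2.1) hw.1
  · rw [if_neg hC]
    refine Finset.sum_congr rfl fun w hw => ?_
    rw [Finset.mem_filter] at hw
    refine h.innerColors_of_ne hs (hs.ne_of_mem hw.1) ?_
    rintro rfl
    exact hC (hsub.2 hw.2)

theorem AddTube.universalBlock_eq (h : AddTube x y t) : x.universalBlock = y.universalBlock := by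
  obtain ⟨-, -, -, -, -, -, -, -, hub, -⟩ := h
  exact hub

theorem AddTube.universalColors_eq (h : AddTube x y t) :
    x.universalColors = y.universalColors := by
  obtain ⟨s, hs⟩ := h.isExtension
  rw [universalColors, universalColors, h.universalBlock_eq]
  congr 1
  refine Finset.sum_congr rfl fun w hw => ?_
  have hwt := hs.ne_of_mem (Finset.mem_union_right y.tubes hw)
  by_cases hws : w = s
  · subst hws
    rw [Blocks.visible, Blocks.visible, h.color_eq hs]
  · rw [h.blocks_of_ne hs hwt hws]

theorem AddUniversalTube.componentColors_eq (h : AddUniversalTube x y t)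
    (C : G.ConnectedComponent) : x.componentColors C = y.componentColors C := by
  rw [Template.componentColors_eq, Template.componentColors_eq, h.union_eq]
  obtain ⟨-, hU, -, hb, c, -, -, ho, hi⟩ := h
  refine Finset.sum_congr rfl fun w hw => ?_
  rw [innerColors, innerColors]
  by_cases hwt : w = t
  · subst hwt
    rw [if_pos hU, if_pos hU, Blocks.hidden, Blocks.hidden, ho, hi]
  · rw [hb w hwt]

theorem AddUniversalTube.universalColors_eq (h : AddUniversalTube x y t) :
    x.universalColors = y.universalColors := by
  have hnone := h.color_eq_none
  obtain ⟨-, hU, -, hb, c, hub, hc, -, -⟩ := h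
  have ht := mem_universalTubes.2 hU
  rw [universalColors, universalColors, ← Finset.add_sum_erase _ _ ht,
    ← Finset.add_sum_erase _ _ ht, hub,
    Finset.sum_congr rfl fun w hw => by rw [hb w (Finset.ne_of_mem_erase hw)]]
  simp only [Blocks.visible, hc, hnone, Option.toList_some, Option.toList_none,
    Multiset.coe_singleton, Multiset.coe_nil, zero_add, ← Multiset.singleton_add]
  abel

theorem componentColors_eq_of_le (h : x ≤ y) (C : G.ConnectedComponent) :
    x.componentColors C = y.componentColors C := by
  induction (show Relation.ReflTransGen Step x y from h) with
  | refl => rfl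
  | tail hxz hzw ih =>
    rw [ih hxz]
    obtain ⟨t, ht | ht⟩ := hzw
    · exact ht.componentColors_eq C
    · exact ht.componentColors_eq C

theorem universalColors_eq_of_le (h : x ≤ y) : x.universalColors = y.universalColors := by
  induction (show Relation.ReflTransGen Step x y from h) with
  | refl => rfl
  | tail hxz hzw ih =>
    rw [ih hxz]
    obtain ⟨t, ht | ht⟩ := hzw
    · exact ht.universalColors_eq
    · exact ht.universalColors_eq

theorem sum_componentColors {ι : Type*} [Fintype ι] (comp : ι ≃ G.ConnectedComponent)
    (x : Template G pal) : ∑ i, x.componentColors (comp i) + x.universalColors = pal := by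
  refine Eq.trans ?_ x.total
  simp only [componentColors_eq]
  rw [sum_sum_filter_subset comp _ fun w hw => x.isTubing.isTube hw, universalColors,
    Finset.sum_congr rfl fun w _ => (x.innerColors_add_visible w).symm, Finset.sum_add_distrib,
    ← Finset.sum_filter, ← add_assoc, add_comm (∑ w ∈ _, x.innerColors w)]
  congr 3
  ext w
  rw [Finset.mem_filter, Finset.mem_union, mem_universalTubes]
  tauto

omit [Finite V] in
theorem coreSet_empty (t : Finset V) : coreSet ∅ t = t := by
  ext v
  simp [coreSet]

theorem componentColors_of_tubes_eq_empty (h : x.tubes = ∅) (C : G.ConnectedComponent) :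
    x.componentColors C = (x.blocks (componentTube C)).hidden := by
  rw [componentColors_eq, h, Finset.empty_union]
  have : (universalTubes G).filter (fun t : Finset V => (t : Set V) ⊆ C.supp) =
      {componentTube C} := by
    ext w
    rw [Finset.mem_filter, mem_universalTubes, isUniversalTube_iff, Finset.mem_singleton]
    constructor
    · rintro ⟨⟨D, rfl⟩, hD⟩
      rw [componentTube_subset_iff.1 hD]
    · rintro rfl
      exact ⟨⟨C, rfl⟩, componentTube_subset_iff.2 rfl⟩
  rw [this, Finset.sum_singleton, innerColors, if_pos (isUniversalTube_componentTube C)]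

theorem universalColors_of_tubes_eq_empty (h : x.tubes = ∅) :
    x.universalColors = x.universalBlock := by
  rw [universalColors, Finset.sum_eq_zero, zero_add]
  intro w _
  have : (x.blocks w).color = none := by
    have := (x.color_isSome w).not.2 (h ▸ Finset.notMem_empty w)
    simpa using this
  rw [Blocks.visible, this]
  rfl

/-- The colors of a component are constant along the order, so they can be counted in the template
without tubes, where they fill the blocks of the universal tube. -/
theorem card_componentColors (x : Template G pal) (C : G.ConnectedComponent) :
    (x.componentColors C).card = C.supp.ncard - 1 := by
  obtain ⟨y, hxy, hy⟩ := (isBooleanAbove G pal).exists_greatest x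
  rw [componentColors_eq_of_le hxy, componentColors_of_tubes_eq_empty hy]
  have := y.inner_card (componentTube C)
    (Finset.mem_union_right _ (mem_universalTubes.2 (isUniversalTube_componentTube C)))
  rw [hy, coreSet_empty, coe_componentTube] at this
  rw [← this, Blocks.hidden, Multiset.card_add, Multiset.coe_card]
  omega

theorem card_universalColors (x : Template G pal) :
    x.universalColors.card + 1 = Nat.card G.ConnectedComponent := by
  obtain ⟨y, hxy, hy⟩ := (isBooleanAbove G pal).exists_greatest x
  rw [universalColors_eq_of_le hxy, universalColors_of_tubes_eq_empty hy, ← y.universalBlock_card,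
    hy]
  simp

/-- The template uses the colors according to the ordered partition `p` of the palette. -/
def HasColors {m : ℕ} {comp : Fin m ≃ G.ConnectedComponent} (p : PalettePartition comp pal)
    (x : Template G pal) : Prop :=
  (∀ i, x.componentColors (comp i) = p.part i) ∧ x.universalColors = p.last

variable {m : ℕ} {comp : Fin m ≃ G.ConnectedComponent} {p : PalettePartition comp pal}

theorem hasColors_iff_of_le (h : x ≤ y) : x.HasColors p ↔ y.HasColors p := by
  simp only [HasColors, componentColors_eq_of_le h, universalColors_eq_of_le h]

/-- All faces of a polytope share a greatest face and hence their color classes, so one face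
decides. -/
theorem mk_mem_subcollection_iff (x : Template G pal) :
    (Quot.mk _ x : Component (Template G pal)) ∈ subcollection p ↔ x.HasColors p := by
  constructor
  · intro h
    exact h ⟨x, rfl⟩
  · intro h y
    obtain ⟨t, hyt, hxt, -⟩ := (isBooleanAbove G pal).mk_eq_mk_iff.1 y.2
    exact (hasColors_iff_of_le hyt).2 ((hasColors_iff_of_le hxt).1 h)

theorem existsUnique_mem_subcollection (comp : Fin m ≃ G.ConnectedComponent)
    (C : Component (Template G pal)) :
    ∃! p : PalettePartition comp pal, C ∈ subcollection p := by
  obtain ⟨x, rfl⟩ := Quot.exists_rep C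
  refine ⟨⟨fun i => x.componentColors (comp i), x.universalColors,
    fun i => x.card_componentColors _, ?_, x.sum_componentColors comp⟩,
    (mk_mem_subcollection_iff x).2 ⟨fun _ => rfl, rfl⟩, fun p hp => ?_⟩
  · have := x.card_universalColors
    rw [← Nat.card_congr comp, Nat.card_fin] at this
    omega
  · replace hp := (mk_mem_subcollection_iff x).1 hp
    exact PalettePartition.ext (funext fun i => (hp.1 i).symm) hp.2.symm

/-- Every ordered partition of the palette is used by some template. -/
theorem exists_hasColors [Nonempty V] (p : PalettePartition comp pal) :
    ∃ x : Template G pal, x.HasColors p := by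
  have hsum : ∀ {w : Finset V}, w ∈ ∅ ∪ universalTubes G → ∃ i, w = componentTube (comp i) := by
    intro w hw
    rw [Finset.empty_union, mem_universalTubes, isUniversalTube_iff] at hw
    obtain ⟨C, rfl⟩ := hw
    exact ⟨comp.symm C, by simp⟩
  have hm : 0 < m := by
    obtain ⟨v⟩ := ‹Nonempty V›
    exact Fin.pos (comp.symm (G.connectedComponentMk v))
  obtain ⟨L, hL⟩ : ∃ L : Finset V → List κ, ∀ i, L (componentTube (comp i)) = (p.part i).toList := by
    refine ⟨fun w => if h : ∃ i, componentTube (comp i) = w then (p.part h.choose).toList else [],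
      fun i => ?_⟩
    have h : ∃ j, componentTube (comp j) = componentTube (comp i) := ⟨i, rfl⟩
    beta_reduce
    rw [dif_pos h, comp.injective (componentTube_injective h.choose_spec)]
  have hex : ∃ x : Template G pal, x.tubes = ∅ ∧ x.universalBlock = p.last ∧ x.Lists L := by
    refine exists_of_lists ⟨by simp, by simp, ?_⟩ L ?_ ?_ _ ?_ ?_
    · exact ⟨_, isUniversalTube_componentTube (comp ⟨0, hm⟩), Finset.notMem_empty _⟩
    · intro w hw
      obtain ⟨i, rfl⟩ := hsum hw
      rw [coreSet_empty, coe_componentTube]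
      exact (comp i).nonempty_supp
    · intro w hw
      obtain ⟨i, rfl⟩ := hsum hw
      have := (Set.ncard_pos (Set.toFinite _)).2 (comp i).nonempty_supp
      rw [hL, coreSet_empty, coe_componentTube, Multiset.length_toList, p.card_part,
        if_neg (Finset.notMem_empty _)]
      omega
    · rw [p.card_last, ← Nat.card_congr comp, Nat.card_fin]
      simp
      omega
    · rw [Finset.empty_union, sum_componentTube comp]
      simp only [hL, Multiset.coe_toList]
      exact p.total
  obtain ⟨x, hx, hub, hxL⟩ := hex
  refine ⟨x, fun i => ?_, by rw [universalColors_of_tubes_eq_empty hx, hub]⟩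
  have h := hxL (componentTube (comp i)) (Finset.mem_union_right _
    (mem_universalTubes.2 (isUniversalTube_componentTube _)))
  have hnone : (x.blocks (componentTube (comp i))).color = none := by
    have := (x.color_isSome (componentTube (comp i))).not.2 (hx ▸ Finset.notMem_empty _)
    simpa using this
  rw [componentColors_of_tubes_eq_empty hx, ← Multiset.coe_toList (p.part i), ← hL, h.coe_eq,
    Blocks.colors, Blocks.visible, hnone]
  simp

end Template
end ColorfulGA

namespace ColorfulGA

open scoped Classical

/-! ### Products of collections -/

/-- If the union of some members of a collection is a product of collections, then these members
correspond to the products of the members of the factors. -/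
theorem exists_equiv_of_orderIso {P R ι κ : Type*} [PartialOrder P] [PartialOrder R]
    {T : P → Finset ι} (hT : IsBooleanAbove T) {κ' : Type*} {TR : R → Finset κ'}
    (hTR : IsBooleanAbove TR) {Q : κ → Type*} [∀ i, PartialOrder (Q i)] {κ'' : κ → Type*}
    {TQ : ∀ i, Q i → Finset (κ'' i)} (hTQ : ∀ i, IsBooleanAbove (TQ i)) (D : Set (Component P))
    (Φ : {x : P // (Quot.mk _ x : Component P) ∈ D} ≃o (∀ i, Q i) × R) :
    ∃ e : D ≃ (∀ i, Component (Q i)) × Component R, ∀ C : D,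
      Nonempty (FacePoset C.1 ≃o WithBot ((∀ i, Faces ((e C).1 i)) × Faces (e C).2)) := by
  -- Components are detected by common upper bounds, and in a product these are found in each factor
  -- separately.
  have key : ∀ x y : {x : P // (Quot.mk _ x : Component P) ∈ D},
      (Quot.mk _ x.1 : Component P) = Quot.mk _ y.1 ↔
        (∀ i, (Quot.mk _ ((Φ x).1 i) : Component (Q i)) = Quot.mk _ ((Φ y).1 i)) ∧
          (Quot.mk _ (Φ x).2 : Component R) = Quot.mk _ (Φ y).2 := by
    intro x y
    constructor
    · intro h
      obtain ⟨t, hx, hy, -⟩ := hT.mk_eq_mk_iff.1 h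
      have htD : (Quot.mk _ t : Component P) ∈ D := mk_eq_of_le hx ▸ x.2
      have hx' : Φ x ≤ Φ ⟨t, htD⟩ := Φ.monotone hx
      have hy' : Φ y ≤ Φ ⟨t, htD⟩ := Φ.monotone hy
      exact ⟨fun i => (mk_eq_of_le (hx'.1 i)).trans (mk_eq_of_le (hy'.1 i)).symm,
        (mk_eq_of_le hx'.2).trans (mk_eq_of_le hy'.2).symm⟩
    · rintro ⟨h1, h2⟩
      choose t hxt hyt _ using fun i => (hTQ i).mk_eq_mk_iff.1 (h1 i)
      obtain ⟨r, hxr, hyr, -⟩ := hTR.mk_eq_mk_iff.1 h2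
      have hx : x ≤ Φ.symm (t, r) := Φ.le_symm_apply.2 ⟨hxt, hxr⟩
      have hy : y ≤ Φ.symm (t, r) := Φ.le_symm_apply.2 ⟨hyt, hyr⟩
      exact (mk_eq_of_le (show x.1 ≤ (Φ.symm (t, r)).1 from hx)).trans
        (mk_eq_of_le (show y.1 ≤ (Φ.symm (t, r)).1 from hy)).symm
  choose rep hrep using fun C : D => Quot.exists_rep C.1
  have hrepD : ∀ C : D, (Quot.mk _ (rep C) : Component P) ∈ D := fun C => (hrep C).symm ▸ C.2
  let f : D → (∀ i, Component (Q i)) × Component R := fun C =>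
    (fun i => Quot.mk _ ((Φ ⟨rep C, hrepD C⟩).1 i), Quot.mk _ (Φ ⟨rep C, hrepD C⟩).2)
  have hf : Function.Bijective f := by
    constructor
    · intro C C' h
      rw [Prod.ext_iff, funext_iff] at h
      exact Subtype.ext ((hrep C).symm.trans
        (((key ⟨rep C, hrepD C⟩ ⟨rep C', hrepD C'⟩).2 h).trans (hrep C')))
    · rintro ⟨q, r⟩
      choose q' hq' using fun i => Quot.exists_rep (q i)
      obtain ⟨r', rfl⟩ := Quot.exists_rep r
      obtain rfl := funext hq'
      refine ⟨⟨Quot.mk _ (Φ.symm (q', r')).1, (Φ.symm (q', r')).2⟩, ?_⟩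
      have := (key ⟨rep ⟨Quot.mk _ (Φ.symm (q', r')).1, (Φ.symm (q', r')).2⟩, hrepD _⟩
        (Φ.symm (q', r'))).1 (hrep ⟨Quot.mk _ (Φ.symm (q', r')).1, (Φ.symm (q', r')).2⟩)
      rw [Φ.apply_symm_apply] at this
      exact Prod.ext (funext this.1) this.2
  refine ⟨Equiv.ofBijective f hf, fun C => ⟨OrderIso.withBotCongr ?_⟩⟩
  have hmem : ∀ x : {x : P // (Quot.mk _ x : Component P) ∈ D},
      (Quot.mk _ x.1 : Component P) = C.1 ↔
        (∀ i, (Quot.mk _ ((Φ x).1 i) : Component (Q i)) = (f C).1 i) ∧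
          (Quot.mk _ (Φ x).2 : Component R) = (f C).2 := by
    intro x
    rw [← key x ⟨rep C, hrepD C⟩, hrep]
  exact
    { toFun := fun x =>
        (fun i => ⟨(Φ ⟨x.1, x.2.symm ▸ C.2⟩).1 i, ((hmem ⟨x.1, x.2.symm ▸ C.2⟩).1 x.2).1 i⟩,
          ⟨(Φ ⟨x.1, x.2.symm ▸ C.2⟩).2, ((hmem ⟨x.1, x.2.symm ▸ C.2⟩).1 x.2).2⟩)
      invFun := fun q => ⟨(Φ.symm (fun i => (q.1 i).1, q.2.1)).1, by
        rw [hmem, Φ.apply_symm_apply]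
        exact ⟨fun i => (q.1 i).2, q.2.2⟩⟩
      left_inv := by
        intro x
        have h := congrArg Subtype.val (Φ.symm_apply_apply ⟨x.1, x.2.symm ▸ C.2⟩)
        exact Subtype.ext h
      right_inv := by
        rintro ⟨q, r⟩
        have h := Φ.apply_symm_apply (fun i => (q i).1, r.1)
        refine Prod.ext (funext fun i => Subtype.ext ?_) (Subtype.ext ?_)
        · exact congrFun (congrArg Prod.fst h) i
        · exact congrArg Prod.snd h
      map_rel_iff' := by
        intro x y
        exact Φ.le_iff_le (x := ⟨x.1, x.2.symm ▸ C.2⟩) (y := ⟨y.1, y.2.symm ▸ C.2⟩) }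

/-! ### Tubes of a connected component -/

/-- `e` identifies `G'` with the connected component `C` of `G`. -/
structure IsComponentEmbedding {V V' : Type u} (G' : SimpleGraph V') (G : SimpleGraph V)
    (C : G.ConnectedComponent) (e : V' ↪ V) : Prop where
  adj_iff : ∀ a b, G'.Adj a b ↔ G.Adj (e a) (e b)
  mem_supp_iff : ∀ v, v ∈ C.supp ↔ ∃ a, e a = v

section Tubes

variable {V V' : Type u} {G : SimpleGraph V} {G' : SimpleGraph V'} {C : G.ConnectedComponent}
  {e : V' ↪ V} {T : Finset (Finset V)} {s t : Finset V'} {w : Finset V}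

/-- This form, free of `ConnectedComponent`, can be transported along an embedding. -/
theorem isUniversalTube_iff_forall_adj {s : Finset V} [Finite V] :
    IsUniversalTube G s ↔ IsTube G s ∧ ∀ a ∈ s, ∀ b, G.Adj a b → b ∈ s := by
  constructor
  · exact fun h => ⟨h.isTube, fun a ha b hab => h.mem_of_adj ha hab⟩
  · rintro ⟨h, hs⟩
    obtain ⟨a, ha⟩ := h.nonempty
    obtain ⟨t, ht, hat⟩ := exists_universalTube_mem G a
    have hst := ht.subset_of_mem h hat ha
    have hts : t ⊆ s := ht.isTube.forall_mem_of_closed {v | v ∈ s} hat ha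
      fun b _ hb c _ hbc => hs b hb c hbc
    rwa [subset_antisymm hst hts]

namespace IsComponentEmbedding

theorem exists_eq_of_adj (h : IsComponentEmbedding G' G C e) {a : V'} {b : V}
    (hab : G.Adj (e a) b) : ∃ b', e b' = b := by
  rw [← h.mem_supp_iff]
  have : e a ∈ C.supp := (h.mem_supp_iff _).2 ⟨a, rfl⟩
  exact (SimpleGraph.ConnectedComponent.connectedComponentMk_eq_of_adj hab).symm.trans this

theorem isTube_map (h : IsComponentEmbedding G' G C e) :
    IsTube G (t.map e) ↔ IsTube G' t := by
  constructor
  · intro ht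
    obtain ⟨_, hv'⟩ := ht.nonempty
    obtain ⟨v, hv, rfl⟩ := Finset.mem_map.1 hv'
    refine isTube_of_forall hv fun X hvX hX b hb => ?_
    have := ht.forall_mem_of_closed (e '' X) (Finset.mem_map_of_mem e hv) ⟨v, hvX, rfl⟩ ?_ (e b)
      (Finset.mem_map_of_mem e hb)
    · obtain ⟨b', hb', hbb⟩ := this
      exact e.injective hbb ▸ hb'
    · rintro _ ha ⟨a, haX, rfl⟩ c hc' hac
      rw [Finset.mem_map' e] at ha
      obtain ⟨c, hc, rfl⟩ := Finset.mem_map.1 hc'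
      exact ⟨c, hX a ha haX c hc ((h.adj_iff _ _).2 hac), rfl⟩
  · intro ht
    obtain ⟨v, hv⟩ := ht.nonempty
    refine isTube_of_forall (Finset.mem_map_of_mem e hv) fun X hvX hX b hb' => ?_
    obtain ⟨b, hb, rfl⟩ := Finset.mem_map.1 hb'
    exact ht.forall_mem_of_closed (e ⁻¹' X) hv hvX (fun a ha haX c hc hac =>
      hX _ (Finset.mem_map_of_mem e ha) haX _ (Finset.mem_map_of_mem e hc)
        ((h.adj_iff _ _).1 hac)) b hb

theorem coe_map_subset (h : IsComponentEmbedding G' G C e) (t : Finset V') :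
    ((t.map e : Finset V) : Set V) ⊆ C.supp := by
  intro v hv
  obtain ⟨a, -, rfl⟩ := Finset.mem_map.1 (Finset.mem_coe.1 hv)
  exact (h.mem_supp_iff _).2 ⟨a, rfl⟩

theorem exists_map_eq (h : IsComponentEmbedding G' G C e) (hw : (w : Set V) ⊆ C.supp) :
    ∃ t : Finset V', t.map e = w := by
  refine ⟨w.preimage e e.injective.injOn, ?_⟩
  ext v
  rw [Finset.mem_map]
  constructor
  · rintro ⟨a, ha, rfl⟩
    exact Finset.mem_preimage.1 ha
  · intro hv
    obtain ⟨a, rfl⟩ := (h.mem_supp_iff v).1 (hw hv)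
    exact ⟨a, Finset.mem_preimage.2 hv, rfl⟩

variable [Finite V] [Finite V']

theorem isUniversalTube_map (h : IsComponentEmbedding G' G C e) :
    IsUniversalTube G (t.map e) ↔ IsUniversalTube G' t := by
  rw [isUniversalTube_iff_forall_adj, isUniversalTube_iff_forall_adj, h.isTube_map]
  refine and_congr_right fun _ => ⟨fun ht a ha b hab => ?_, fun ht a ha' b hab => ?_⟩
  · rw [← Finset.mem_map' e]
    exact ht _ (Finset.mem_map_of_mem e ha) _ ((h.adj_iff _ _).1 hab)
  · obtain ⟨a, ha, rfl⟩ := Finset.mem_map.1 ha'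
    obtain ⟨b, rfl⟩ := h.exists_eq_of_adj hab
    exact Finset.mem_map_of_mem e (ht a ha b ((h.adj_iff _ _).2 hab))

omit [Finite V'] in
theorem isUniversalTube_map_iff_eq (h : IsComponentEmbedding G' G C e) :
    IsUniversalTube G (t.map e) ↔ t.map e = componentTube C := by
  rw [isUniversalTube_iff]
  constructor
  · rintro ⟨D, hD⟩
    have := h.coe_map_subset t
    rw [hD, componentTube_subset_iff] at this
    rw [hD, this]
  · intro ht
    exact ⟨C, ht⟩

/-- The tubes of `T`, other than universal tubes, that are contained in the component. -/
noncomputable def restrictTubes (G : SimpleGraph V) (e : V' ↪ V) (T : Finset (Finset V)) :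
    Finset (Finset V') :=
  (Set.toFinite {t : Finset V' | t.map e ∈ T ∧ ¬ IsUniversalTube G (t.map e)}).toFinset

omit [Finite V] in
theorem mem_restrictTubes :
    t ∈ restrictTubes G e T ↔ t.map e ∈ T ∧ ¬ IsUniversalTube G (t.map e) := by
  simp [restrictTubes]

theorem mem_restrictTubes_union (h : IsComponentEmbedding G' G C e) :
    t ∈ restrictTubes G e T ∪ universalTubes G' ↔ t.map e ∈ T ∪ universalTubes G := by
  rw [Finset.mem_union, Finset.mem_union, mem_restrictTubes, mem_universalTubes,
    mem_universalTubes, h.isUniversalTube_map]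
  tauto

theorem exists_isUniversalTube (h : IsComponentEmbedding G' G C e) :
    ∃ t : Finset V', t.map e = componentTube C ∧ IsUniversalTube G' t := by
  obtain ⟨t, ht⟩ := h.exists_map_eq (coe_componentTube C).subset
  exact ⟨t, ht, h.isUniversalTube_map.1 (h.isUniversalTube_map_iff_eq.2 ht)⟩

theorem isTubing_restrictTubes (h : IsComponentEmbedding G' G C e) (hT : IsTubing G T) :
    IsTubing G' (restrictTubes G e T) where
  tube t ht := h.isTube_map.1 (hT.tube _ (mem_restrictTubes.1 ht).1)
  compatible s hs t ht hne := by
    rcases hT.compatible _ (mem_restrictTubes.1 hs).1 _ (mem_restrictTubes.1 ht).1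
      (fun hst => hne (Finset.map_injective e hst)) with hst | hst | ⟨hst, hadj⟩
    · exact Or.inl (Finset.map_ssubset_map.1 hst)
    · exact Or.inr (Or.inl (Finset.map_ssubset_map.1 hst))
    · refine Or.inr (Or.inr ⟨(Finset.disjoint_map e).1 hst, fun a ha b hb hab => ?_⟩)
      exact hadj _ (Finset.mem_map_of_mem e ha) _ (Finset.mem_map_of_mem e hb)
        ((h.adj_iff _ _).1 hab)
  proper := by
    obtain ⟨t, -, ht⟩ := h.exists_isUniversalTube
    exact ⟨t, ht, fun htT => (mem_restrictTubes.1 htT).2 (h.isUniversalTube_map.2 ht)⟩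

omit [Finite V] in
/-- The tubes of `T` that are properly contained in a tube of the component. -/
theorem mem_and_ssubset_map_iff (h : IsComponentEmbedding G' G C e) (ht : IsTube G' t) :
    w ∈ T ∧ w ⊂ t.map e ↔ ∃ t' ∈ restrictTubes G e T, t' ⊂ t ∧ t'.map e = w := by
  constructor
  · rintro ⟨hw, hwt⟩
    obtain ⟨t', rfl⟩ := h.exists_map_eq ((Finset.coe_subset.2 hwt.1).trans (h.coe_map_subset t))
    exact ⟨t', mem_restrictTubes.2 ⟨hw, fun hU => hU.not_ssubset (h.isTube_map.2 ht) hwt⟩,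
      Finset.map_ssubset_map.1 hwt, rfl⟩
  · rintro ⟨t', ht', htt, rfl⟩
    exact ⟨(mem_restrictTubes.1 ht').1, Finset.map_ssubset_map.2 htt⟩

omit [Finite V] in
theorem coreSet_map (h : IsComponentEmbedding G' G C e) (ht : IsTube G' t) :
    coreSet T (t.map e) = e '' coreSet (restrictTubes G e T) t := by
  ext v
  constructor
  · rintro ⟨hv, hvT⟩
    obtain ⟨a, ha, rfl⟩ := Finset.mem_map.1 hv
    refine ⟨a, ⟨ha, fun t' ht' htt hat => ?_⟩, rfl⟩
    have := (h.mem_and_ssubset_map_iff (T := T) ht).2 ⟨t', ht', htt, rfl⟩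
    exact hvT _ this.1 this.2 (Finset.mem_map_of_mem e hat)
  · rintro ⟨a, ⟨ha, haT⟩, rfl⟩
    refine ⟨Finset.mem_map_of_mem e ha, fun w hw hwt haw => ?_⟩
    obtain ⟨t', ht', htt, rfl⟩ := (h.mem_and_ssubset_map_iff ht).1 ⟨hw, hwt⟩
    exact haT t' ht' htt ((Finset.mem_map' e).1 haw)

omit [Finite V] in
theorem ncard_coreSet_map (h : IsComponentEmbedding G' G C e) (ht : IsTube G' t) :
    (coreSet T (t.map e)).ncard = (coreSet (restrictTubes G e T) t).ncard := by
  rw [h.coreSet_map ht, Set.ncard_image_of_injective _ e.injective]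

omit [Finite V] [Finite V'] in
theorem exists_adj_map (h : IsComponentEmbedding G' G C e) {a : V'} :
    (∃ c ∈ t.map e, G.Adj (e a) c) ↔ ∃ c ∈ t, G'.Adj a c := by
  constructor
  · rintro ⟨_, hc', hac⟩
    obtain ⟨c, hc, rfl⟩ := Finset.mem_map.1 hc'
    exact ⟨c, hc, (h.adj_iff _ _).2 hac⟩
  · rintro ⟨c, hc, hac⟩
    exact ⟨e c, Finset.mem_map_of_mem e hc, (h.adj_iff _ _).1 hac⟩

omit [Finite V] in
theorem coreAdj_map (h : IsComponentEmbedding G' G C e) (ht : IsTube G' t) {a b : V'} :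
    CoreAdj G T (t.map e) (e a) (e b) ↔ CoreAdj G' (restrictTubes G e T) t a b := by
  rw [CoreAdj, CoreAdj, h.adj_iff]
  refine or_congr_right ⟨?_, ?_⟩
  · rintro ⟨w, hw, hwt, ha, hb⟩
    obtain ⟨t', ht', htt, rfl⟩ := (h.mem_and_ssubset_map_iff ht).1 ⟨hw, hwt⟩
    exact ⟨t', ht', htt, h.exists_adj_map.1 ha, h.exists_adj_map.1 hb⟩
  · rintro ⟨t', ht', htt, ha, hb⟩
    have := (h.mem_and_ssubset_map_iff (T := T) ht).2 ⟨t', ht', htt, rfl⟩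
    exact ⟨_, this.1, this.2, h.exists_adj_map.2 ha, h.exists_adj_map.2 hb⟩

omit [Finite V] in
theorem conn_map (h : IsComponentEmbedding G' G C e) (ht : IsTube G' t) :
    conn G T (t.map e) = conn G' (restrictTubes G e T) t :=
  conn_eq_of_image e e.injective (h.coreSet_map ht) fun _ _ _ _ _ => h.coreAdj_map ht

theorem sum_filter_subset (h : IsComponentEmbedding G' G C e) {M : Type*} [AddCommMonoid M]
    (f : Finset V → M) :
    ∑ w ∈ (T ∪ universalTubes G).filter (fun w : Finset V => (w : Set V) ⊆ C.supp), f w =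
      ∑ t ∈ restrictTubes G e T ∪ universalTubes G', f (t.map e) := by
  refine (Finset.sum_bij (fun t _ => t.map e) ?_ ?_ ?_ ?_).symm
  · intro t ht
    exact Finset.mem_filter.2 ⟨h.mem_restrictTubes_union.1 ht, h.coe_map_subset t⟩
  · intro s _ t _ hst
    exact Finset.map_injective e hst
  · intro w hw
    obtain ⟨hw, hwC⟩ := Finset.mem_filter.1 hw
    obtain ⟨t, rfl⟩ := h.exists_map_eq hwC
    exact ⟨t, h.mem_restrictTubes_union.2 hw, rfl⟩
  · intro t _
    rfl

theorem card_connectedComponent (h : IsComponentEmbedding G' G C e) :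
    Nat.card G'.ConnectedComponent = 1 := by
  obtain ⟨t, ht, htU⟩ := h.exists_isUniversalTube
  rw [← card_universalTubes, Finset.card_eq_one]
  refine ⟨t, ?_⟩
  ext s
  rw [mem_universalTubes, Finset.mem_singleton]
  constructor
  · intro hs
    rw [← h.isUniversalTube_map, h.isUniversalTube_map_iff_eq, ← ht] at hs
    exact Finset.map_injective e hs
  · rintro rfl
    exact htU

end IsComponentEmbedding

end Tubes

end ColorfulGA

namespace ColorfulGA

open scoped Classical

/-! ### Tubes of the null graph -/

section NullGraph

variable {ι : Type u} {T : Finset (Finset ι)} {t : Finset ι}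

theorem isTube_bot : IsTube (⊥ : SimpleGraph ι) t ↔ ∃ i, t = {i} := by
  constructor
  · intro h
    obtain ⟨i, hi⟩ := h.nonempty
    refine ⟨i, Finset.eq_singleton_iff_unique_mem.2 ⟨hi, fun j hj => ?_⟩⟩
    exact h.forall_mem_of_closed {j | j = i} hi rfl (fun _ _ _ _ _ hab => absurd hab id) j hj
  · rintro ⟨i, rfl⟩
    refine isTube_of_forall (Finset.mem_singleton_self i) fun X hX _ j hj => ?_
    rw [Finset.mem_singleton.1 hj]
    exact hX

theorem coreSet_singleton (hT : ∀ t ∈ T, t.Nonempty) (i : ι) : coreSet T {i} = {i} := by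
  ext j
  rw [Set.mem_singleton_iff, coreSet, Set.mem_ofPred_eq, Finset.mem_singleton,
    and_iff_left_iff_imp]
  rintro - t ht hti
  exact absurd (Finset.ssubset_singleton_iff.1 hti) (hT t ht).ne_empty

variable [Finite ι]

theorem isUniversalTube_bot : IsUniversalTube (⊥ : SimpleGraph ι) t ↔ ∃ i, t = {i} := by
  rw [isUniversalTube_iff_forall_adj, isTube_bot, and_iff_left_iff_imp]
  rintro - _ _ _ hab
  exact absurd hab id

theorem sum_universalTubes_bot [Fintype ι] {M : Type*} [AddCommMonoid M] (f : Finset ι → M) :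
    ∑ t ∈ universalTubes (⊥ : SimpleGraph ι), f t = ∑ i, f {i} := by
  refine (Finset.sum_bij (fun i _ => {i}) ?_ ?_ ?_ ?_).symm
  · intro i _
    exact mem_universalTubes.2 (isUniversalTube_bot.2 ⟨i, rfl⟩)
  · intro i _ j _ h
    exact Finset.singleton_injective h
  · intro t ht
    obtain ⟨i, rfl⟩ := isUniversalTube_bot.1 (mem_universalTubes.1 ht)
    exact ⟨i, Finset.mem_univ _, rfl⟩
  · intro i _
    rfl

theorem isTubing_bot (hT : ∀ t ∈ T, ∃ i, t = {i}) {i : ι} (hi : {i} ∉ T) :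
    IsTubing (⊥ : SimpleGraph ι) T where
  tube t ht := isTube_bot.2 (hT t ht)
  compatible s hs t ht hne := by
    obtain ⟨i, rfl⟩ := hT s hs
    obtain ⟨j, rfl⟩ := hT t ht
    refine Or.inr (Or.inr ⟨?_, fun _ _ _ _ hab => hab⟩)
    rw [Finset.disjoint_singleton]
    rintro rfl
    exact hne rfl
  proper := ⟨{i}, isUniversalTube_bot.2 ⟨i, rfl⟩, hi⟩

theorem conn_singleton (hT : ∀ t ∈ T, t.Nonempty) (i : ι) : conn (⊥ : SimpleGraph ι) T {i} = 0 := by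
  have := conn_lt_ncard (G := (⊥ : SimpleGraph ι)) (T := T) (s := {i})
    (by rw [coreSet_singleton hT]; exact Set.singleton_nonempty i)
  rw [coreSet_singleton hT, Set.ncard_singleton] at this
  omega

theorem IsTubing.exists_eq_singleton (hT : IsTubing (⊥ : SimpleGraph ι) T)
    (ht : t ∈ T ∪ universalTubes (⊥ : SimpleGraph ι)) : ∃ i, t = {i} :=
  isTube_bot.1 (hT.isTube ht)

theorem IsTubing.union_universalTubes_bot (hT : IsTubing (⊥ : SimpleGraph ι) T) :
    T ∪ universalTubes (⊥ : SimpleGraph ι) = universalTubes ⊥ := by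
  refine Finset.union_eq_right.2 fun t ht => ?_
  rw [mem_universalTubes, isUniversalTube_bot]
  exact hT.exists_eq_singleton (Finset.mem_union_left _ ht)

end NullGraph

/-! ### Connected components as nodes of the null graph -/

section Tubes

variable {V ι : Type*} [Finite V] {G : SimpleGraph V} {comp : ι ≃ G.ConnectedComponent}
  {t : Finset ι} {s : Finset V}

/-- The union of a set of connected components. -/
noncomputable def unionTube (comp : ι ≃ G.ConnectedComponent) (t : Finset ι) : Finset V :=
  t.biUnion fun i => componentTube (comp i)

@[simp]
theorem unionTube_singleton (i : ι) : unionTube comp {i} = componentTube (comp i) :=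
  Finset.singleton_biUnion

/-- A tube lies in a single component, so the unions of several components never occur in a tubing.
-/
theorem exists_eq_singleton_of_isTube_unionTube (h : IsTube G (unionTube comp t)) :
    ∃ i, t = {i} := by
  obtain ⟨v, hv⟩ := h.nonempty
  obtain ⟨i, hi, hvi⟩ := Finset.mem_biUnion.1 hv
  refine ⟨i, Finset.eq_singleton_iff_unique_mem.2 ⟨hi, fun j hj => ?_⟩⟩
  have h1 := (isUniversalTube_componentTube (comp i)).subset_of_mem h hvi hv
  have h2 : componentTube (comp j) ⊆ unionTube comp t :=
    Finset.subset_biUnion_of_mem (fun i => componentTube (comp i)) hj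
  have h3 := Finset.coe_subset.2 (h2.trans h1)
  rw [coe_componentTube (comp i), componentTube_subset_iff] at h3
  exact comp.injective h3

theorem exists_unionTube_of_isUniversalTube (comp : ι ≃ G.ConnectedComponent)
    (h : IsUniversalTube G s) : ∃ i, unionTube comp {i} = s := by
  obtain ⟨C, rfl⟩ := isUniversalTube_iff.1 h
  exact ⟨comp.symm C, by simp⟩

theorem isUniversalTube_unionTube_singleton (i : ι) : IsUniversalTube G (unionTube comp {i}) := by
  rw [unionTube_singleton]
  exact isUniversalTube_componentTube _

theorem unionTube_singleton_injective : Function.Injective fun i => unionTube comp {i} := by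
  intro i j h
  simp only [unionTube_singleton] at h
  exact comp.injective (componentTube_injective h)

theorem exists_map_eq_of_isTube {V : Type u} {V' : ι → Type u} {G : SimpleGraph V}
    {comp : ι ≃ G.ConnectedComponent}
    {G' : ∀ i, SimpleGraph (V' i)} {e : ∀ i, V' i ↪ V}
    (h : ∀ i, IsComponentEmbedding (G' i) G (comp i) (e i)) {w : Finset V} (hw : IsTube G w) :
    ∃ i t, Finset.map (e i) t = w := by
  obtain ⟨v, hv⟩ := hw.nonempty
  refine ⟨comp.symm (G.connectedComponentMk v), (h _).exists_map_eq ?_⟩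
  have hX : ∀ b ∈ w, b ∈ (G.connectedComponentMk v).supp :=
    hw.forall_mem_of_closed (G.connectedComponentMk v).supp hv rfl fun a _ haX b _ hab =>
      (SimpleGraph.ConnectedComponent.connectedComponentMk_eq_of_adj hab).symm.trans haX
  rw [Equiv.apply_symm_apply]
  exact hX

end Tubes

namespace Blocks

variable {κ : Type v}

/-- The blocks without the color of the tube. -/
def uncolor (b : Blocks κ) : Blocks κ := ⟨none, b.outer, b.inner⟩

theorem colors_uncolor (b : Blocks κ) : b.uncolor.colors = b.hidden := by
  rw [colors, visible, uncolor, Option.toList_none, Multiset.coe_nil, zero_add]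
  rfl

theorem isListing_uncolor_iff {b : Blocks κ} {l : List κ} :
    b.IsListing (b.color.toList ++ l) ↔ b.uncolor.IsListing l := by
  constructor
  · rintro ⟨i, hi, hl⟩
    rw [List.append_assoc, List.append_cancel_left_eq] at hl
    exact ⟨i, hi, hl⟩
  · rintro ⟨i, hi, rfl⟩
    exact ⟨i, hi, by simp [uncolor]⟩

theorem IsListing.exists_eq {b : Blocks κ} {l : List κ} (h : b.IsListing l) :
    ∃ l', l = b.color.toList ++ l' ∧ b.uncolor.IsListing l' := by
  obtain ⟨i, hi, rfl⟩ := h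
  exact ⟨b.outer ++ i, by simp, i, hi, by simp [uncolor]⟩

end Blocks

namespace Template

variable {V V' : Type u} [Finite V] [Finite V'] {κ : Type v} {G : SimpleGraph V}
  {G' : SimpleGraph V'} {pal q : Multiset κ} {C : G.ConnectedComponent} {e : V' ↪ V}
  {x y : Template G pal} {w : Finset V} {s t : Finset V'}

/-! ### Restriction of a template to a connected component -/

/-- The blocks of a tube, without the color of a universal tube. -/
noncomputable def innerBlocks (x : Template G pal) (w : Finset V) : Blocks κ :=
  if IsUniversalTube G w then (x.blocks w).uncolor else x.blocks w

theorem innerBlocks_outer (x : Template G pal) (w : Finset V) :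
    (x.innerBlocks w).outer = (x.blocks w).outer := by
  rw [innerBlocks]
  split_ifs <;> rfl

theorem innerBlocks_inner (x : Template G pal) (w : Finset V) :
    (x.innerBlocks w).inner = (x.blocks w).inner := by
  rw [innerBlocks]
  split_ifs <;> rfl

theorem innerBlocks_colors (x : Template G pal) (w : Finset V) :
    (x.innerBlocks w).colors = x.innerColors w := by
  rw [innerBlocks, innerColors]
  split_ifs
  · exact Blocks.colors_uncolor _
  · rfl

theorem AddTube.innerBlocks_of_ne {s t : Finset V} (hxy : AddTube x y t)
    (hs : IsExtension G y.tubes t s) (hwt : w ≠ t) (hws : w ≠ s) :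
    x.innerBlocks w = y.innerBlocks w := by
  rw [innerBlocks, innerBlocks, hxy.blocks_of_ne hs hwt hws]

/-- The restriction of a template to a connected component. -/
noncomputable def restrict (h : IsComponentEmbedding G' G C e) (x : Template G pal)
    (hx : x.componentColors C = q) : Template G' q where
  tubes := IsComponentEmbedding.restrictTubes G e x.tubes
  blocks t := x.innerBlocks (t.map e)
  universalBlock := 0
  isTubing := h.isTubing_restrictTubes x.isTubing
  color_isSome t := by
    rw [IsComponentEmbedding.mem_restrictTubes, innerBlocks, ← x.color_isSome]
    split_ifs with ht
    · simp [ht, Blocks.uncolor]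
    · simp [ht]
  outer_length t ht := by
    have htG := h.mem_restrictTubes_union.1 ht
    have := x.outer_length _ htG
    rw [innerBlocks_outer, this]
    exact congrArg (· - 1) (h.conn_map (h.isTube_map.1 (x.isTubing.isTube htG)))
  inner_card t ht := by
    have htG := h.mem_restrictTubes_union.1 ht
    rw [innerBlocks_outer, innerBlocks_inner, x.inner_card _ htG,
      h.ncard_coreSet_map (h.isTube_map.1 (x.isTubing.isTube htG))]
  blocks_eq t ht := by
    have htG := h.mem_restrictTubes_union.not.1 ht
    rw [innerBlocks, x.blocks_eq _ htG]
    split_ifs <;> rfl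
  -- The graph of the component is connected, so its universal block is empty, and its universal
  -- tube has been left out of the restricted tubing.
  universalBlock_card := by
    rw [h.card_connectedComponent, Multiset.card_zero, zero_add, Nat.add_eq_right,
      Finset.card_eq_zero, ← Finset.disjoint_iff_inter_eq_empty, Finset.disjoint_left]
    intro t ht htU
    exact (IsComponentEmbedding.mem_restrictTubes.1 ht).2
      (h.isUniversalTube_map.2 (mem_universalTubes.1 htU))
  total := by
    rw [add_zero, ← hx, componentColors_eq, h.sum_filter_subset]
    exact Finset.sum_congr rfl fun t _ => x.innerBlocks_colors _

variable (h : IsComponentEmbedding G' G C e) (hx : x.componentColors C = q)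
  (hy : y.componentColors C = q)

include h

theorem restrict_eq_of_forall (ht : ∀ t : Finset V', ¬ IsUniversalTube G (t.map e) →
    (t.map e ∈ x.tubes ↔ t.map e ∈ y.tubes))
    (hb : ∀ t : Finset V', x.innerBlocks (t.map e) = y.innerBlocks (t.map e)) :
    restrict h x hx = restrict h y hy := by
  refine Template.ext ?_ (funext hb) rfl
  ext t
  rw [restrict, restrict, IsComponentEmbedding.mem_restrictTubes,
    IsComponentEmbedding.mem_restrictTubes]
  have := ht t
  tauto

theorem AddTube.restrict_eq (hxy : AddTube x y w) (hw : ¬ (w : Set V) ⊆ C.supp) :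
    restrict h x hx = restrict h y hy := by
  obtain ⟨s, hs⟩ := hxy.isExtension
  have hne : ∀ t : Finset V', t.map e ≠ w := by
    rintro t rfl
    exact hw (h.coe_map_subset t)
  have hne' : ∀ t : Finset V', t.map e ≠ s := by
    rintro t rfl
    exact hw ((Finset.coe_subset.2 hs.isParent.ssubset.1).trans (h.coe_map_subset t))
  refine restrict_eq_of_forall h hx hy (fun t _ => ?_) fun t => ?_
  · rw [hxy.tubes_eq, Finset.mem_insert, or_iff_right (hne t)]
  · rw [innerBlocks, innerBlocks, hxy.blocks_of_ne hs (hne t) (hne' t)]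

theorem AddUniversalTube.restrict_eq (hxy : AddUniversalTube x y w) :
    restrict h x hx = restrict h y hy := by
  refine restrict_eq_of_forall h hx hy (fun t ht => ?_) fun t => ?_
  · rw [hxy.tubes_eq, Finset.mem_insert, or_iff_right]
    rintro rfl
    exact ht hxy.2.1
  · obtain ⟨-, hU, -, hb, c, -, -, ho, hi⟩ := hxy
    rw [innerBlocks, innerBlocks]
    by_cases htw : t.map e = w
    · rw [htw, if_pos hU, if_pos hU, Blocks.uncolor, Blocks.uncolor, ho, hi]
    · rw [hb _ htw]

theorem AddTube.restrict (hxy : AddTube x y (t.map e)) :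
    AddTube (restrict h x hx) (restrict h y hy) t := by
  obtain ⟨p, hp⟩ := hxy.isExtension
  have hcol := hxy.color_eq hp
  obtain ⟨v, hv⟩ := hp.isTube.nonempty
  have hpC : (p : Set V) ⊆ C.supp := by
    rw [(y.isTubing.isTube hp.isParent.mem).subset_componentTube_iff (hp.isParent.ssubset.1 hv),
      ← hp.isTube.subset_componentTube_iff hv]
    exact h.coe_map_subset t
  obtain ⟨s, rfl⟩ := h.exists_map_eq hpC
  obtain ⟨l₁, hl₁⟩ := (x.blocks (s.map e)).exists_isListing
  obtain ⟨l₂, hl₂⟩ := (x.blocks (t.map e)).exists_isListing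
  have hl := hxy.listing hp hl₁ hl₂
  refine ⟨?_, fun hU => hxy.2.1 (h.isUniversalTube_map.2 hU), ?_, s, ?_, ?_, ?_, ?_, rfl, ?_⟩
  · exact fun ht => hxy.1 (IsComponentEmbedding.mem_restrictTubes.1 ht).1
  · ext t'
    rw [Finset.mem_insert, Template.restrict, Template.restrict,
      IsComponentEmbedding.mem_restrictTubes, IsComponentEmbedding.mem_restrictTubes,
      hxy.tubes_eq, Finset.mem_insert, (Finset.map_injective e).eq_iff]
    constructor
    · rintro ⟨h1 | h1, h2⟩
      · exact Or.inl h1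
      · exact Or.inr ⟨h1, h2⟩
    · rintro (rfl | ⟨h1, h2⟩)
      · exact ⟨Or.inl rfl, hxy.2.1⟩
      · exact ⟨Or.inr h1, h2⟩
  · exact h.mem_restrictTubes_union.2 hp.isParent.mem
  · exact Finset.map_ssubset_map.1 hp.isParent.ssubset
  · intro w hw htw
    exact Finset.map_subset_map.1 (hp.isParent.subset _ (h.mem_restrictTubes_union.1 hw)
      (Finset.map_ssubset_map.2 htw))
  · intro w hwt hws
    exact hxy.innerBlocks_of_ne hp (fun e' => hwt (Finset.map_injective e e'))
      (fun e' => hws (Finset.map_injective e e'))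
  · have hb2 : (Template.restrict h x hx).blocks t = x.blocks (t.map e) := if_neg hxy.2.1
    -- If the parent is the whole component, its color, when present, is the common head of the old
    -- and new listings and is cancelled from both.
    by_cases hU : IsUniversalTube G (s.map e)
    · have hbx : (Template.restrict h x hx).blocks s = (x.blocks (s.map e)).uncolor := if_pos hU
      have hby : (Template.restrict h y hy).blocks s = (y.blocks (s.map e)).uncolor := if_pos hU
      obtain ⟨l₁, rfl, hl₁'⟩ := hl₁.exists_eq
      refine ⟨l₁, l₂, hbx ▸ hl₁', hb2 ▸ hl₂, ?_⟩
      rw [hcol, List.append_assoc, Blocks.isListing_uncolor_iff] at hl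
      exact hby ▸ hl
    · have hbx : (Template.restrict h x hx).blocks s = x.blocks (s.map e) := if_neg hU
      have hby : (Template.restrict h y hy).blocks s = y.blocks (s.map e) := if_neg hU
      exact ⟨l₁, l₂, hbx ▸ hl₁, hb2 ▸ hl₂, hby ▸ hl⟩

/-- Adding a universal tube or a tube outside `C` leaves the restriction unchanged; any other step
restricts to a step. -/
theorem restrict_mono (hxy : x ≤ y) : restrict h x hx ≤ restrict h y hy := by
  induction (show Relation.ReflTransGen Step x y from hxy) with
  | refl => exact le_rfl
  | @tail z w hxz hzw ih =>
    have hz : z.componentColors C = q := (componentColors_eq_of_le hxz C).symm.trans hx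
    refine (ih hz hxz).trans ?_
    obtain ⟨t, ht | ht⟩ := hzw
    · by_cases hC : (t : Set V) ⊆ C.supp
      · obtain ⟨t, rfl⟩ := h.exists_map_eq hC
        exact le_of_addAt (Or.inl (ht.restrict h hz hy))
      · exact (ht.restrict_eq h hz hy hC).le
    · exact (ht.restrict_eq h hz hy).le

end Template

namespace Template

/-! ### The universal tubes of a template -/

variable {V : Type u} {ι : Type*} [Finite V] [Finite ι] {κ : Type v} {G : SimpleGraph V}
  {pal q : Multiset κ} {x y : Template G pal} {w : Finset V} {t : Finset ι}

/-- The universal tubes in a tubing. -/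
noncomputable def restrictUniversalTubes (comp : ι ≃ G.ConnectedComponent)
    (T : Finset (Finset V)) : Finset (Finset ι) :=
  (Set.toFinite {t : Finset ι | unionTube comp t ∈ T}).toFinset

theorem mem_restrictUniversalTubes {comp : ι ≃ G.ConnectedComponent} {T : Finset (Finset V)} :
    t ∈ restrictUniversalTubes comp T ↔ unionTube comp t ∈ T := by
  simp [restrictUniversalTubes]

theorem isTubing_restrictUniversalTubes (comp : ι ≃ G.ConnectedComponent) {T : Finset (Finset V)}
    (hT : IsTubing G T) : IsTubing (⊥ : SimpleGraph ι) (restrictUniversalTubes comp T) := by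
  obtain ⟨s, hs, hsT⟩ := hT.proper
  obtain ⟨i, rfl⟩ := exists_unionTube_of_isUniversalTube comp hs
  refine isTubing_bot (fun t ht => ?_) (i := i) fun hi => hsT (mem_restrictUniversalTubes.1 hi)
  exact exists_eq_singleton_of_isTube_unionTube (hT.tube _ (mem_restrictUniversalTubes.1 ht))

theorem card_restrictUniversalTubes (comp : ι ≃ G.ConnectedComponent) (T : Finset (Finset V)) :
    (restrictUniversalTubes comp T ∩ universalTubes (⊥ : SimpleGraph ι)).card =
      (T ∩ universalTubes G).card := by
  refine Finset.card_bij (fun t _ => unionTube comp t) ?_ ?_ ?_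
  · intro t ht
    rw [Finset.mem_inter, mem_restrictUniversalTubes, mem_universalTubes,
      isUniversalTube_bot] at ht
    obtain ⟨ht, i, rfl⟩ := ht
    exact Finset.mem_inter.2
      ⟨ht, mem_universalTubes.2 (isUniversalTube_unionTube_singleton i)⟩
  · intro s hs t ht hst
    rw [Finset.mem_inter, mem_universalTubes, isUniversalTube_bot] at hs ht
    obtain ⟨-, i, rfl⟩ := hs
    obtain ⟨-, j, rfl⟩ := ht
    rw [unionTube_singleton_injective hst]
  · intro w hw
    rw [Finset.mem_inter, mem_universalTubes] at hw
    obtain ⟨i, rfl⟩ := exists_unionTube_of_isUniversalTube comp hw.2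
    exact ⟨{i}, Finset.mem_inter.2 ⟨mem_restrictUniversalTubes.2 hw.1,
      mem_universalTubes.2 (isUniversalTube_bot.2 ⟨i, rfl⟩)⟩, rfl⟩

theorem card_connectedComponent_bot :
    Nat.card (⊥ : SimpleGraph ι).ConnectedComponent = Nat.card ι := by
  have := Fintype.ofFinite ι
  rw [← card_universalTubes, Finset.card_eq_sum_ones, sum_universalTubes_bot]
  simp

/-- The colors of the universal tubes of a template, together with the universal block, form a
template of the null graph on the set of connected components. -/
noncomputable def restrictUniversal (comp : ι ≃ G.ConnectedComponent) (x : Template G pal)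
    (hx : x.universalColors = q) : Template (⊥ : SimpleGraph ι) q where
  tubes := restrictUniversalTubes comp x.tubes
  blocks t := ⟨(x.blocks (unionTube comp t)).color, [], 0⟩
  universalBlock := x.universalBlock
  isTubing := isTubing_restrictUniversalTubes comp x.isTubing
  color_isSome t := by
    rw [mem_restrictUniversalTubes]
    exact x.color_isSome _
  outer_length t ht := by
    have hT := isTubing_restrictUniversalTubes comp x.isTubing
    obtain ⟨i, rfl⟩ := hT.exists_eq_singleton ht
    have := conn_singleton (fun t ht => (hT.tube t ht).nonempty) i
    rw [conn] at this
    rw [this]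
    rfl
  inner_card t ht := by
    have hT := isTubing_restrictUniversalTubes comp x.isTubing
    obtain ⟨i, rfl⟩ := hT.exists_eq_singleton ht
    rw [coreSet_singleton (fun t ht => (hT.tube t ht).nonempty), Set.ncard_singleton]
    rfl
  blocks_eq t ht := by
    have : unionTube comp t ∉ x.tubes := fun h =>
      ht (Finset.mem_union_left _ (mem_restrictUniversalTubes.2 h))
    rw [← x.color_isSome] at this
    simpa using this
  universalBlock_card := by
    rw [card_restrictUniversalTubes comp, x.universalBlock_card,
      card_connectedComponent_bot, Nat.card_congr comp]
  total := by
    have := Fintype.ofFinite ι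
    rw [(isTubing_restrictUniversalTubes comp x.isTubing).union_universalTubes_bot,
      sum_universalTubes_bot, ← hx, universalColors, sum_componentTube comp]
    congr 1
    refine Finset.sum_congr rfl fun i _ => ?_
    rw [unionTube_singleton, Blocks.colors, Blocks.hidden, Blocks.visible, Blocks.visible]
    simp

variable (comp : ι ≃ G.ConnectedComponent) (hx : x.universalColors = q)
  (hy : y.universalColors = q)

theorem AddTube.restrictUniversal_eq (hxy : AddTube x y w) :
    restrictUniversal comp x hx = restrictUniversal comp y hy := by
  have hT : restrictUniversalTubes comp x.tubes = restrictUniversalTubes comp y.tubes := by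
    ext t
    rw [mem_restrictUniversalTubes, mem_restrictUniversalTubes, hxy.tubes_eq, Finset.mem_insert,
      or_iff_right]
    rintro rfl
    obtain ⟨s, hs⟩ := hxy.isExtension
    obtain ⟨i, rfl⟩ := exists_eq_singleton_of_isTube_unionTube hs.isTube
    exact hxy.2.1 (isUniversalTube_unionTube_singleton i)
  refine Template.ext hT (funext fun t => Blocks.ext ?_ rfl rfl) hxy.universalBlock_eq
  obtain ⟨s, hs⟩ := hxy.isExtension
  change (x.blocks (unionTube comp t)).color = (y.blocks (unionTube comp t)).color
  by_cases h1 : unionTube comp t = w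
  · subst h1
    obtain ⟨i, rfl⟩ := exists_eq_singleton_of_isTube_unionTube hs.isTube
    exact absurd (isUniversalTube_unionTube_singleton i) hxy.2.1
  · by_cases h2 : unionTube comp t = s
    · rw [h2, hxy.color_eq hs]
    · rw [hxy.blocks_of_ne hs h1 h2]

theorem AddUniversalTube.restrictUniversal {i : ι}
    (hxy : AddUniversalTube x y (unionTube comp {i})) :
    AddUniversalTube (restrictUniversal comp x hx) (restrictUniversal comp y hy) {i} := by
  obtain ⟨h1, h2, h3, h4, c, h5, h6, -, -⟩ := hxy
  have hinj : ∀ {t}, IsTube G (unionTube comp t) → unionTube comp t = unionTube comp {i} →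
      t = {i} := by
    intro t ht hti
    obtain ⟨j, rfl⟩ := exists_eq_singleton_of_isTube_unionTube ht
    rw [unionTube_singleton_injective hti]
  refine ⟨fun h => h1 (mem_restrictUniversalTubes.1 h), isUniversalTube_bot.2 ⟨i, rfl⟩, ?_, ?_, c,
    h5, h6, rfl, rfl⟩
  · ext t
    rw [Finset.mem_insert, Template.restrictUniversal, Template.restrictUniversal,
      mem_restrictUniversalTubes, mem_restrictUniversalTubes, h3, Finset.mem_insert]
    refine or_congr_left ⟨fun h => hinj (h ▸ h2.isTube) h, fun h => h ▸ rfl⟩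
  · intro t ht
    refine Blocks.ext ?_ rfl rfl
    change (x.blocks (unionTube comp t)).color = (y.blocks (unionTube comp t)).color
    rw [h4]
    intro h
    exact ht (hinj (h ▸ h2.isTube) h)

theorem restrictUniversal_mono (hxy : x ≤ y) :
    restrictUniversal comp x hx ≤ restrictUniversal comp y hy := by
  induction (show Relation.ReflTransGen Step x y from hxy) with
  | refl => exact le_rfl
  | @tail z w hxz hzw ih =>
    have hz : z.universalColors = q := (universalColors_eq_of_le hxz).symm.trans hx
    refine (ih hz hxz).trans ?_
    obtain ⟨t, ht | ht⟩ := hzw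
    · exact (ht.restrictUniversal_eq comp hz hy).le
    · obtain ⟨i, rfl⟩ := exists_unionTube_of_isUniversalTube comp ht.2.1
      exact le_of_addAt (Or.inr (ht.restrictUniversal comp hz hy))

end Template
end ColorfulGA

namespace ColorfulGA

open scoped Classical

/-! ### Gluing templates of the components and of the null graph -/

theorem tubesCompatible_of_subset_supp {V : Type*} {G : SimpleGraph V} {s t : Finset V}
    {C D : G.ConnectedComponent} (hs : (s : Set V) ⊆ C.supp) (ht : (t : Set V) ⊆ D.supp)
    (h : C ≠ D) : TubesCompatible G s t := by
  refine Or.inr (Or.inr ⟨Finset.disjoint_left.2 fun a ha ha' => ?_, fun a ha b hb hab => ?_⟩)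
  · exact h ((show _ = C from hs ha).symm.trans (ht ha'))
  · have h1 : G.connectedComponentMk a = C := hs ha
    have h2 : G.connectedComponentMk b = D := ht hb
    exact h (h1.symm.trans
      ((SimpleGraph.ConnectedComponent.connectedComponentMk_eq_of_adj hab).trans h2))

theorem IsComponentEmbedding.tubesCompatible_map {V V' : Type u} {G : SimpleGraph V}
    {G' : SimpleGraph V'} {C : G.ConnectedComponent} {e : V' ↪ V}
    (h : IsComponentEmbedding G' G C e) {s t : Finset V'} (hst : TubesCompatible G' s t) :
    TubesCompatible G (s.map e) (t.map e) := by
  rcases hst with hst | hst | ⟨hst, hadj⟩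
  · exact Or.inl (Finset.map_ssubset_map.2 hst)
  · exact Or.inr (Or.inl (Finset.map_ssubset_map.2 hst))
  · refine Or.inr (Or.inr ⟨(Finset.disjoint_map e).2 hst, fun a ha' b hb' hab => ?_⟩)
    obtain ⟨a, ha, rfl⟩ := Finset.mem_map.1 ha'
    obtain ⟨b, hb, rfl⟩ := Finset.mem_map.1 hb'
    exact hadj a ha b hb ((h.adj_iff _ _).2 hab)

namespace Template

section Component

variable {V V' : Type u} [Finite V] [Finite V'] {κ : Type v} {G : SimpleGraph V}
  {G' : SimpleGraph V'} {q : Multiset κ} {C : G.ConnectedComponent} {e : V' ↪ V} {t : Finset V'}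

theorem card_eq_zero_of_isComponentEmbedding (h : IsComponentEmbedding G' G C e)
    (z : Template G' q) :
    z.universalBlock.card = 0 ∧ (z.tubes ∩ universalTubes G').card = 0 := by
  have := z.universalBlock_card
  rw [h.card_connectedComponent] at this
  omega

theorem notMem_tubes_of_isUniversalTube (h : IsComponentEmbedding G' G C e) (z : Template G' q)
    (ht : IsUniversalTube G' t) : t ∉ z.tubes := by
  intro htz
  have := (card_eq_zero_of_isComponentEmbedding h z).2
  rw [Finset.card_eq_zero] at this
  exact Finset.notMem_empty t (this ▸ Finset.mem_inter.2 ⟨htz, mem_universalTubes.2 ht⟩)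

end Component

theorem blocks_bot {ι : Type*} [Finite ι] {κ : Type v} {r : Multiset κ}
    (z : Template (⊥ : SimpleGraph ι) r) (t : Finset ι) :
    (z.blocks t).outer = [] ∧ (z.blocks t).inner = 0 := by
  by_cases ht : t ∈ z.tubes ∪ universalTubes (⊥ : SimpleGraph ι)
  · obtain ⟨i, rfl⟩ := z.isTubing.exists_eq_singleton ht
    have := z.inner_card _ ht
    rw [coreSet_singleton fun t ht => (z.isTubing.tube t ht).nonempty, Set.ncard_singleton] at this
    rw [← List.length_eq_zero_iff, ← Multiset.card_eq_zero]
    omega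
  · rw [z.blocks_eq t ht]
    exact ⟨rfl, rfl⟩

variable {V : Type u} [Finite V] {κ : Type v} {G : SimpleGraph V} {pal : Multiset κ}
  {ι : Type*} [Finite ι] {comp : ι ≃ G.ConnectedComponent} {V' : ι → Type u}
  [∀ i, Finite (V' i)] {G' : ∀ i, SimpleGraph (V' i)} {e : ∀ i, V' i ↪ V} {q : ι → Multiset κ}
  {r : Multiset κ} {x y : Template G pal}

/-- A template is determined by its restrictions to the components and to the universal tubes. -/
theorem eq_of_restrict_eq (h : ∀ i, IsComponentEmbedding (G' i) G (comp i) (e i))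
    (hx : ∀ i, x.componentColors (comp i) = q i) (hy : ∀ i, y.componentColors (comp i) = q i)
    (hx' : x.universalColors = r) (hy' : y.universalColors = r)
    (hr : ∀ i, restrict (h i) x (hx i) = restrict (h i) y (hy i))
    (hr' : restrictUniversal comp x hx' = restrictUniversal comp y hy') : x = y := by
  have htubes : ∀ {w}, IsTube G w → (w ∈ x.tubes ↔ w ∈ y.tubes) := by
    intro w hw
    obtain ⟨i, t, rfl⟩ := exists_map_eq_of_isTube h hw
    by_cases hU : IsUniversalTube G (t.map (e i))
    · obtain ⟨j, hj⟩ := exists_unionTube_of_isUniversalTube comp hU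
      rw [← hj, ← mem_restrictUniversalTubes, ← mem_restrictUniversalTubes]
      have := congrArg Template.tubes hr'
      exact Finset.ext_iff.1 this {j}
    · have := Finset.ext_iff.1 (congrArg Template.tubes (hr i)) t
      rw [restrict, restrict, IsComponentEmbedding.mem_restrictTubes,
        IsComponentEmbedding.mem_restrictTubes, and_iff_left hU, and_iff_left hU] at this
      exact this
  have ht : x.tubes = y.tubes := by
    ext w
    exact ⟨fun hw => (htubes (x.isTubing.tube w hw)).1 hw,
      fun hw => (htubes (y.isTubing.tube w hw)).2 hw⟩
  have hub := congrArg Template.universalBlock hr'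
  refine Template.ext ht (funext fun w => ?_) hub
  by_cases hw : w ∈ x.tubes ∪ universalTubes G
  · obtain ⟨i, t, rfl⟩ := exists_map_eq_of_isTube h (x.isTubing.isTube hw)
    have hb : x.innerBlocks (t.map (e i)) = y.innerBlocks (t.map (e i)) :=
      congrFun (congrArg Template.blocks (hr i)) t
    by_cases hU : IsUniversalTube G (t.map (e i))
    · refine Blocks.ext ?_ ?_ ?_
      · obtain ⟨j, hj⟩ := exists_unionTube_of_isUniversalTube comp hU
        have hc := congrArg Blocks.color (congrFun (congrArg Template.blocks hr') {j})
        rw [← hj]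
        exact hc
      · rw [← innerBlocks_outer, hb, innerBlocks_outer]
      · rw [← innerBlocks_inner, hb, innerBlocks_inner]
    · rwa [innerBlocks, innerBlocks, if_neg hU, if_neg hU] at hb
  · rw [x.blocks_eq w hw, y.blocks_eq w (ht ▸ hw)]

/-- Templates of the components and of the null graph can be glued. -/
theorem exists_restrict_eq [Fintype ι] (h : ∀ i, IsComponentEmbedding (G' i) G (comp i) (e i))
    (z : ∀ i, Template (G' i) (q i)) (z₀ : Template (⊥ : SimpleGraph ι) r)
    (hpal : ∑ i, q i + r = pal) :
    ∃ (x : Template G pal) (hq : ∀ i, x.componentColors (comp i) = q i)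
      (hr : x.universalColors = r), (∀ i, restrict (h i) x (hq i) = z i) ∧
        restrictUniversal comp x hr = z₀ := by
  -- Non-universal tubes come from the components, universal ones from the null graph.
  obtain ⟨T, hT⟩ : ∃ T : Finset (Finset V), ∀ w, w ∈ T ↔
      (∃ i, ∃ t ∈ (z i).tubes, t.map (e i) = w) ∨ ∃ j, {j} ∈ z₀.tubes ∧ unionTube comp {j} = w :=
    ⟨(Set.toFinite {w : Finset V | (∃ i, ∃ t ∈ (z i).tubes, t.map (e i) = w) ∨
      ∃ j, {j} ∈ z₀.tubes ∧ unionTube comp {j} = w}).toFinset, fun w => by simp⟩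
  -- A nonempty set of nodes lies in at most one component, so its index and its preimage are
  -- determined. This makes the definition of the blocks unambiguous.
  have hmap : ∀ {i j} {t : Finset (V' i)} {t' : Finset (V' j)}, t.Nonempty →
      t'.map (e j) = t.map (e i) → ∃ hij : j = i, hij ▸ t' = t := by
    intro i j t t' ht htt
    obtain ⟨a, ha⟩ := ht
    have h1 : G.connectedComponentMk (e i a) = comp i :=
      (h i).coe_map_subset t (Finset.mem_map_of_mem (e i) ha)
    have h2 : G.connectedComponentMk (e i a) = comp j :=
      (h j).coe_map_subset t' (htt ▸ Finset.mem_map_of_mem (e i) ha)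
    obtain rfl := comp.injective (h1.symm.trans h2)
    exact ⟨rfl, Finset.map_injective (e i) htt⟩
  have hzU : ∀ {i} {t : Finset (V' i)}, t ∈ (z i).tubes → ¬ IsUniversalTube G (t.map (e i)) :=
    fun {i} _ ht hU => notMem_tubes_of_isUniversalTube (h i) (z i)
      ((h i).isUniversalTube_map.1 hU) ht
  have hdown : ∀ i, IsComponentEmbedding.restrictTubes G (e i) T = (z i).tubes := by
    intro i
    ext t
    rw [IsComponentEmbedding.mem_restrictTubes, hT]
    constructor
    · rintro ⟨⟨j, t', ht', htt⟩ | ⟨j, -, hj⟩, hU⟩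
      · have hne : t.Nonempty := by
          rw [← Finset.map_nonempty (f := e i), ← htt, Finset.map_nonempty]
          exact ((z j).isTubing.tube t' ht').nonempty
        obtain ⟨rfl, rfl⟩ := hmap hne htt
        exact ht'
      · exact absurd (hj ▸ isUniversalTube_unionTube_singleton j) hU
    · intro ht
      exact ⟨Or.inl ⟨i, t, ht, rfl⟩, hzU ht⟩
  have hsingle : ∀ j, unionTube comp {j} ∈ T ↔ {j} ∈ z₀.tubes := by
    intro j
    rw [hT]
    constructor
    · rintro (⟨i, t, ht, hti⟩ | ⟨k, hk, hkj⟩)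
      · exact absurd (hti ▸ isUniversalTube_unionTube_singleton j) (hzU ht)
      · rwa [← unionTube_singleton_injective hkj]
    · exact fun hj => Or.inr ⟨j, hj, rfl⟩
  have hTtube : ∀ {w}, w ∈ T → IsTube G w := by
    intro w hw
    rcases (hT w).1 hw with ⟨i, t, ht, rfl⟩ | ⟨j, -, rfl⟩
    · exact (h i).isTube_map.2 ((z i).isTubing.tube t ht)
    · exact (isUniversalTube_unionTube_singleton j).isTube
  have hdown₀ : restrictUniversalTubes comp T = z₀.tubes := by
    ext t
    rw [mem_restrictUniversalTubes]
    constructor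
    · intro ht
      obtain ⟨j, rfl⟩ := exists_eq_singleton_of_isTube_unionTube (hTtube ht)
      exact (hsingle j).1 ht
    · intro ht
      obtain ⟨j, rfl⟩ := z₀.isTubing.exists_eq_singleton (Finset.mem_union_left _ ht)
      exact (hsingle j).2 ht
  have hunion : ∀ j, ((unionTube comp {j} : Finset V) : Set V) ⊆ (comp j).supp := by
    intro j
    rw [unionTube_singleton, coe_componentTube]
  have hTT : IsTubing G T := by
    refine ⟨fun w hw => hTtube hw, fun w hw w' hw' hne => ?_, ?_⟩
    · have key : ∀ {i j} {t : Finset (V' i)}, t ∈ (z i).tubes →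
          t.map (e i) ⊂ unionTube comp {j} ∨ comp i ≠ comp j := by
        intro i j t ht
        by_cases hij : i = j
        · subst hij
          refine Or.inl (Finset.ssubset_iff_subset_ne.2 ⟨?_, fun he => ?_⟩)
          · rw [unionTube_singleton, ← Finset.coe_subset, coe_componentTube]
            exact (h i).coe_map_subset t
          · exact hzU ht (he ▸ isUniversalTube_unionTube_singleton i)
        · exact Or.inr fun he => hij (comp.injective he)
      rcases (hT w).1 hw with ⟨i, t, ht, rfl⟩ | ⟨i, -, rfl⟩ <;>
        rcases (hT w').1 hw' with ⟨j, t', ht', rfl⟩ | ⟨j, -, rfl⟩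
      · by_cases hij : i = j
        · subst hij
          exact (h i).tubesCompatible_map ((z i).isTubing.compatible t ht t' ht'
            fun he => hne (he ▸ rfl))
        · exact tubesCompatible_of_subset_supp ((h i).coe_map_subset t)
            ((h j).coe_map_subset t') fun he => hij (comp.injective he)
      · rcases key (j := j) ht with hk | hk
        · exact Or.inl hk
        · exact tubesCompatible_of_subset_supp ((h i).coe_map_subset t) (hunion j) hk
      · rcases key (j := i) ht' with hk | hk
        · exact Or.inr (Or.inl hk)
        · exact tubesCompatible_of_subset_supp (hunion i) ((h j).coe_map_subset t') hk.symm
      · refine tubesCompatible_of_subset_supp (hunion i) (hunion j) fun he => hne ?_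
        rw [comp.injective he]
    · obtain ⟨s, hs, hsz⟩ := z₀.isTubing.proper
      obtain ⟨j, rfl⟩ := isUniversalTube_bot.1 hs
      exact ⟨_, isUniversalTube_unionTube_singleton j, (hsingle j).not.2 hsz⟩
  have hmem : ∀ {i} {t : Finset (V' i)}, t ∈ (z i).tubes ∪ universalTubes (G' i) ↔
      t.map (e i) ∈ T ∪ universalTubes G := by
    intro i t
    rw [← hdown, (h i).mem_restrictTubes_union]
  -- A universal tube takes its color from the null graph and its other blocks from the template of
  -- its component.
  have hblocks : ∀ w, ∃ b : Blocks κ,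
      (∀ i (t : Finset (V' i)), t.Nonempty → t.map (e i) = w →
        b = ⟨if IsUniversalTube (G' i) t then (z₀.blocks {i}).color else ((z i).blocks t).color,
          ((z i).blocks t).outer, ((z i).blocks t).inner⟩) ∧
      ((∀ i (t : Finset (V' i)), t.Nonempty → t.map (e i) ≠ w) → b = ⟨none, [], 0⟩) := by
    intro w
    by_cases hw : ∃ i, ∃ t : Finset (V' i), t.Nonempty ∧ t.map (e i) = w
    · obtain ⟨i, t, ht, rfl⟩ := hw
      refine ⟨⟨if IsUniversalTube (G' i) t then (z₀.blocks {i}).color else ((z i).blocks t).color,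
        ((z i).blocks t).outer, ((z i).blocks t).inner⟩, fun j t' ht' htt => ?_,
        fun hn => absurd rfl (hn i t ht)⟩
      obtain ⟨rfl, rfl⟩ := hmap ht htt
      rfl
    · refine ⟨⟨none, [], 0⟩, fun i t ht htw => absurd ⟨i, t, ht, htw⟩ hw, fun _ => rfl⟩
  choose b hb hb₀ using hblocks
  replace hb : ∀ {i} {t : Finset (V' i)}, t.Nonempty → b (t.map (e i)) =
      ⟨if IsUniversalTube (G' i) t then (z₀.blocks {i}).color else ((z i).blocks t).color,
        ((z i).blocks t).outer, ((z i).blocks t).inner⟩ := fun {i t} ht => hb _ i t ht rfl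
  have hTne : ∀ {i} {t : Finset (V' i)}, t.map (e i) ∈ T ∪ universalTubes G → t.Nonempty :=
    fun ht => Finset.map_nonempty.1 (hTT.isTube ht).nonempty
  have htubeU : ∀ {i} {t : Finset (V' i)}, IsUniversalTube (G' i) t →
      t.map (e i) = unionTube comp {i} := by
    intro i t ht
    rw [unionTube_singleton, ← (h i).isUniversalTube_map_iff_eq, (h i).isUniversalTube_map]
    exact ht
  have hout : ∀ {w}, w ∉ T ∪ universalTubes G → b w = ⟨none, [], 0⟩ := by
    intro w hw
    by_cases hex : ∃ i, ∃ t : Finset (V' i), t.Nonempty ∧ t.map (e i) = w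
    · obtain ⟨i, t, ht, rfl⟩ := hex
      have htz := hmem.not.2 hw
      rw [hb ht, if_neg fun hU => htz (Finset.mem_union_right _ (mem_universalTubes.2 hU)),
        (z i).blocks_eq t htz]
    · exact hb₀ w fun i t ht htw => hex ⟨i, t, ht, htw⟩
  -- The palette is left open here, so that `total` holds by definition; it is identified with `pal`
  -- once the color classes of `x` are known.
  obtain ⟨pal', x, hxT, hxb, hxu⟩ : ∃ (pal' : Multiset κ) (x : Template G pal'),
      x.tubes = T ∧ x.blocks = b ∧ x.universalBlock = z₀.universalBlock := by
    refine ⟨_, ⟨T, b, z₀.universalBlock, hTT, ?_, ?_, ?_, fun w hw => hout hw, ?_, rfl⟩, rfl, rfl,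
      rfl⟩
    · intro w
      by_cases hw : w ∈ T ∪ universalTubes G
      · obtain ⟨i, t, rfl⟩ := exists_map_eq_of_isTube h (hTT.isTube hw)
        rw [hb (hTne hw)]
        by_cases hU : IsUniversalTube (G' i) t
        · simp only [if_pos hU]
          rw [htubeU hU, z₀.color_isSome, hsingle]
        · simp only [if_neg hU]
          rw [(z i).color_isSome, ← hdown, IsComponentEmbedding.mem_restrictTubes,
            (h i).isUniversalTube_map, and_iff_left hU]
      · rw [hout hw]
        simp only [Finset.mem_union, not_or] at hw
        simp [hw.1]
    · intro w hw
      obtain ⟨i, t, rfl⟩ := exists_map_eq_of_isTube h (hTT.isTube hw)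
      rw [hb (hTne hw)]
      rw [(z i).outer_length t (hmem.2 hw)]
      have := (h i).conn_map (T := T) ((h i).isTube_map.1 (hTT.isTube hw))
      rw [hdown, conn, conn] at this
      rw [this]
    · intro w hw
      obtain ⟨i, t, rfl⟩ := exists_map_eq_of_isTube h (hTT.isTube hw)
      rw [hb (hTne hw), (h i).ncard_coreSet_map ((h i).isTube_map.1 (hTT.isTube hw)), hdown]
      exact (z i).inner_card t (hmem.2 hw)
    · rw [← card_restrictUniversalTubes comp, hdown₀, z₀.universalBlock_card,
        card_connectedComponent_bot, Nat.card_congr comp]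
  subst hxT hxb
  have hinner : ∀ i t, x.innerBlocks (t.map (e i)) = (z i).blocks t := by
    intro i t
    by_cases ht : t.map (e i) ∈ x.tubes ∪ universalTubes G
    · rw [innerBlocks, hb (hTne ht), (h i).isUniversalTube_map]
      by_cases hU : IsUniversalTube (G' i) t
      · rw [if_pos hU]
        have := ((z i).color_isSome t).not.2 (notMem_tubes_of_isUniversalTube (h i) (z i) hU)
        refine Blocks.ext ?_ rfl rfl
        rw [Blocks.uncolor]
        simpa using Eq.symm (by simpa using this : ((z i).blocks t).color = none)
      · rw [if_neg hU]
        exact Blocks.ext (if_neg hU) rfl rfl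
    · rw [innerBlocks, x.blocks_eq _ ht, (z i).blocks_eq t (hmem.not.2 ht)]
      split_ifs <;> rfl
  have hcol : ∀ j, (x.blocks (unionTube comp {j})).color = (z₀.blocks {j}).color := by
    intro j
    obtain ⟨t, ht, htU⟩ := (h j).exists_isUniversalTube
    rw [unionTube_singleton, ← ht, hb htU.isTube.nonempty]
    exact if_pos htU
  have hq : ∀ i, x.componentColors (comp i) = q i := by
    intro i
    rw [componentColors_eq, (h i).sum_filter_subset, hdown]
    refine Eq.trans ?_ (z i).total
    rw [Multiset.card_eq_zero.1 (card_eq_zero_of_isComponentEmbedding (h i) (z i)).1, add_zero]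
    refine Finset.sum_congr rfl fun t _ => ?_
    rw [← innerBlocks_colors, hinner]
  have hr : x.universalColors = r := by
    refine Eq.trans ?_ z₀.total
    rw [universalColors, hxu, sum_componentTube comp, z₀.isTubing.union_universalTubes_bot,
      sum_universalTubes_bot]
    congr 1
    refine Finset.sum_congr rfl fun j _ => ?_
    rw [← unionTube_singleton, Blocks.colors, Blocks.hidden, (z₀.blocks_bot {j}).1,
      (z₀.blocks_bot {j}).2, Blocks.visible, hcol, Blocks.visible]
    simp
  obtain rfl : pal' = pal := by
    refine (x.sum_componentColors comp).symm.trans (Eq.trans ?_ hpal)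
    rw [hr, Finset.sum_congr rfl fun i _ => hq i]
  refine ⟨x, hq, hr, fun i => Template.ext (hdown i) (funext fun t => hinner i t) ?_,
    Template.ext hdown₀ (funext fun t => ?_) hxu⟩
  · exact (Multiset.card_eq_zero.1 (card_eq_zero_of_isComponentEmbedding (h i) (z i)).1).symm
  · refine Blocks.ext ?_ (z₀.blocks_bot t).1.symm (z₀.blocks_bot t).2.symm
    by_cases ht : ∃ j, t = {j}
    · obtain ⟨j, rfl⟩ := ht
      exact hcol j
    · have h1 : unionTube comp t ∉ x.tubes := fun hmem' =>
        ht (exists_eq_singleton_of_isTube_unionTube (x.isTubing.tube _ hmem'))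
      have h2 : t ∉ z₀.tubes := fun hmem' =>
        ht (z₀.isTubing.exists_eq_singleton (Finset.mem_union_left _ hmem'))
      rw [← x.color_isSome] at h1
      rw [← z₀.color_isSome] at h2
      exact (by simpa using h1 : (x.blocks (unionTube comp t)).color = none).trans
        (by simpa using h2 : (z₀.blocks t).color = none).symm

end Template
end ColorfulGA

namespace ColorfulGA

open scoped Classical

/-! ### The order isomorphism with the product -/

namespace Template

variable {V : Type u} [Finite V] {κ : Type v} {G : SimpleGraph V} {pal : Multiset κ}
  {ι : Type*} [Finite ι] {comp : ι ≃ G.ConnectedComponent} {V' : ι → Type u}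
  [∀ i, Finite (V' i)] {G' : ∀ i, SimpleGraph (V' i)} {e : ∀ i, V' i ↪ V} {q : ι → Multiset κ}
  {r : Multiset κ} {x y : Template G pal}

/-- The tubes of `y` are among those of `x`, so some `z` above `x` has exactly these tubes. In each
factor the restrictions of `z` and `y` lie above that of `x` and have the same tubes, so they are
equal, and `z = y`. -/
theorem le_of_restrict_le (h : ∀ i, IsComponentEmbedding (G' i) G (comp i) (e i))
    (hx : ∀ i, x.componentColors (comp i) = q i) (hy : ∀ i, y.componentColors (comp i) = q i)
    (hx' : x.universalColors = r) (hy' : y.universalColors = r)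
    (hr : ∀ i, restrict (h i) x (hx i) ≤ restrict (h i) y (hy i))
    (hr' : restrictUniversal comp x hx' ≤ restrictUniversal comp y hy') : x ≤ y := by
  have hsub : y.tubes ⊆ x.tubes := by
    intro w hw
    obtain ⟨i, t, rfl⟩ := exists_map_eq_of_isTube h (y.isTubing.tube w hw)
    by_cases hU : IsUniversalTube G (t.map (e i))
    · obtain ⟨j, hj⟩ := exists_unionTube_of_isUniversalTube comp hU
      rw [← hj] at hw ⊢
      exact mem_restrictUniversalTubes.1
        ((isBooleanAbove _ _).subset hr' (mem_restrictUniversalTubes.2 hw))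
    · exact (IsComponentEmbedding.mem_restrictTubes.1 ((isBooleanAbove _ _).subset (hr i)
        (IsComponentEmbedding.mem_restrictTubes.2 ⟨hw, hU⟩))).1
  obtain ⟨z, hxz, hz⟩ := (isBooleanAbove G pal).exists_above x hsub
  have hzq : ∀ i, z.componentColors (comp i) = q i := fun i =>
    (componentColors_eq_of_le hxz _).symm.trans (hx i)
  have hzr : z.universalColors = r := (universalColors_eq_of_le hxz).symm.trans hx'
  rwa [eq_of_restrict_eq h hzq hy hzr hy'
    (fun i => (isBooleanAbove _ _).eq_of_eq (restrict_mono (h i) (hx i) (hzq i) hxz) (hr i)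
      (congrArg (IsComponentEmbedding.restrictTubes G (e i)) hz))
    ((isBooleanAbove _ _).eq_of_eq (restrictUniversal_mono comp hx' hzr hxz) hr'
      (congrArg (restrictUniversalTubes comp) hz))] at hxz

end Template

variable {V : Type u} [Finite V] {κ : Type v} {G : SimpleGraph V} {pal : Multiset κ} {m : ℕ}
  {comp : Fin m ≃ G.ConnectedComponent}

theorem exists_orderIso_subcollection {V' : Fin m → Type u} [∀ i, Finite (V' i)]
    {G' : ∀ i, SimpleGraph (V' i)} {e : ∀ i, V' i ↪ V}
    (h : ∀ i, IsComponentEmbedding (G' i) G (comp i) (e i)) (p : PalettePartition comp pal) :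
    Nonempty ({x : Template G pal // (Quot.mk _ x : Component (Template G pal)) ∈ subcollection p}
      ≃o (∀ i, Template (G' i) (p.part i)) × Template (⊥ : SimpleGraph (Fin m)) p.last) := by
  have hc := fun x : {x : Template G pal //
    (Quot.mk _ x : Component (Template G pal)) ∈ subcollection p} =>
      (Template.mk_mem_subcollection_iff x.1).1 x.2
  let f : {x : Template G pal // (Quot.mk _ x : Component (Template G pal)) ∈ subcollection p} →
      (∀ i, Template (G' i) (p.part i)) × Template (⊥ : SimpleGraph (Fin m)) p.last :=
    fun x => (fun i => x.1.restrict (h i) ((hc x).1 i), x.1.restrictUniversal comp (hc x).2)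
  have hf : Function.Bijective f := by
    constructor
    · intro x y hxy
      rw [Prod.ext_iff, funext_iff] at hxy
      exact Subtype.ext (Template.eq_of_restrict_eq h (hc x).1 (hc y).1 (hc x).2 (hc y).2
        hxy.1 hxy.2)
    · rintro ⟨z, z₀⟩
      obtain ⟨x, hq, hr, hz, hz₀⟩ := Template.exists_restrict_eq h z z₀ p.total
      exact ⟨⟨x, (Template.mk_mem_subcollection_iff x).2 ⟨hq, hr⟩⟩, Prod.ext (funext hz) hz₀⟩
  exact ⟨{
    toEquiv := Equiv.ofBijective f hf
    map_rel_iff' := by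
      intro x y
      constructor
      · rintro ⟨h1, h2⟩
        exact Template.le_of_restrict_le h (hc x).1 (hc y).1 (hc x).2 (hc y).2 h1 h2
      · intro hxy
        exact ⟨fun i => Template.restrict_mono (h i) ((hc x).1 i) ((hc y).1 i) hxy,
          Template.restrictUniversal_mono comp (hc x).2 (hc y).2 hxy⟩ }⟩

theorem isComponentEmbedding_subtype {V : Type u} {G : SimpleGraph V} (C : G.ConnectedComponent) :
    IsComponentEmbedding C.toSimpleGraph G C (Function.Embedding.subtype (· ∈ C)) where
  adj_iff _ _ := Iff.rfl
  mem_supp_iff v := ⟨fun hv => ⟨⟨v, hv⟩, rfl⟩, by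
    rintro ⟨a, rfl⟩
    exact a.2⟩

end ColorfulGA

theorem theorem5p3 {V : Type u} [Finite V] [Nonempty V] {κ : Type v} (G : SimpleGraph V)
    (pal : Multiset κ) (hpal : pal.card = Nat.card V - 1)
    {m : ℕ} (comp : Fin m ≃ G.ConnectedComponent) :
    -- every member of the collection is a simple abstract polytope
    (∀ C : ColorfulGA.Component (ColorfulGA.Template G pal),
      ColorfulGA.IsAbstractPolytope (ColorfulGA.FacePoset C) (Nat.card V - 1) ∧
      ColorfulGA.IsSimplePolytope (ColorfulGA.FacePoset C) (Nat.card V - 1)) ∧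
    -- every member belongs to exactly one ordered partition of the palette
    (∀ C : ColorfulGA.Component (ColorfulGA.Template G pal),
      ∃! p : ColorfulGA.PalettePartition comp pal, C ∈ ColorfulGA.subcollection p) ∧
    -- the members that belong to a given ordered partition are, one by one, the Cartesian
    -- products (products of the posets without least faces, with a least face appended)
    -- of the members of the collections of the components and of the null graph
    (∀ p : ColorfulGA.PalettePartition comp pal,
      (ColorfulGA.subcollection p).Nonempty ∧
      ∃ e : ColorfulGA.subcollection p ≃
          (∀ i, ColorfulGA.Component
            (ColorfulGA.Template (comp i).toSimpleGraph (p.part i))) ×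
          ColorfulGA.Component (ColorfulGA.Template (⊥ : SimpleGraph (Fin m)) p.last),
        ∀ C : ColorfulGA.subcollection p,
          Nonempty (ColorfulGA.FacePoset C.1 ≃o
            WithBot ((∀ i, ColorfulGA.Faces ((e C).1 i)) × ColorfulGA.Faces (e C).2))) := by
  -- The rank enters the general results as the number of colors of the palette.
  rw [← hpal]
  refine ⟨ColorfulGA.Template.isPolytope_facePoset,
    ColorfulGA.Template.existsUnique_mem_subcollection comp, fun p => ⟨?_, ?_⟩⟩
  · obtain ⟨x, hx⟩ := ColorfulGA.Template.exists_hasColors p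
    exact ⟨_, (ColorfulGA.Template.mk_mem_subcollection_iff x).2 hx⟩
  · obtain ⟨Φ⟩ := ColorfulGA.exists_orderIso_subcollection
      (fun i => ColorfulGA.isComponentEmbedding_subtype (comp i)) p
    exact ColorfulGA.exists_equiv_of_orderIso (ColorfulGA.Template.isBooleanAbove _ _)
      (ColorfulGA.Template.isBooleanAbove _ _)
      (fun i => ColorfulGA.Template.isBooleanAbove _ _) _ Φ
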